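/- A tournament $D$ is a digraph without loops on a vertex set $V(D)$ of arbitrary (finite or infinite) cardinality such that for all $u\neq v$ in $V(D)$ exactly one of $uv$, $vu$ is an arc; $A(D)$ denotes its set of arcs. For a (finite) directed cycle $C$ of a digraph $D$, let $D^{C}$ be the digraph on $V(D)$ with arc set $(A(D)\setminus A(C))\cup\{vu : uv\in A(C)\}$. A transfinite sequence $\mathcal C=\langle C_\xi:\xi<\alpha\rangle$ ($\alpha$ an ordinal) is a reversal sequence of $D$, written $\mathcal C\in \mathrm{rs}(D)$, if (i) it is locally finite: each arc $uv$ lies on $C_\xi$ for only finitely many indices $\xi<\alpha$; and (ii) for every $\xi<\alpha$, $C_\xi$ is a directed cycle of $D_\xi$, where the digraphs $D_\xi$ ($\xi\le\alpha$) on $V(D)$ are defined by $D_0=D$, $D_{\xi+1}=(D_\xi)^{C_\xi}$, and, for limit $\zeta$, $uv\in A(D_\zeta)$ iff there is $\nu<\zeta$ such that $uv\in A(D_\xi)$ for all $\nu<\xi<\zeta$. The reversed digraph is $D^{\mathcal C}=D_\alpha$. A set of vertices is acyclic if the subdigraph induced on it contains no directed cycle, and the dichromatic number of a digraph is the least cardinality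 of a family of acyclic vertex sets covering its vertex set. **Theorem.** For every (finite or infinite) tournament $D$ there is $\mathcal C\in\mathrm{rs}(D)$ such that the dichromatic number of $D^{\mathcal C}$ is at most $2$. -/

import Mathlib

universe u

namespace CycleReversion

/-- A tournament on the vertex set `V`: no loops, and for any two distinct vertices `x`, `y`
exactly one of the arcs `xy`, `yx` is present. -/
structure IsTournament {V : Type u} (D : Digraph V) : Prop where
  loopless : ∀ x, ¬ D.Adj x x
  exactly_one : ∀ x y, x ≠ y → (D.Adj x y ↔ ¬ D.Adj y x)

/-- `xy` is an arc of the cyclic sequence of vertices `c`: some rotation of `c` starts with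
`x, y`.  (Only used for cycles without repetitions on at least three vertices.) -/
def IsArcOf {V : Type u} (c : Cycle V) (x y : V) : Prop :=
  ∃ l : List V, c = ((x :: y :: l : List V) : Cycle V)

/-- `c` is a directed cycle of `D`: a cyclic sequence of distinct vertices in which each vertex
is followed by one of its out-neighbours.  Digraphs here are oriented simple graphs (no loops, no
pair of opposite arcs), so a directed cycle has at least three vertices. -/
def IsDirectedCycle {V : Type u} (D : Digraph V) (c : Cycle V) : Prop :=
  c.Nodup ∧ 3 ≤ c.length ∧ c.Chain D.Adj

/-- The digraph obtained from `D` by reversing all the arcs of the cycle `c`. -/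
def reverseCycle {V : Type u} (D : Digraph V) (c : Cycle V) : Digraph V where
  Adj x y := (D.Adj x y ∧ ¬ IsArcOf c x y) ∨ IsArcOf c y x

/-- A transfinite sequence of cyclic sequences of vertices, indexed by the ordinals
`ξ < length`; the values of `cycle` at other ordinals are irrelevant. -/
structure CycleSeq (V : Type u) : Type (u + 1) where
  length : Ordinal.{u}
  cycle : Ordinal.{u} → Cycle V

/-- The digraph obtained from `D` by reversing one after the other the cycles `C ξ`, `ξ < α`.
At a limit step, `xy` is an arc iff it is an arc at all sufficiently late earlier stages. -/
noncomputable def stage {V : Type u} (D : Digraph V) (C : Ordinal.{u} → Cycle V)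
    (α : Ordinal.{u}) : Digraph V :=
  Ordinal.limitRecOn (motive := fun _ => Digraph V) α D
    (fun ξ G => reverseCycle G (C ξ))
    (fun ζ _ G => ⟨fun x y => ∃ ν < ζ, ∀ ξ (h : ξ < ζ), ν < ξ → (G ξ h).Adj x y⟩)

theorem stage_zero {V : Type u} (D : Digraph V) (C : Ordinal.{u} → Cycle V) :
    stage D C 0 = D :=
  Ordinal.limitRecOn_zero ..

theorem stage_add_one {V : Type u} (D : Digraph V) (C : Ordinal.{u} → Cycle V)
    (α : Ordinal.{u}) : stage D C (α + 1) = reverseCycle (stage D C α) (C α) :=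
  Ordinal.limitRecOn_add_one ..

theorem stage_limit_adj {V : Type u} (D : Digraph V) (C : Ordinal.{u} → Cycle V)
    (ζ : Ordinal.{u}) (hζ : Order.IsSuccLimit ζ) (x y : V) :
    (stage D C ζ).Adj x y ↔ ∃ ν < ζ, ∀ ξ, ξ < ζ → ν < ξ → (stage D C ξ).Adj x y := by
  have h : stage D C ζ = ⟨fun x y => ∃ ν < ζ, ∀ ξ, ξ < ζ → ν < ξ → (stage D C ξ).Adj x y⟩ :=
    Ordinal.limitRecOn_limit _ _ _ _ hζ
  rw [h]

/-- `rs(D)`, the set of reversal sequences of `D`: each cycle in the sequence is a directed cycle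
of the digraph obtained by reversing all the previous ones, and the sequence is locally finite,
i.e. each arc occurs in only finitely many terms of the sequence. -/
def reversalSequences {V : Type u} (D : Digraph V) : Set (CycleSeq V) :=
  {S | (∀ ξ < S.length, IsDirectedCycle (stage D S.cycle ξ) (S.cycle ξ)) ∧
    ∀ x y : V, {ξ | ξ < S.length ∧ IsArcOf (S.cycle ξ) x y}.Finite}

/-- The digraph obtained from `D` by reversing the whole sequence `S`. -/
noncomputable def reversed {V : Type u} (D : Digraph V) (S : CycleSeq V) : Digraph V :=
  stage D S.cycle S.length

/-- A set `W` of vertices is acyclic if the induced subdigraph on `W` has no directed cycle. -/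
def IsAcyclicSet {V : Type u} (D : Digraph V) (W : Set V) : Prop :=
  ∀ c : Cycle V, IsDirectedCycle D c → ¬ ∀ x ∈ c, x ∈ W

/-- The dichromatic number of `D`: the least number of acyclic vertex sets covering `D`. -/
noncomputable def dichromaticNumber {V : Type u} (D : Digraph V) : Cardinal.{u} :=
  sInf {κ | ∃ F : Set (Set V), (∀ W ∈ F, IsAcyclicSet D W) ∧ ⋃₀ F = Set.univ ∧
    Cardinal.mk F = κ}

end CycleReversion

/-! In a tournament, reversing a directed cycle flips a set of unordered pairs, and flips compose by
symmetric difference. A locally finite sequence is therefore recorded by the set `S` of pairs it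
reverses an odd number of times, together with a set `T` containing every pair it touches, which
keeps local finiteness under control (`Reach`). Strong components can be treated independently
(`Reducible.of_strongComponents`).

Finite case: order the vertices by non-increasing score and split them by parity of position. Cycle
reversals preserve scores, and a counting argument over cuts (`score_cut_inequality`) puts each
backward arc between vertices of equal parity on a balanced set of arcs whose reversal repairs it
without creating new ones. In the end both parity classes are transitive.

Infinite case: an arc `vu` that closes cycles with infinitely many arc-disjoint paths from `u` to
`v` can be reversed alone. It is reversed together with the first path; each later path is then used
to restore the preceding one, and in the limit every path is back in place (`Reach.of_returns`,
`Reach.of_family`). So between highly connected pairs the arcs can be made to follow a linear order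
`p` that extends the strict part of the connectivity relation.

If `V` is countable and highly connected means not separable by finitely many arcs, each strong
component afterwards either follows `p` or is thin. A thin tournament has a cut with finitely many
leaving arcs, in-finite on one side and out-finite on the other. The leaving arcs are removed by
moving finite sets across or reversing double rays; an out-finite countable tournament is broken
into finite strong components by reversing rays.

If `V` is uncountable, it is filtered by smaller sets that contain separators for their own
separable pairs, and the connectivity required of a pair grows with its level. A strong component of
bounded rank is smaller than `V` and falls to induction on cardinality; one of unbounded rank
follows `p`, because excursions above a level certify connectivity at that level. -/

namespace CycleReversion

open Set

/-! ### Reversing a set of unordered pairs -/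

section Toggle

variable {V : Type u}

/-- The digraph obtained from `D` by reversing all arcs between pairs of vertices in `S`. -/
def toggle (D : Digraph V) (S : Set (Sym2 V)) : Digraph V where
  Adj x y := (s(x, y) ∈ S ∧ D.Adj y x) ∨ (s(x, y) ∉ S ∧ D.Adj x y)

theorem toggle_adj_of_mem {D : Digraph V} {S : Set (Sym2 V)} {x y : V} (h : s(x, y) ∈ S) :
    (toggle D S).Adj x y ↔ D.Adj y x := by
  simp [toggle, h]

theorem toggle_adj_of_notMem {D : Digraph V} {S : Set (Sym2 V)} {x y : V} (h : s(x, y) ∉ S) :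
    (toggle D S).Adj x y ↔ D.Adj x y := by
  simp [toggle, h]

theorem toggle_empty (D : Digraph V) : toggle D ∅ = D := by
  ext x y; simp [toggle]

theorem toggle_toggle (D : Digraph V) (S S' : Set (Sym2 V)) :
    toggle (toggle D S) S' = toggle D (symmDiff S S') := by
  ext x y
  have e : s(y, x) = s(x, y) := Sym2.eq_swap
  by_cases h : s(x, y) ∈ S <;> by_cases h' : s(x, y) ∈ S' <;>
    simp [toggle, h, h', e, Set.mem_symmDiff]

theorem IsTournament.toggle {D : Digraph V} (hD : IsTournament D) (S : Set (Sym2 V)) :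
    IsTournament (toggle D S) where
  loopless x := by
    by_cases h : s(x, x) ∈ S <;> simp [CycleReversion.toggle, h, hD.loopless]
  exactly_one x y hxy := by
    have e : s(y, x) = s(x, y) := Sym2.eq_swap
    have := hD.exactly_one x y hxy
    by_cases h : s(x, y) ∈ S <;> simp [CycleReversion.toggle, h, e] <;> tauto

theorem IsTournament.asymm {D : Digraph V} (hD : IsTournament D) {x y : V} (h : D.Adj x y) :
    ¬ D.Adj y x := by
  have hxy : x ≠ y := by rintro rfl; exact hD.loopless _ h
  exact (hD.exactly_one x y hxy).1 h

theorem IsTournament.ne {D : Digraph V} (hD : IsTournament D) {x y : V} (h : D.Adj x y) :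
    x ≠ y := by
  rintro rfl; exact hD.loopless _ h

theorem IsTournament.adj_or {D : Digraph V} (hD : IsTournament D) {x y : V} (h : x ≠ y) :
    D.Adj x y ∨ D.Adj y x := by
  by_cases h' : D.Adj y x
  · exact Or.inr h'
  · exact Or.inl ((hD.exactly_one x y h).2 h')

end Toggle

/-! ### Arcs of a cycle and cycle reversal as a toggle -/

section Cycles

variable {V : Type u}

/-- The unordered pairs of consecutive vertices of a cycle. -/
def cycleEdges (c : Cycle V) : Set (Sym2 V) :=
  {p | ∃ x y, IsArcOf c x y ∧ p = s(x, y)}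

theorem mem_cycleEdges {c : Cycle V} {x y : V} :
    s(x, y) ∈ cycleEdges c ↔ IsArcOf c x y ∨ IsArcOf c y x := by
  constructor
  · rintro ⟨a, b, h, e⟩
    rcases Sym2.eq_iff.1 e with ⟨rfl, rfl⟩ | ⟨rfl, rfl⟩
    · exact Or.inl h
    · exact Or.inr h
  · rintro (h | h)
    · exact ⟨x, y, h, rfl⟩
    · exact ⟨y, x, h, Sym2.eq_swap⟩

theorem rel_of_isArcOf {r : V → V → Prop} {c : Cycle V} (h : c.Chain r) {x y : V}
    (hxy : IsArcOf c x y) : r x y := by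
  obtain ⟨l, rfl⟩ := hxy
  rw [Cycle.chain_coe_cons] at h
  simp only [List.cons_append, List.isChain_cons_cons] at h
  exact h.1

theorem exists_isArcOf_of_mem {c : Cycle V} (hc : 2 ≤ c.length) {x : V} (hx : x ∈ c) :
    ∃ y, IsArcOf c x y := by
  induction c using Quotient.inductionOn' with | h l =>
  have hx' : x ∈ l := hx
  obtain ⟨a, b, rfl⟩ := List.append_of_mem hx'
  have e : ((a ++ x :: b : List V) : Cycle V) = ((x :: (b ++ a) : List V) : Cycle V) := by
    rw [Cycle.coe_eq_coe]
    have := List.IsRotated.symm (List.isRotated_append (l := x :: b) (l' := a))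
    simpa using this
  have hl : 2 ≤ (x :: (b ++ a)).length := by
    have : 2 ≤ (a ++ x :: b).length := hc
    simp at this ⊢; omega
  obtain ⟨y, l', hl'⟩ : ∃ y l', b ++ a = y :: l' := by
    cases h : b ++ a with
    | nil => rw [h] at hl; simp at hl
    | cons y l' => exact ⟨y, l', rfl⟩
  refine ⟨y, l', ?_⟩
  rw [← hl', ← e]; rfl

theorem IsArcOf.mem {c : Cycle V} {x y : V} (h : IsArcOf c x y) : x ∈ c ∧ y ∈ c := by
  obtain ⟨l, rfl⟩ := h
  simp

theorem finite_cycle_mem (c : Cycle V) : {x | x ∈ c}.Finite := by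
  induction c using Quotient.inductionOn' with | h l =>
  exact l.finite_toSet

/-- In a tournament no arc of a directed cycle has its opposite present, so the two clauses of
`reverseCycle` amount to flipping pairs. This makes the order of reversals irrelevant for the
outcome; it matters only for each cycle being directed in its turn. -/
theorem reverseCycle_eq_toggle {D : Digraph V} (hD : IsTournament D) {c : Cycle V}
    (hc : IsDirectedCycle D c) : reverseCycle D c = toggle D (cycleEdges c) := by
  have h {x y : V} (h : IsArcOf c x y) : D.Adj x y := rel_of_isArcOf hc.2.2 h
  have h2 {x y : V} (hxy : IsArcOf c x y) : ¬ D.Adj y x := hD.asymm (h hxy)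
  ext x y
  by_cases h1 : IsArcOf c x y
  · have h3 : ¬ IsArcOf c y x := fun h' => h2 h1 (h h')
    rw [toggle_adj_of_mem (mem_cycleEdges.2 (Or.inl h1))]
    simp [reverseCycle, h1, h3, h2 h1]
  · by_cases h3 : IsArcOf c y x
    · rw [toggle_adj_of_mem (mem_cycleEdges.2 (Or.inr h3))]
      simp [reverseCycle, h3, h h3]
    · rw [toggle_adj_of_notMem (by rw [mem_cycleEdges]; tauto)]
      simp [reverseCycle, h1, h3]

end Cycles

/-! ### Calculus of locally finite well-ordered sequences -/

section Reach

variable {V : Type u}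

/-- The pairs that belong to `S w` for an odd number of indices `w ∈ A`. -/
def oddSet {W : Type*} (S : W → Set (Sym2 V)) (A : Set W) : Set (Sym2 V) :=
  {p | Odd {w | w ∈ A ∧ p ∈ S w}.ncard}

theorem oddSet_of_subsingleton {W : Type*} {S : W → Set (Sym2 V)} {A : Set W}
    (h : ∀ p w w', w ∈ A → w' ∈ A → p ∈ S w → p ∈ S w' → w = w') :
    oddSet S A = ⋃ w ∈ A, S w := by
  ext p
  simp only [oddSet, mem_ofPred_eq, mem_iUnion]
  rcases Set.eq_empty_or_nonempty {w | w ∈ A ∧ p ∈ S w} with h0 | ⟨w, hw⟩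
  · rw [h0]
    simp only [ncard_empty, Nat.not_odd_zero, false_iff]
    rintro ⟨w, hw, hp⟩
    exact (h0 ▸ (show w ∈ {w | w ∈ A ∧ p ∈ S w} from ⟨hw, hp⟩) : w ∈ (∅ : Set W))
  · have : {w | w ∈ A ∧ p ∈ S w} = {w} := by
      ext w'
      constructor
      · intro hw'; exact h p w' w hw'.1 hw.1 hw'.2 hw.2
      · rintro rfl; exact hw
    rw [this]
    simp only [ncard_singleton, odd_one, true_iff]
    exact ⟨w, hw.1, hw.2⟩

theorem oddSet_empty {W : Type*} (S : W → Set (Sym2 V)) : oddSet S ∅ = ∅ := by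
  ext p; simp [oddSet]

/-- Finiteness is essential here: `ncard` of an infinite set is `0`, so parity is meaningful only
for locally finite families. -/
theorem oddSet_insert {W : Type*} {S : W → Set (Sym2 V)} {A : Set W} {a : W} (ha : a ∉ A)
    (hfin : ∀ p, {w | p ∈ S w}.Finite) :
    oddSet S (insert a A) = symmDiff (oddSet S A) (S a) := by
  ext p
  have hf : {w | w ∈ A ∧ p ∈ S w}.Finite := (hfin p).subset fun w hw => hw.2
  by_cases hp : p ∈ S a
  · have : {w | w ∈ insert a A ∧ p ∈ S w} = insert a {w | w ∈ A ∧ p ∈ S w} := by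
      ext w
      simp only [mem_insert_iff, mem_ofPred_eq]
      constructor
      · rintro ⟨rfl | h, h'⟩
        · exact Or.inl rfl
        · exact Or.inr ⟨h, h'⟩
      · rintro (rfl | h)
        · exact ⟨Or.inl rfl, hp⟩
        · exact ⟨Or.inr h.1, h.2⟩
    simp only [oddSet, Set.mem_symmDiff, mem_ofPred_eq, this,
      ncard_insert_of_notMem (fun h => ha h.1) hf, Nat.odd_add_one, hp]
    tauto
  · have : {w | w ∈ insert a A ∧ p ∈ S w} = {w | w ∈ A ∧ p ∈ S w} := by
      ext w
      simp only [mem_insert_iff, mem_ofPred_eq]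
      constructor
      · rintro ⟨rfl | h, h'⟩
        · exact absurd h' hp
        · exact ⟨h, h'⟩
      · rintro h; exact ⟨Or.inr h.1, h.2⟩
    simp only [oddSet, Set.mem_symmDiff, mem_ofPred_eq, this, hp]
    tauto

/-- The parity of the size of a finite set is the parity of the number of odd fibres of a map. -/
theorem odd_ncard_iff_fibers {J I : Type*} {Z : Set J} (hZ : Z.Finite) (f : J → I) :
    Odd Z.ncard ↔ Odd {i | Odd {z | z ∈ Z ∧ f z = i}.ncard}.ncard := by
  classical
  lift Z to Finset J using hZ
  have h1 : ∀ i, {z | z ∈ (Z : Set J) ∧ f z = i}.ncard = (Z.filter fun z => f z = i).card := by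
    intro i
    rw [← ncard_coe_finset]
    congr 1
    ext z; simp
  rw [ncard_coe_finset, Finset.card_eq_sum_card_image f Z, Finset.odd_sum_iff_odd_card_odd]
  rw [← ncard_coe_finset]
  have : (↑({x ∈ Finset.image f Z | Odd (Finset.card {z ∈ Z | f z = x})}) : Set I) =
      {i | Odd {z | z ∈ (Z : Set J) ∧ f z = i}.ncard} := by
    ext i
    simp only [h1]
    simp only [Finset.coe_filter, Finset.mem_image, mem_ofPred_eq, and_iff_right_iff_imp]
    intro h
    obtain ⟨z, hz⟩ := Finset.card_pos.1 h.pos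
    rw [Finset.mem_filter] at hz
    exact ⟨z, hz⟩
  rw [this]

/-- `D` can be transformed by a locally finite, well-ordered sequence of reversals of directed
cycles, all of whose edges lie in `T`, into the digraph obtained by reversing the pairs in `S`. -/
def Reach (D : Digraph V) (S T : Set (Sym2 V)) : Prop :=
  ∃ (W : Type u) (_ : LinearOrder W) (_ : WellFoundedLT W) (c : W → Cycle V),
    (∀ p, {w | p ∈ cycleEdges (c w)}.Finite) ∧
    (∀ w, IsDirectedCycle (toggle D (oddSet (fun w => cycleEdges (c w)) (Iio w))) (c w)) ∧
    S = oddSet (fun w => cycleEdges (c w)) univ ∧ ∀ w, cycleEdges (c w) ⊆ T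

theorem Reach.mono {D : Digraph V} {S T T' : Set (Sym2 V)} (h : Reach D S T) (hT : T ⊆ T') :
    Reach D S T' := by
  obtain ⟨W, i1, i2, c, h1, h2, h3, h4⟩ := h
  exact ⟨W, i1, i2, c, h1, h2, h3, fun w => (h4 w).trans hT⟩

theorem Reach.subset {D : Digraph V} {S T : Set (Sym2 V)} (h : Reach D S T) : S ⊆ T := by
  obtain ⟨W, i1, i2, c, h1, h2, rfl, h4⟩ := h
  intro p hp
  have : {w | w ∈ univ ∧ p ∈ cycleEdges (c w)}.ncard ≠ 0 := by
    intro h0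
    simp only [oddSet, mem_ofPred_eq] at hp
    rw [h0] at hp
    simp at hp
  obtain ⟨w, hw⟩ := nonempty_of_ncard_ne_zero this
  exact h4 w hw.2

theorem Reach.refl (D : Digraph V) (T : Set (Sym2 V)) : Reach D ∅ T := by
  refine ⟨PEmpty, inferInstance, inferInstance, fun w => w.elim, fun p => toFinite _,
    fun w => w.elim, ?_, fun w => w.elim⟩
  ext p
  simp [oddSet, Set.eq_empty_of_isEmpty]

theorem Reach.single {D : Digraph V} {c : Cycle V} (hc : IsDirectedCycle D c) :
    Reach D (cycleEdges c) (cycleEdges c) := by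
  refine ⟨PUnit, inferInstance, inferInstance, fun _ => c, fun p => toFinite _, fun w => ?_, ?_,
    fun _ => subset_rfl⟩
  · have : Iio w = ∅ := by ext; simp
    rw [this, oddSet_empty, toggle_empty]
    exact hc
  · rw [oddSet_of_subsingleton (fun _ _ _ _ _ _ _ => Subsingleton.elim _ _)]
    ext p; simp

theorem wellFoundedLT_sigmaLex {I : Type*} {W : I → Type*} [LinearOrder I] [WellFoundedLT I]
    [∀ i, LinearOrder (W i)] [∀ i, WellFoundedLT (W i)] : WellFoundedLT (Σₗ i, W i) := by
  constructor
  have h : WellFounded (PSigma.Lex (fun a b : I => a < b) (fun i (a b : W i) => a < b)) :=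
    ⟨fun a => PSigma.lexAccessible (wellFounded_lt.apply a.1) (fun i => wellFounded_lt) a.2⟩
  refine Subrelation.wf (r := InvImage (PSigma.Lex (fun a b : I => a < b)
    (fun i (a b : W i) => a < b)) (fun z : Sigma W => ⟨z.1, z.2⟩)) ?_ (InvImage.wf _ h)
  intro a b hab
  have hab' : Sigma.Lex (fun a b : I => a < b) (fun i (a b : W i) => a < b) a b := hab
  cases hab' with
  | left _ _ h => exact PSigma.Lex.left _ _ h
  | right _ _ h => exact PSigma.Lex.right _ h

/-- Concatenation along a well-order, indexed by the lexicographic sum. Local finiteness is asked of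
the sets `T i` because `S i` forgets pairs reversed an even number of times: a pair lies in finitely
many `T i`, and each block touches it finitely often. -/
theorem Reach.comp {D : Digraph V} {I : Type u} [LinearOrder I] [WellFoundedLT I]
    {S T : I → Set (Sym2 V)} (hfin : ∀ p, {i | p ∈ T i}.Finite)
    (h : ∀ i, Reach (toggle D (oddSet S (Iio i))) (S i) (T i)) :
    Reach D (oddSet S univ) (⋃ i, T i) := by
  have hST : ∀ i, S i ⊆ T i := fun i => (h i).subset
  have hSfin : ∀ p, {i | p ∈ S i}.Finite := fun p => (hfin p).subset fun i hi => hST i hi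
  choose W lo wf c hcfin hdir hS hT using h
  let e : (Σ i, W i) → Set (Sym2 V) := fun z => cycleEdges (c z.1 z.2)
  have hZfin : ∀ p, {z : Σ i, W i | p ∈ e z}.Finite := by
    intro p
    have : {z : Σ i, W i | p ∈ e z} ⊆
        ⋃ i ∈ {i | p ∈ T i}, (Sigma.mk i) '' {w | p ∈ cycleEdges (c i w)} := by
      rintro ⟨i, w⟩ hz
      simp only [mem_iUnion]
      exact ⟨i, hT i w hz, w, hz, rfl⟩
    exact ((hfin p).biUnion fun i _ => (hcfin i p).image _).subset this
  have hfib : ∀ (A : Set (Σ i, W i)) (i : I) (p : Sym2 V),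
      {z | z ∈ {z | z ∈ A ∧ p ∈ e z} ∧ z.1 = i}.ncard =
        {w : W i | (⟨i, w⟩ : Σ i, W i) ∈ A ∧ p ∈ cycleEdges (c i w)}.ncard := by
    intro A i p
    rw [← ncard_image_of_injective _ (sigma_mk_injective (i := i))]
    congr 1
    ext ⟨j, w⟩
    constructor
    · rintro ⟨⟨h1, h2⟩, rfl⟩
      exact ⟨w, ⟨h1, h2⟩, rfl⟩
    · rintro ⟨w', ⟨h1, h2⟩, h3⟩
      cases h3
      exact ⟨⟨h1, h2⟩, rfl⟩
  have hfull : ∀ (i : I) (p : Sym2 V), Odd {w : W i | p ∈ cycleEdges (c i w)}.ncard ↔ p ∈ S i := by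
    intro i p
    rw [hS i]
    simp [oddSet]
  refine ⟨Σₗ i, W i, Sigma.Lex.linearOrder, wellFoundedLT_sigmaLex, fun z => c z.1 z.2,
    hZfin, ?_, ?_, ?_⟩
  · rintro ⟨i, w⟩
    -- The predecessors of `(i, w)` are the full fibres over `j < i`, contributing `S j`, and the
    -- segment below `w` in the fibre over `i`. Counting parities fibre by fibre gives the symmetric
    -- difference.
    have key : oddSet e {z | Sigma.Lex (· < ·) (fun i (a b : W i) => a < b) z ⟨i, w⟩} =
        symmDiff (oddSet S (Iio i)) (oddSet (fun w => cycleEdges (c i w)) (Iio w)) := by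
      set A : Set (Σ i, W i) := {z | Sigma.Lex (· < ·) (fun i (a b : W i) => a < b) z ⟨i, w⟩}
      have hA1 : ∀ j (w' : W j), j < i → (⟨j, w'⟩ : Σ i, W i) ∈ A := fun j w' hj =>
        Sigma.Lex.left _ _ hj
      have hA2 : ∀ (w' : W i), (⟨i, w'⟩ : Σ i, W i) ∈ A ↔ w' < w := by
        intro w'
        constructor
        · intro h
          have h : Sigma.Lex (· < ·) (fun i (a b : W i) => a < b)
            (⟨i, w'⟩ : Σ i, W i) ⟨i, w⟩ := h
          rw [Sigma.lex_iff] at h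
          rcases h with h | ⟨_, h⟩
          · exact absurd h (lt_irrefl _)
          · exact h
        · intro h; exact Sigma.Lex.right _ _ h
      have hA3 : ∀ j (w' : W j), i < j → (⟨j, w'⟩ : Σ i, W i) ∉ A := by
        intro j w' hj h
        have h : Sigma.Lex (· < ·) (fun i (a b : W i) => a < b)
            (⟨j, w'⟩ : Σ i, W i) ⟨i, w⟩ := h
        rw [Sigma.lex_iff] at h
        rcases h with h | ⟨h, _⟩
        · exact lt_asymm h hj
        · exact hj.ne h.symm
      ext p
      have hset : {j | Odd {z | z ∈ {z | z ∈ A ∧ p ∈ e z} ∧ z.1 = j}.ncard} =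
          {j | j ∈ Iio i ∧ p ∈ S j} ∪
            {j | j = i ∧ p ∈ oddSet (fun w => cycleEdges (c i w)) (Iio w)} := by
        ext j
        rw [mem_ofPred_eq, hfib]
        rcases lt_trichotomy j i with hj | rfl | hj
        · simp only [hA1 _ _ hj, true_and, hfull, mem_union, mem_ofPred_eq, mem_Iio, hj, hj.ne,
            false_and, or_false]
        · simp only [hA2, mem_union, mem_ofPred_eq, mem_Iio, lt_irrefl, false_and, false_or,
            true_and, oddSet]
        · simp [hA3 _ _ hj, hj.ne', hj.not_gt]
      have hf : {j | j ∈ Iio i ∧ p ∈ S j}.Finite := (hSfin p).subset fun j hj => hj.2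
      have : p ∈ oddSet e A ↔ Odd ({j | j ∈ Iio i ∧ p ∈ S j} ∪
            {j | j = i ∧ p ∈ oddSet (fun w => cycleEdges (c i w)) (Iio w)}).ncard := by
        rw [← hset]
        exact odd_ncard_iff_fibers ((hZfin p).subset fun z hz => hz.2) _
      rw [this, Set.mem_symmDiff]
      by_cases hp : p ∈ oddSet (fun w => cycleEdges (c i w)) (Iio w)
      · have e1 : {j | j = i ∧ p ∈ oddSet (fun w => cycleEdges (c i w)) (Iio w)} = {i} := by
          ext; simp [hp]
        rw [e1, union_singleton, ncard_insert_of_notMem (by simp) hf, Nat.odd_add_one]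
        simp only [hp, not_true, and_false, true_and, false_or]
        rfl
      · have e1 : {j | j = i ∧ p ∈ oddSet (fun w => cycleEdges (c i w)) (Iio w)} = ∅ := by
          ext; simp [hp]
        rw [e1, union_empty]
        simp only [hp, not_false_eq_true, and_true, false_and, or_false]
        rfl
    have := hdir i w
    rw [toggle_toggle, ← key] at this
    exact this
  · ext p
    have : p ∈ oddSet e univ ↔ Odd {j | Odd {z | z ∈ {z | z ∈ univ ∧ p ∈ e z} ∧ z.1 = j}.ncard}.ncard :=
      odd_ncard_iff_fibers ((hZfin p).subset fun z hz => hz.2) _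
    refine Iff.trans ?_ this.symm
    have : {j | Odd {z | z ∈ {z | z ∈ univ ∧ p ∈ e z} ∧ z.1 = j}.ncard} =
        {j | j ∈ univ ∧ p ∈ S j} := by
      ext j
      rw [mem_ofPred_eq, hfib]
      simp only [mem_univ, true_and, hfull, mem_ofPred_eq]
    rw [this]
    rfl
  · rintro ⟨i, w⟩
    exact (hT i w).trans (subset_iUnion _ i)

theorem Reach.trans {D : Digraph V} {S S' T T' : Set (Sym2 V)} (h : Reach D S T)
    (h' : Reach (toggle D S) S' T') : Reach D (symmDiff S S') (T ∪ T') := by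
  have hI : (univ : Set (ULift.{u} Bool)) = insert ⟨true⟩ {⟨false⟩} := by
    ext ⟨b⟩; cases b <;> simp
  have hf : ∀ (S : ULift.{u} Bool → Set (Sym2 V)) (p : Sym2 V), {i | p ∈ S i}.Finite :=
    fun S p => toFinite _
  have hs : ∀ (S : ULift.{u} Bool → Set (Sym2 V)), oddSet S {⟨false⟩} = S ⟨false⟩ := by
    intro S
    rw [oddSet_of_subsingleton]
    · simp
    · rintro p w w' hw hw' _ _; rw [hw, hw']
  have key := Reach.comp (D := D) (I := ULift.{u} Bool)
    (S := fun b => if b.down then S' else S) (T := fun b => if b.down then T' else T)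
    (hf _) ?_
  · rw [hI, oddSet_insert (by simp) (hf _), hs] at key
    refine Reach.mono (by simpa using key) ?_
    refine iUnion_subset ?_
    rintro ⟨b⟩; cases b <;> simp
  · rintro ⟨b⟩
    cases b
    · have : Iio (⟨false⟩ : ULift.{u} Bool) = ∅ := by
        ext ⟨b⟩; cases b <;> simp [← ULift.down_lt]
      rw [this, oddSet_empty, toggle_empty]
      simpa using h
    · have : Iio (⟨true⟩ : ULift.{u} Bool) = {⟨false⟩} := by
        ext ⟨b⟩; cases b <;> simp [← ULift.down_lt]
      rw [this, hs]
      simpa using h'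

/-- Composition of a sequence of type `ω`, described by the sets `E n` of pairs reversed before
step `n`. -/
theorem Reach.seq {D : Digraph V} {E : ℕ → Set (Sym2 V)} {T : ℕ → Set (Sym2 V)}
    {E' : Set (Sym2 V)} (h0 : E 0 = ∅) (hfin : ∀ p, {n | p ∈ T n}.Finite)
    (h : ∀ n, Reach (toggle D (E n)) (symmDiff (E n) (E (n + 1))) (T n))
    (hlim : ∀ p, ∀ᶠ n in Filter.atTop, (p ∈ E n ↔ p ∈ E')) :
    Reach D E' (⋃ n, T n) := by
  set S : ULift.{u} ℕ → Set (Sym2 V) := fun n => symmDiff (E n.down) (E (n.down + 1)) with hS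
  have hST : ∀ n, S n ⊆ T n.down := fun n => (h n.down).subset
  have hfin' : ∀ p, {n : ULift.{u} ℕ | p ∈ T n.down}.Finite := by
    intro p
    exact (hfin p).preimage (ULift.down_injective.injOn)
  have hSfin : ∀ p, {n | p ∈ S n}.Finite := fun p => (hfin' p).subset fun n hn => hST n hn
  have hE : ∀ n : ℕ, oddSet S {m | m.down < n} = E n := by
    intro n
    induction n with
    | zero => simp [h0, oddSet_empty]
    | succ n ih =>
      have : {m : ULift.{u} ℕ | m.down < n + 1} = insert ⟨n⟩ {m | m.down < n} := by
        ext ⟨m⟩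
        simp only [mem_ofPred_eq, mem_insert_iff, ULift.up_inj]
        omega
      rw [this, oddSet_insert (by simp) hSfin, ih, hS]
      simp
  have key := Reach.comp (D := D) (I := ULift.{u} ℕ) (S := S) (T := fun n => T n.down) hfin' ?_
  · have : oddSet S univ = E' := by
      ext p
      obtain ⟨N, hN⟩ := Filter.eventually_atTop.1 (hlim p)
      obtain ⟨M, hM⟩ := ((hfin p).bddAbove)
      -- From index `N` on, membership of `p` in `E n` has its limiting value; after index `M` no
      -- step touches `p`.
      rw [← hN (max N (M + 1)) (le_max_left _ _), ← hE]
      simp only [oddSet, mem_ofPred_eq, mem_univ, true_and]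
      have : {w | p ∈ S w} = {w | w.down < max N (M + 1) ∧ p ∈ S w} := by
        ext w
        simp only [mem_ofPred_eq]
        refine ⟨fun hw => ⟨?_, hw⟩, fun hw => hw.2⟩
        have := hM (hST w hw)
        exact lt_of_lt_of_le (Nat.lt_succ_of_le this) (le_max_right _ _)
      rw [this]
    rw [this] at key
    refine key.mono (iUnion_subset fun n => subset_iUnion T n.down)
  · rintro ⟨n⟩
    have : Iio (⟨n⟩ : ULift.{u} ℕ) = {m | m.down < n} := by
      ext ⟨m⟩; simp [← ULift.down_lt]
    rw [this, hE]
    exact h n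

end Reach

/-! ### From abstract sequences to ordinal-indexed reversal sequences -/

section Realization

variable {V : Type u}

theorem stage_eq_toggle {D : Digraph V} (hD : IsTournament D) {W : Type u} [LinearOrder W]
    [WellFoundedLT W] {c : W → Cycle V} {C : Ordinal.{u} → Cycle V}
    (hC : ∀ w, C (Ordinal.typein ((· < ·) : W → W → Prop) w) = c w)
    (hfin : ∀ p, {w | p ∈ cycleEdges (c w)}.Finite)
    (hdir : ∀ w, IsDirectedCycle (toggle D (oddSet (fun w => cycleEdges (c w)) (Iio w))) (c w))
    (α : Ordinal.{u}) (hα : α ≤ Ordinal.type ((· < ·) : W → W → Prop)) :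
    stage D C α = toggle D (oddSet (fun w => cycleEdges (c w))
      {w | Ordinal.typein ((· < ·) : W → W → Prop) w < α}) := by
  induction α using Ordinal.limitRecOn with
  | zero =>
    have : {w : W | Ordinal.typein ((· < ·) : W → W → Prop) w < 0} = ∅ := by
      ext w; simp
    rw [this, oddSet_empty, toggle_empty, stage_zero]
  | add_one ξ ih =>
    have hξ : ξ < Ordinal.type ((· < ·) : W → W → Prop) := lt_of_lt_of_le (by simp) hα
    rw [stage_add_one, ih hξ.le]
    obtain ⟨w, rfl⟩ := (Ordinal.mem_range_typein_iff ((· < ·) : W → W → Prop)).2 hξ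
    have hs : {w' : W | Ordinal.typein ((· < ·) : W → W → Prop) w' < Ordinal.typein ((· < ·) : W → W → Prop) w} = Iio w := by
      ext w'; simp
    have hs' : {w' : W | Ordinal.typein ((· < ·) : W → W → Prop) w' < Ordinal.typein ((· < ·) : W → W → Prop) w + 1} =
        insert w (Iio w) := by
      ext w'
      simp only [mem_ofPred_eq, mem_insert_iff, mem_Iio]
      rw [← Order.succ_eq_add_one, Order.lt_succ_iff, le_iff_eq_or_lt]
      simp
    rw [hs, hC, reverseCycle_eq_toggle (hD.toggle _) (hdir w), toggle_toggle, hs',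
      oddSet_insert (by simp) hfin]
  | limit ζ hζ ih =>
    ext x y
    rw [stage_limit_adj D C ζ hζ]
    set p := s(x, y)
    have hAfin : (Ordinal.typein ((· < ·) : W → W → Prop) '' {w | p ∈ cycleEdges (c w)} ∩ Iio ζ).Finite :=
      ((hfin p).image _).subset inter_subset_left
    -- Only finitely many indices below `ζ` touch the pair, so beyond the largest of them its
    -- orientation is constant and agrees with the limit rule.
    obtain ⟨ν₀, hν₀, hmax⟩ : ∃ ν₀ < ζ, ∀ w, p ∈ cycleEdges (c w) →
        Ordinal.typein ((· < ·) : W → W → Prop) w < ζ → Ordinal.typein ((· < ·) : W → W → Prop) w ≤ ν₀ := by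
      rcases Set.eq_empty_or_nonempty
        (Ordinal.typein ((· < ·) : W → W → Prop) '' {w | p ∈ cycleEdges (c w)} ∩ Iio ζ) with h0 | h0
      · refine ⟨0, hζ.bot_lt, fun w hw hwζ => ?_⟩
        have hm : Ordinal.typein ((· < ·) : W → W → Prop) w ∈
            Ordinal.typein ((· < ·) : W → W → Prop) '' {w | p ∈ cycleEdges (c w)} ∩ Iio ζ :=
          ⟨⟨w, hw, rfl⟩, hwζ⟩
        rw [h0] at hm
        exact hm.elim
      · obtain ⟨ν, hν, h⟩ := Set.exists_max_image _ id hAfin h0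
        exact ⟨ν, hν.2, fun w hw hwζ => h _ ⟨⟨w, hw, rfl⟩, hwζ⟩⟩
    have key : ∀ ξ, ν₀ < ξ → ξ < ζ → ((stage D C ξ).Adj x y ↔
        (toggle D (oddSet (fun w => cycleEdges (c w))
          {w | Ordinal.typein ((· < ·) : W → W → Prop) w < ζ})).Adj x y) := by
      intro ξ h1 h2
      rw [ih ξ h2 (h2.le.trans hα)]
      have : p ∈ oddSet (fun w => cycleEdges (c w)) {w | Ordinal.typein ((· < ·) : W → W → Prop) w < ξ} ↔
          p ∈ oddSet (fun w => cycleEdges (c w)) {w | Ordinal.typein ((· < ·) : W → W → Prop) w < ζ} := by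
        simp only [oddSet, mem_ofPred_eq]
        have : {w | Ordinal.typein ((· < ·) : W → W → Prop) w < ξ ∧ p ∈ cycleEdges (c w)} =
            {w | Ordinal.typein ((· < ·) : W → W → Prop) w < ζ ∧ p ∈ cycleEdges (c w)} := by
          ext w
          constructor
          · rintro ⟨h, h'⟩; exact ⟨h.trans h2, h'⟩
          · rintro ⟨h, h'⟩; exact ⟨(hmax w h' h).trans_lt h1, h'⟩
        rw [this]
      simp only [toggle]
      rw [this]
    constructor
    · rintro ⟨ν, hν, h⟩
      have hlt : Order.succ (max ν ν₀) < ζ := hζ.succ_lt (max_lt hν hν₀)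
      have h1 := h _ hlt (lt_of_le_of_lt (le_max_left _ _) (Order.lt_succ _))
      exact (key _ (lt_of_le_of_lt (le_max_right _ _) (Order.lt_succ _)) hlt).1 h1
    · intro h
      exact ⟨ν₀, hν₀, fun ξ h1 h2 => (key ξ h2 h1).2 h⟩

theorem Reach.exists_reversalSequence {D : Digraph V} (hD : IsTournament D)
    {S T : Set (Sym2 V)} (h : Reach D S T) :
    ∃ C ∈ reversalSequences D, reversed D C = toggle D S := by
  classical
  obtain ⟨W, i1, i2, c, hfin, hdir, rfl, -⟩ := h
  -- The value `Cycle.nil` beyond the order type of `W` is never used.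
  let C : Ordinal.{u} → Cycle V := fun ξ =>
    if h : ξ < Ordinal.type ((· < ·) : W → W → Prop) then c (Ordinal.enum ((· < ·) : W → W → Prop) ⟨ξ, h⟩)
      else Cycle.nil
  have hC : ∀ w, C (Ordinal.typein ((· < ·) : W → W → Prop) w) = c w := by
    intro w
    simp only [C, Ordinal.typein_lt_type, dif_pos, Ordinal.enum_typein]
  have hst := stage_eq_toggle hD hC hfin hdir
  refine ⟨⟨Ordinal.type ((· < ·) : W → W → Prop), C⟩, ⟨?_, ?_⟩, ?_⟩
  · intro ξ hξ
    obtain ⟨w, rfl⟩ := (Ordinal.mem_range_typein_iff ((· < ·) : W → W → Prop)).2 hξ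
    have hs : {w' : W | Ordinal.typein ((· < ·) : W → W → Prop) w' < Ordinal.typein ((· < ·) : W → W → Prop) w} = Iio w := by
      ext w'; simp
    change IsDirectedCycle (stage D C _) (C _)
    rw [hst _ (Ordinal.typein_lt_type _ _).le, hC, hs]
    exact hdir w
  · intro x y
    refine ((hfin s(x, y)).image (Ordinal.typein ((· < ·) : W → W → Prop))).subset ?_
    rintro ξ ⟨hξ, h⟩
    obtain ⟨w, rfl⟩ := (Ordinal.mem_range_typein_iff ((· < ·) : W → W → Prop)).2 hξ
    refine ⟨w, ?_, rfl⟩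
    have h : IsArcOf (C _) x y := h
    rw [hC] at h
    exact mem_cycleEdges.2 (Or.inl h)
  · have : {w : W | Ordinal.typein ((· < ·) : W → W → Prop) w < Ordinal.type ((· < ·) : W → W → Prop)} = univ := by
      ext w; simp [Ordinal.typein_lt_type]
    rw [← this]
    exact hst _ le_rfl

end Realization

/-! ### Transport along embeddings of induced subdigraphs -/

section Transport

variable {V V' : Type u}

theorem isArcOf_map {g : V' → V} {c : Cycle V'} {x y : V} :
    IsArcOf (c.map g) x y ↔ ∃ a b, IsArcOf c a b ∧ g a = x ∧ g b = y := by
  constructor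
  · rintro ⟨l, h⟩
    induction c using Quotient.inductionOn' with | h m =>
    have h' : (m.map g : Cycle V) = ((x :: y :: l : List V) : Cycle V) := h
    rw [Cycle.coe_eq_coe] at h'
    obtain ⟨n, hn⟩ := h'
    rw [← List.map_rotate] at hn
    have e : (Quotient.mk'' m : Cycle V') = ((m.rotate n : List V') : Cycle V') := by
      change ((m : List V') : Cycle V') = _
      rw [Cycle.coe_eq_coe]
      exact ⟨n, rfl⟩
    rcases hm : m.rotate n with _ | ⟨a, _ | ⟨b, l'⟩⟩
    · simp [hm] at hn
    · simp [hm] at hn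
    · rw [hm] at hn e
      simp only [List.map_cons, List.cons.injEq] at hn
      exact ⟨a, b, ⟨l', e⟩, hn.1, hn.2.1⟩
  · rintro ⟨a, b, ⟨l, rfl⟩, rfl, rfl⟩
    exact ⟨l.map g, by simp⟩

theorem cycleEdges_map (g : V' → V) (c : Cycle V') :
    cycleEdges (c.map g) = Sym2.map g '' cycleEdges c := by
  ext p
  constructor
  · rintro ⟨x, y, h, rfl⟩
    obtain ⟨a, b, h', rfl, rfl⟩ := isArcOf_map.1 h
    exact ⟨s(a, b), ⟨a, b, h', rfl⟩, rfl⟩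
  · rintro ⟨_, ⟨a, b, h, rfl⟩, rfl⟩
    exact ⟨g a, g b, isArcOf_map.2 ⟨a, b, h, rfl, rfl⟩, rfl⟩

theorem oddSet_image {W : Type*} {g : V' → V} (hg : Function.Injective g)
    (S : W → Set (Sym2 V')) (A : Set W) :
    oddSet (fun w => Sym2.map g '' S w) A = Sym2.map g '' oddSet S A := by
  have hinj := Sym2.map.injective hg
  ext p
  by_cases hp : p ∈ range (Sym2.map g)
  · obtain ⟨q, rfl⟩ := hp
    rw [hinj.mem_set_image]
    simp only [oddSet, mem_ofPred_eq, hinj.mem_set_image]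
  · have h1 : p ∉ Sym2.map g '' oddSet S A := fun ⟨q, _, h⟩ => hp ⟨q, h⟩
    have h2 : ∀ w, p ∉ Sym2.map g '' S w := fun w ⟨q, _, h⟩ => hp ⟨q, h⟩
    refine iff_of_false ?_ h1
    simp only [oddSet, mem_ofPred_eq, h2, and_false]
    simp

theorem toggle_map_adj {g : V' → V} (hg : Function.Injective g) {D' : Digraph V'} {D : Digraph V}
    (h : ∀ a b, D'.Adj a b ↔ D.Adj (g a) (g b)) (S : Set (Sym2 V')) (a b : V') :
    (toggle D' S).Adj a b ↔ (toggle D (Sym2.map g '' S)).Adj (g a) (g b) := by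
  have : s(g a, g b) ∈ Sym2.map g '' S ↔ s(a, b) ∈ S := by
    rw [← Sym2.map_mk, (Sym2.map.injective hg).mem_set_image]
  simp only [toggle, this, h]

theorem nodup_map_iff {g : V' → V} (hg : Function.Injective g) (c : Cycle V') :
    (c.map g).Nodup ↔ c.Nodup := by
  induction c using Quotient.inductionOn' with | h m =>
  exact List.nodup_map_iff hg

theorem length_map (g : V' → V) (c : Cycle V') : (c.map g).length = c.length := by
  induction c using Quotient.inductionOn' with | h m =>
  exact List.length_map g

theorem isDirectedCycle_map {g : V' → V} (hg : Function.Injective g) {D' : Digraph V'}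
    {D : Digraph V} (h : ∀ a b, D'.Adj a b ↔ D.Adj (g a) (g b)) {c : Cycle V'} :
    IsDirectedCycle D (c.map g) ↔ IsDirectedCycle D' c := by
  have e : (fun a b => D.Adj (g a) (g b)) = D'.Adj := by
    ext a b; exact (h a b).symm
  rw [IsDirectedCycle, IsDirectedCycle, nodup_map_iff hg, length_map, Cycle.chain_map, e]

theorem Reach.map {g : V' → V} (hg : Function.Injective g) {D' : Digraph V'}
    {D : Digraph V} (h : ∀ a b, D'.Adj a b ↔ D.Adj (g a) (g b)) {S T : Set (Sym2 V')}
    (hR : Reach D' S T) : Reach D (Sym2.map g '' S) (Sym2.map g '' T) := by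
  obtain ⟨W, i1, i2, c, hfin, hdir, rfl, hT⟩ := hR
  refine ⟨W, i1, i2, fun w => (c w).map g, ?_, ?_, ?_, ?_⟩
  · intro p
    simp only [cycleEdges_map]
    by_cases hp : p ∈ range (Sym2.map g)
    · obtain ⟨q, rfl⟩ := hp
      simp only [(Sym2.map.injective hg).mem_set_image]
      exact hfin q
    · have h2 : ∀ w, p ∉ Sym2.map g '' cycleEdges (c w) := fun w ⟨q, _, h⟩ => hp ⟨q, h⟩
      simp [h2]
  · intro w
    simp only [cycleEdges_map]
    rw [oddSet_image hg, isDirectedCycle_map hg (toggle_map_adj hg h _)]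
    exact hdir w
  · simp only [cycleEdges_map]
    rw [oddSet_image hg]
  · intro w
    rw [cycleEdges_map]
    exact image_mono (hT w)

end Transport

/-! ### Symmetry under reversing all arcs -/

section Opposite

variable {V : Type u}

/-- The digraph with all arcs reversed. -/
def opposite (D : Digraph V) : Digraph V where
  Adj x y := D.Adj y x

theorem opposite_toggle (D : Digraph V) (S : Set (Sym2 V)) :
    opposite (toggle D S) = toggle (opposite D) S := by
  ext x y
  simp only [opposite, toggle, Sym2.eq_swap]

theorem IsTournament.opposite {D : Digraph V} (hD : IsTournament D) :
    IsTournament (opposite D) where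
  loopless := hD.loopless
  exactly_one x y h := hD.exactly_one y x h.symm

theorem IsArcOf.reverse {c : Cycle V} {x y : V} (h : IsArcOf c x y) :
    IsArcOf c.reverse y x := by
  obtain ⟨l, rfl⟩ := h
  refine ⟨l.reverse, ?_⟩
  rw [Cycle.reverse_coe, Cycle.coe_eq_coe]
  have := List.isRotated_append (l := l.reverse) (l' := [y, x])
  simpa using this

theorem cycleEdges_reverse (c : Cycle V) : cycleEdges c.reverse = cycleEdges c := by
  have h : ∀ c : Cycle V, cycleEdges c ⊆ cycleEdges c.reverse := by
    rintro c p ⟨x, y, h, rfl⟩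
    exact ⟨y, x, h.reverse, Sym2.eq_swap⟩
  refine subset_antisymm ?_ (h c)
  have := h c.reverse
  rwa [Cycle.reverse_reverse] at this

theorem chain_reverse {r : V → V → Prop} {c : Cycle V} (h : c.Chain r) :
    c.reverse.Chain (fun x y => r y x) := by
  induction c using Quotient.inductionOn' with | h m =>
  change Cycle.Chain r (m : Cycle V) at h
  change Cycle.Chain _ (Cycle.reverse (m : Cycle V))
  cases m with
  | nil => simp
  | cons a m =>
    rw [Cycle.chain_coe_cons] at h
    have e : Cycle.reverse ((a :: m : List V) : Cycle V) = ((a :: m.reverse : List V) : Cycle V) := by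
      rw [Cycle.reverse_coe, Cycle.coe_eq_coe]
      have := List.isRotated_append (l := m.reverse) (l' := [a])
      simpa using this
    rw [e, Cycle.chain_coe_cons]
    have h2 := (List.isChain_reverse (R := fun x y => r y x)
      (l := a :: (m ++ [a]))).2 (by simpa [flip] using h)
    simpa using h2

theorem IsDirectedCycle.reverse {D : Digraph V} {c : Cycle V} (h : IsDirectedCycle D c) :
    IsDirectedCycle (CycleReversion.opposite D) c.reverse :=
  ⟨Cycle.nodup_reverse_iff.2 h.1, by rw [Cycle.length_reverse]; exact h.2.1, chain_reverse h.2.2⟩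

theorem Reach.opposite {D : Digraph V} {S T : Set (Sym2 V)} (h : Reach D S T) :
    Reach (CycleReversion.opposite D) S T := by
  obtain ⟨W, i1, i2, c, hfin, hdir, rfl, hT⟩ := h
  refine ⟨W, i1, i2, fun w => (c w).reverse, ?_, ?_, ?_, ?_⟩
  · simpa only [cycleEdges_reverse] using hfin
  · intro w
    simp only [cycleEdges_reverse]
    rw [← opposite_toggle]
    exact (hdir w).reverse
  · simp only [cycleEdges_reverse]
  · simpa only [cycleEdges_reverse] using hT

end Opposite

/-! ### Reducible digraphs and reduction to strong components -/

section Reducible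

variable {V : Type u}

/-- The vertex set can be split into two acyclic sets. -/
def TwoAcyclic (D : Digraph V) : Prop :=
  ∃ A : Set V, IsAcyclicSet D A ∧ IsAcyclicSet D Aᶜ

/-- Some reversal sequence leads to a digraph that splits into two acyclic sets. -/
def Reducible (D : Digraph V) : Prop :=
  ∃ S T, Reach D S T ∧ TwoAcyclic (toggle D S)

theorem TwoAcyclic.dichromaticNumber_le {D : Digraph V} (h : TwoAcyclic D) :
    dichromaticNumber D ≤ 2 := by
  obtain ⟨A, h1, h2⟩ := h
  have : Cardinal.mk ({A, Aᶜ} : Set (Set V)) ≤ 2 := by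
    refine (Cardinal.mk_insert_le).trans ?_
    rw [Cardinal.mk_singleton]
    exact le_of_eq one_add_one_eq_two
  refine le_trans (csInf_le' ?_) this
  refine ⟨{A, Aᶜ}, ?_, ?_, rfl⟩
  · rintro W (rfl | rfl)
    · exact h1
    · exact h2
  · simp

theorem Reducible.of_reach {D : Digraph V} {S T : Set (Sym2 V)} (h : Reach D S T)
    (h' : Reducible (toggle D S)) : Reducible D := by
  obtain ⟨S', T', h1, h2⟩ := h'
  exact ⟨_, _, h.trans h1, by rwa [← toggle_toggle]⟩

theorem IsAcyclicSet.opposite {D : Digraph V} {A : Set V} (h : IsAcyclicSet D A) :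
    IsAcyclicSet (CycleReversion.opposite D) A := by
  intro c hc hA
  exact h c.reverse hc.reverse (by simpa using hA)

theorem Reducible.opposite {D : Digraph V} (h : Reducible D) :
    Reducible (CycleReversion.opposite D) := by
  obtain ⟨S, T, h1, A, h2, h3⟩ := h
  refine ⟨S, T, h1.opposite, A, ?_, ?_⟩ <;> rw [← opposite_toggle]
  · exact h2.opposite
  · exact h3.opposite

/-- The subdigraph induced on `K`. -/
def restrict (D : Digraph V) (K : Set V) : Digraph K where
  Adj a b := D.Adj a b

theorem IsTournament.restrict {D : Digraph V} (hD : IsTournament D) (K : Set V) :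
    IsTournament (restrict D K) where
  loopless x := hD.loopless x
  exactly_one x y h := hD.exactly_one x y fun e => h (Subtype.ext e)

theorem exists_map_val_eq {K : Set V} {c : Cycle V} (h : ∀ x ∈ c, x ∈ K) :
    ∃ c' : Cycle K, c'.map Subtype.val = c := by
  induction c using Quotient.inductionOn' with | h m =>
  have h : ∀ x ∈ m, x ∈ K := h
  lift m to List K using h
  exact ⟨m, rfl⟩

/-- If the arcs between the classes of a partition respect a partial order on the classes, then it
suffices to treat the classes separately. -/
theorem Reducible.of_fibers {D : Digraph V} {ι : Type u} (f : V → ι) (r : ι → ι → Prop)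
    (hirr : ∀ i, ¬ r i i) (htr : ∀ i j k, r i j → r j k → r i k)
    (hf : ∀ x y, D.Adj x y → f x = f y ∨ r (f x) (f y))
    (h : ∀ i, Reducible (restrict D {v | f v = i})) : Reducible D := by
  -- This well-order of the classes has nothing to do with `r`. The classes touch disjoint sets of
  -- pairs, so they may be processed in any order.
  obtain ⟨_, _⟩ := exists_wellFoundedLT ι
  choose S T hR A hA hA' using h
  let g : ∀ i, {v | f v = i} → V := fun i => Subtype.val
  have hg : ∀ i, Function.Injective (g i) := fun i => Subtype.val_injective
  set S' : ι → Set (Sym2 V) := fun i => Sym2.map (g i) '' S i with hS'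
  set T' : ι → Set (Sym2 V) := fun i => Sym2.map (g i) '' T i with hT'
  have hST : ∀ i, S' i ⊆ T' i := fun i => image_mono (hR i).subset
  have hTf : ∀ i x y, s(x, y) ∈ T' i → f x = i ∧ f y = i := by
    rintro i x y ⟨q, -, hq⟩
    induction q with | h a b =>
    rw [Sym2.map_mk, Sym2.eq_iff] at hq
    rcases hq with ⟨rfl, rfl⟩ | ⟨rfl, rfl⟩
    · exact ⟨a.2, b.2⟩
    · exact ⟨b.2, a.2⟩
  have huniq : ∀ p i j, p ∈ T' i → p ∈ T' j → i = j := by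
    intro p i j hi hj
    induction p with | h x y =>
    rw [← (hTf i x y hi).1, (hTf j x y hj).1]
  have hodd : ∀ B, oddSet S' B = ⋃ w ∈ B, S' w := fun B =>
    oddSet_of_subsingleton fun p w w' _ _ h h' => huniq p w w' (hST _ h) (hST _ h')
  have hrestr : ∀ B i, i ∉ B → ∀ a b : {v | f v = i},
      (restrict D {v | f v = i}).Adj a b ↔ (toggle D (oddSet S' B)).Adj (g i a) (g i b) := by
    intro B i hi a b
    rw [toggle_adj_of_notMem]
    · rfl
    · rw [hodd]
      simp only [mem_iUnion, not_exists]
      intro j hj hp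
      have := (hTf j _ _ (hST j hp)).1
      have ha : f (g i a) = i := a.2
      rw [ha] at this
      exact hi (this ▸ hj)
  have hfull : ∀ i, ∀ a b : {v | f v = i},
      (toggle (restrict D {v | f v = i}) (S i)).Adj a b ↔
        (toggle D (oddSet S' univ)).Adj (g i a) (g i b) := by
    intro i a b
    rw [toggle_map_adj (hg i) (D := D) (fun _ _ => Iff.rfl)]
    have ha : f (g i a) = i := a.2
    have : s(g i a, g i b) ∈ oddSet S' univ ↔ s(g i a, g i b) ∈ Sym2.map (g i) '' S i := by
      rw [hodd]
      simp only [mem_iUnion, mem_univ, exists_true_left]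
      constructor
      · rintro ⟨j, hj⟩
        have := (hTf j _ _ (hST j hj)).1
        rw [ha] at this
        subst this
        exact hj
      · intro hp; exact ⟨i, hp⟩
    simp only [toggle, this]
  refine ⟨oddSet S' univ, ⋃ i, T' i, Reach.comp ?_ ?_, {v | ∃ i, v ∈ g i '' A i}, ?_⟩
  · intro p
    refine Set.Subsingleton.finite ?_
    intro i hi j hj
    exact huniq p i j hi hj
  · intro i
    exact (hR i).map (hg i) (hrestr _ i (by simp))
  have hcyc : ∀ c, IsDirectedCycle (toggle D (oddSet S' univ)) c → ∃ i, ∃ c' : Cycle {v | f v = i},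
      c'.map (g i) = c ∧ IsDirectedCycle (toggle (restrict D {v | f v = i}) (S i)) c' := by
    intro c hc
    have hch : c.Chain (fun x y => f x = f y ∨ r (f x) (f y)) := by
      refine hc.2.2.imp ?_
      intro x y hxy
      by_cases hp : s(x, y) ∈ oddSet S' univ
      · rw [hodd] at hp
        simp only [mem_iUnion, mem_univ, exists_true_left] at hp
        obtain ⟨i, hi⟩ := hp
        have := hTf i x y (hST i hi)
        exact Or.inl (this.1.trans this.2.symm)
      · exact hf x y ((toggle_adj_of_notMem hp).1 hxy)
    have : IsTrans V (fun x y => f x = f y ∨ r (f x) (f y)) := by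
      constructor
      rintro x y z (h1 | h1) (h2 | h2)
      · exact Or.inl (h1.trans h2)
      · rw [h1]; exact Or.inr h2
      · rw [← h2]; exact Or.inr h1
      · exact Or.inr (htr _ _ _ h1 h2)
    -- A transitive relation holding along a cycle holds between any two of its vertices, in both
    -- directions. As `r` is transitive and irreflexive, the cycle stays in one class.
    rw [Cycle.chain_iff_pairwise] at hch
    have hne : ∃ x, x ∈ c := by
      have h3 := hc.2.1
      induction c using Quotient.inductionOn' with | h m =>
      have h3 : 3 ≤ m.length := h3
      have : m ≠ [] := by rintro rfl; simp at h3
      exact List.exists_mem_of_ne_nil m this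
    obtain ⟨x, hx⟩ := hne
    have hall : ∀ y ∈ c, y ∈ {v | f v = f x} := by
      intro y hy
      rcases hch y hy x hx with h1 | h1
      · exact h1
      · rcases hch x hx y hy with h2 | h2
        · exact h2.symm
        · exact absurd (htr _ _ _ h1 h2) (hirr _)
    obtain ⟨c', hc'⟩ := exists_map_val_eq hall
    refine ⟨f x, c', hc', ?_⟩
    rw [← isDirectedCycle_map (hg _) (hfull (f x))]
    have : c'.map (g (f x)) = c := hc'
    rwa [this]
  constructor
  · intro c hc hcA
    obtain ⟨i, c', rfl, h2⟩ := hcyc c hc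
    refine hA i c' h2 fun a ha => ?_
    obtain ⟨j, b, hb, hba⟩ := hcA (g i a) (Cycle.mem_map.2 ⟨a, ha, rfl⟩)
    have hj : j = i := by
      have h1 : f (g j b) = j := b.2
      have h2 : f (g i a) = i := a.2
      rw [← h1, hba, h2]
    subst hj
    rwa [← hg _ hba]
  · intro c hc hcA
    obtain ⟨i, c', rfl, h2⟩ := hcyc c hc
    refine hA' i c' h2 fun a ha ha' => ?_
    exact hcA (g i a) (Cycle.mem_map.2 ⟨a, ha, rfl⟩) ⟨i, a, ha', rfl⟩

/-- The strong component of a vertex. -/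
def strongComponent (D : Digraph V) (v : V) : Set V :=
  {w | Relation.ReflTransGen D.Adj v w ∧ Relation.ReflTransGen D.Adj w v}

/-- The classes are those of the reachability preorder, and its quotient order is respected by every
arc. -/
theorem Reducible.of_strongComponents {D : Digraph V}
    (h : ∀ v, Reducible (restrict D (strongComponent D v))) : Reducible D := by
  let P : Preorder V :=
    { le := Relation.ReflTransGen D.Adj
      le_refl := fun _ => Relation.ReflTransGen.refl
      le_trans := fun _ _ _ => Relation.ReflTransGen.trans }
  refine Reducible.of_fibers (ι := Antisymmetrization V (· ≤ ·))
    (fun v => toAntisymmetrization (· ≤ ·) v) (· < ·) (fun i => lt_irrefl i)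
    (fun i j k => lt_trans) ?_ ?_
  · intro x y hxy
    have : toAntisymmetrization (α := V) (· ≤ ·) x ≤ toAntisymmetrization (· ≤ ·) y :=
      toAntisymmetrization_le_toAntisymmetrization_iff.2 (Relation.ReflTransGen.single hxy)
    exact this.eq_or_lt
  · intro i
    induction i using Quotient.inductionOn' with | h v =>
    have : {w | toAntisymmetrization (α := V) (· ≤ ·) w = Quotient.mk'' v} =
        strongComponent D v := by
      ext w
      rw [mem_ofPred_eq]
      refine Quotient.eq''.trans ?_
      exact and_comm
    rw [this]
    exact h v

end Reducible

/-! ### Balanced arc sets, cycle decomposition and return paths -/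

section Flow

open scoped Classical

variable {V : Type u}

/-- The net out-flow of a finite set of arcs. -/
noncomputable def flow (A : Finset (V × V)) : V →₀ ℤ :=
  ∑ p ∈ A, (Finsupp.single p.1 1 - Finsupp.single p.2 1)

/-- The pairs underlying a set of arcs. -/
def arcEdges (A : Finset (V × V)) : Set (Sym2 V) :=
  {p | ∃ a ∈ A, p = s(a.1, a.2)}

theorem flow_union {A B : Finset (V × V)} (h : Disjoint A B) : flow (A ∪ B) = flow A + flow B :=
  Finset.sum_union h

theorem flow_sdiff {A B : Finset (V × V)} (h : A ⊆ B) : flow (B \ A) = flow B - flow A := by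
  rw [eq_sub_iff_add_eq]
  exact Finset.sum_sdiff h

theorem flow_image_swap (A : Finset (V × V)) : flow (A.image Prod.swap) = - flow A := by
  rw [flow, Finset.sum_image Prod.swap_injective.injOn, flow, ← Finset.sum_neg_distrib]
  refine Finset.sum_congr rfl fun p _ => ?_
  simp

theorem mem_arcEdges {A : Finset (V × V)} {x y : V} :
    s(x, y) ∈ arcEdges A ↔ (x, y) ∈ A ∨ (y, x) ∈ A := by
  constructor
  · rintro ⟨⟨a, b⟩, h, e⟩
    rcases Sym2.eq_iff.1 e with ⟨rfl, rfl⟩ | ⟨rfl, rfl⟩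
    · exact Or.inl h
    · exact Or.inr h
  · rintro (h | h)
    · exact ⟨(x, y), h, rfl⟩
    · exact ⟨(y, x), h, Sym2.eq_swap⟩

theorem arcEdges_union (A B : Finset (V × V)) : arcEdges (A ∪ B) = arcEdges A ∪ arcEdges B := by
  ext p
  induction p with | h x y =>
  simp only [mem_arcEdges, Finset.mem_union, mem_union]
  tauto

theorem arcEdges_image_swap (A : Finset (V × V)) : arcEdges (A.image Prod.swap) = arcEdges A := by
  ext p
  induction p with | h x y =>
  simp only [mem_arcEdges, Finset.mem_image, Prod.exists, Prod.swap_prod_mk, Prod.mk.injEq]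
  constructor
  · rintro (⟨a, b, h, rfl, rfl⟩ | ⟨a, b, h, rfl, rfl⟩)
    · exact Or.inr h
    · exact Or.inl h
  · rintro (h | h)
    · exact Or.inr ⟨_, _, h, rfl, rfl⟩
    · exact Or.inl ⟨_, _, h, rfl, rfl⟩

theorem finite_arcEdges (A : Finset (V × V)) : (arcEdges A).Finite := by
  refine ((A.finite_toSet).image (fun a : V × V => s(a.1, a.2))).subset ?_
  rintro p ⟨a, ha, rfl⟩
  exact ⟨a, ha, rfl⟩

theorem mem_arcEdges_iff {D : Digraph V} (hD : IsTournament D) {A : Finset (V × V)}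
    (hA : ∀ a ∈ A, D.Adj a.1 a.2) {x y : V} (h : D.Adj x y) :
    s(x, y) ∈ arcEdges A ↔ (x, y) ∈ A := by
  rw [mem_arcEdges]
  refine or_iff_left fun h' => hD.asymm h (hA _ h')

/-- A balanced nonempty set of arcs of a tournament contains a directed cycle. -/
theorem exists_cycle_of_flow_eq_zero {D : Digraph V} (hD : IsTournament D) {A : Finset (V × V)}
    (hA : ∀ a ∈ A, D.Adj a.1 a.2) (h0 : flow A = 0) (hne : A.Nonempty) :
    ∃ (c : Cycle V) (B : Finset (V × V)), IsDirectedCycle D c ∧ B ⊆ A ∧ B.Nonempty ∧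
      flow B = 0 ∧ arcEdges B = cycleEdges c := by
  -- A head of an arc of `A` that is not a tail would have strictly negative net out-flow.
  have hout : ∀ x y, (x, y) ∈ A → ∃ z, (y, z) ∈ A := by
    intro x y hxy
    by_contra! hcon
    have h1 : flow A y = 0 := by rw [h0]; rfl
    rw [flow, Finsupp.finsetSum_apply] at h1
    have h2 : ∑ p ∈ A, (Finsupp.single p.1 (1 : ℤ) - Finsupp.single p.2 1 : V →₀ ℤ) y <
        ∑ p ∈ A, 0 := by
      refine Finset.sum_lt_sum ?_ ⟨(x, y), hxy, ?_⟩
      · rintro ⟨a, b⟩ hab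
        have : a ≠ y := by rintro rfl; exact hcon b hab
        simp only [Finsupp.coe_sub, Pi.sub_apply, Finsupp.single_apply, this, if_false]
        split_ifs <;> simp
      · have : x ≠ y := hD.ne (hA _ hxy)
        simp [this]
    simp only [Finset.sum_const_zero] at h2
    exact absurd h1 h2.ne
  obtain ⟨⟨x₀, y₀⟩, hx₀⟩ := hne
  have : ∀ x, ∃ y, (∃ z, (x, z) ∈ A) → (x, y) ∈ A := by
    intro x
    by_cases h : ∃ z, (x, z) ∈ A
    · obtain ⟨z, hz⟩ := h
      exact ⟨z, fun _ => hz⟩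
    · exact ⟨x, fun h' => absurd h' h⟩
  -- Iterating `f` from `x₀` stays among the finitely many tails of `A`, hence becomes periodic; the
  -- periodic orbit is the desired cycle.
  choose f hf using this
  have hf0 : (x₀, f x₀) ∈ A := hf x₀ ⟨_, hx₀⟩
  have hit : ∀ x, (x, f x) ∈ A → ∀ n, (f^[n] x, f^[n + 1] x) ∈ A := by
    intro x hx n
    induction n with
    | zero => exact hx
    | succ n ih =>
      rw [Function.iterate_succ_apply' f (n + 1)]
      exact hf _ (hout _ _ ih)
  obtain ⟨m, n, hmn, heq⟩ : ∃ m n, m < n ∧ f^[m] x₀ = f^[n] x₀ := by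
    have hfin : (A.image Prod.fst : Set V).Finite := Finset.finite_toSet _
    obtain ⟨m, -, n, -, hmn, h⟩ := Set.infinite_univ.exists_lt_map_eq_of_mapsTo
      (f := fun n : ℕ => f^[n] x₀) (t := (A.image Prod.fst : Set V))
      (fun n _ => Finset.mem_coe.2 (Finset.mem_image_of_mem Prod.fst (hit x₀ hf0 n))) hfin
    exact ⟨m, n, hmn, h⟩
  set x := f^[m] x₀ with hx
  have hper : f^[n - m] x = x := by
    rw [hx, ← Function.iterate_add_apply, Nat.sub_add_cancel hmn.le, ← heq]
  have hxp : x ∈ Function.periodicPts f := ⟨n - m, Nat.sub_pos_of_lt hmn, hper⟩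
  have hxA : (x, f x) ∈ A := by
    have := hit x₀ hf0 m
    rwa [Function.iterate_succ_apply'] at this
  set c := Function.periodicOrbit f x with hc
  set p := Function.minimalPeriod f x with hp
  have hp0 : 0 < p := Function.minimalPeriod_pos_of_mem_periodicPts hxp
  have hmem : ∀ z, z ∈ c → (z, f z) ∈ A ∧ f^[p] z = z := by
    intro z hz
    obtain ⟨k, rfl⟩ := (Function.mem_periodicOrbit_iff hxp).1 hz
    refine ⟨?_, ?_⟩
    · have := hit x hxA k
      rwa [Function.iterate_succ_apply'] at this
    · rw [← Function.iterate_add_apply, add_comm, Function.iterate_add_apply,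
        (Function.isPeriodicPt_minimalPeriod f x).eq]
  have hmemf : ∀ n z, z ∈ c → f^[n] z ∈ c := by
    intro n z hz
    obtain ⟨k, rfl⟩ := (Function.mem_periodicOrbit_iff hxp).1 hz
    rw [← Function.iterate_add_apply]
    exact Function.iterate_mem_periodicOrbit hxp _
  -- Period 1 would be a loop and period 2 a pair of opposite arcs.
  have hlen : 3 ≤ c.length := by
    rw [hc, Function.periodicOrbit_length, ← hp]
    have h1 : p ≠ 1 := by
      intro h
      rw [hp, Function.minimalPeriod_eq_one_iff_isFixedPt] at h
      have := hA _ hxA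
      rw [h.eq] at this
      exact hD.loopless _ this
    have h2 : p ≠ 2 := by
      intro h
      have h3 := (Function.isPeriodicPt_minimalPeriod f x).eq
      rw [← hp, h] at h3
      have h4 := hA _ (hit x hxA 1)
      rw [h3] at h4
      exact hD.asymm h4 (hA _ hxA)
    omega
  have hchain : c.Chain (fun a b => D.Adj a b) := by
    rw [hc, Function.periodicOrbit_chain' _ hxp]
    exact fun n => hA _ (hit x hxA n)
  have hchain' : c.Chain (fun a b => b = f a) := by
    rw [hc, Function.periodicOrbit_chain' _ hxp]
    exact fun n => Function.iterate_succ_apply' _ _ _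
  have harc : ∀ z w, IsArcOf c z w ↔ z ∈ c ∧ w = f z := by
    intro z w
    constructor
    · intro h
      exact ⟨h.mem.1, rel_of_isArcOf hchain' h⟩
    · rintro ⟨hz, rfl⟩
      obtain ⟨y, hy⟩ := exists_isArcOf_of_mem (by omega) hz
      rwa [← rel_of_isArcOf hchain' hy]
  have hfinite := finite_cycle_mem c
  set O : Finset V := hfinite.toFinset with hO
  have hOm : ∀ z, z ∈ O ↔ z ∈ c := by intro z; simp [hO]
  refine ⟨c, O.image fun z => (z, f z), ⟨Function.nodup_periodicOrbit, hlen, hchain⟩, ?_, ?_, ?_, ?_⟩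
  · intro a ha
    obtain ⟨z, hz, rfl⟩ := Finset.mem_image.1 ha
    exact (hmem z ((hOm z).1 hz)).1
  · exact Finset.Nonempty.image ⟨x, (hOm x).2 (Function.self_mem_periodicOrbit hxp)⟩ _
  · rw [flow, Finset.sum_image (fun a _ b _ h => (Prod.ext_iff.1 h).1), Finset.sum_sub_distrib,
      sub_eq_zero]
    symm
    -- On the orbit `f` is a permutation with inverse `f^[p - 1]`, so every vertex is a head as
    -- often as a tail.
    refine Finset.sum_nbij' f (f^[p - 1]) ?_ ?_ ?_ ?_ ?_
    · intro z hz
      exact (hOm _).2 (hmemf 1 z ((hOm z).1 hz))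
    · intro z hz
      exact (hOm _).2 (hmemf _ z ((hOm z).1 hz))
    · intro z hz
      rw [← Function.iterate_succ_apply, Nat.succ_eq_add_one, Nat.sub_add_cancel hp0]
      exact (hmem z ((hOm z).1 hz)).2
    · intro z hz
      rw [← Function.iterate_succ_apply' f, Nat.succ_eq_add_one, Nat.sub_add_cancel hp0]
      exact (hmem z ((hOm z).1 hz)).2
    · intro z hz; rfl
  · ext q
    constructor
    · rintro ⟨a, ha, rfl⟩
      obtain ⟨z, hz, rfl⟩ := Finset.mem_image.1 ha
      exact ⟨z, f z, (harc _ _).2 ⟨(hOm z).1 hz, rfl⟩, rfl⟩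
    · rintro ⟨z, w, h, rfl⟩
      obtain ⟨hz, rfl⟩ := (harc _ _).1 h
      exact ⟨(z, f z), Finset.mem_image_of_mem _ ((hOm z).2 hz), rfl⟩

/-- Reversing a balanced set of arcs is possible by reversing cycles inside it. -/
theorem Reach.of_flow_eq_zero {D : Digraph V} (hD : IsTournament D) {A : Finset (V × V)}
    (hA : ∀ a ∈ A, D.Adj a.1 a.2) (h0 : flow A = 0) : Reach D (arcEdges A) (arcEdges A) := by
  induction A using Finset.strongInduction generalizing D with | H A ih =>
  rcases A.eq_empty_or_nonempty with rfl | hne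
  · have : arcEdges (∅ : Finset (V × V)) = ∅ := by ext; simp [arcEdges]
    rw [this]
    exact Reach.refl _ _
  obtain ⟨c, B, hc, hBA, hB, hB0, he⟩ := exists_cycle_of_flow_eq_zero hD hA h0 hne
  have hBarc : ∀ a ∈ B, D.Adj a.1 a.2 := fun a ha => hA a (hBA ha)
  have h1 := Reach.single hc
  rw [← he] at h1
  -- The arcs of `A \ B` are untouched by the reversal of `B`, and they are still balanced.
  have h2 := ih (A \ B) (Finset.sdiff_ssubset hBA hB) (hD.toggle (arcEdges B)) ?_ ?_
  · have e : arcEdges B ∪ arcEdges (A \ B) = arcEdges A := by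
      rw [← arcEdges_union, Finset.union_sdiff_of_subset hBA]
    have e' : symmDiff (arcEdges B) (arcEdges (A \ B)) = arcEdges A := by
      rw [← e]
      refine Disjoint.symmDiff_eq_sup (a := arcEdges B) (Set.disjoint_left.2 ?_)
      rintro p ⟨⟨x, y⟩, h, rfl⟩ h'
      rw [mem_arcEdges_iff hD (fun a ha => hA a (Finset.sdiff_subset ha)) (hBarc _ h)] at h'
      exact (Finset.mem_sdiff.1 h').2 h
    have h3 := h1.trans h2
    rwa [e, e'] at h3
  · rintro ⟨x, y⟩ ha
    have hxy := hA _ (Finset.sdiff_subset ha)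
    rw [toggle_adj_of_notMem]
    · exact hxy
    · rw [mem_arcEdges_iff hD hBarc hxy]
      exact (Finset.mem_sdiff.1 ha).2
  · rw [flow_sdiff hBA, h0, hB0, sub_zero]

/-- If increasing finite sets of arcs `A n` can be closed by pairwise disjoint return sets `Q n`,
then the union of the sets `A n` can be reversed. -/
theorem Reach.of_returns {D : Digraph V} (hD : IsTournament D) {A Q : ℕ → Finset (V × V)}
    (hmono : Monotone A) (hA : ∀ n, ∀ a ∈ A n, D.Adj a.1 a.2) (hQ : ∀ n, ∀ a ∈ Q n, D.Adj a.1 a.2)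
    (hAQ : ∀ m n, Disjoint (A m) (Q n)) (hQQ : ∀ m n, m ≠ n → Disjoint (Q m) (Q n))
    (hflow : ∀ n, flow (A n) + flow (Q n) = 0) :
    Reach D (⋃ n, arcEdges (A n)) (⋃ n, arcEdges (A n ∪ Q n)) := by
  have hAQ' : ∀ m n a, a ∈ A m → a ∉ Q n := fun m n a h => Finset.disjoint_left.1 (hAQ m n) h
  have hQQ' : ∀ m n a, a ∈ Q m → a ∈ Q n → m = n := by
    intro m n a h h'
    by_contra hne
    exact Finset.disjoint_left.1 (hQQ m n hne) h h'
  have hAQarc : ∀ n, ∀ a ∈ A n ∪ Q n, D.Adj a.1 a.2 := by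
    intro n a ha
    rcases Finset.mem_union.1 ha with h | h
    · exact hA n a h
    · exact hQ n a h
  -- The pairs reversed before step `n`: none at first, then those of `A n` and its own return set
  -- `Q n`.
  let E : ℕ → Set (Sym2 V) := fun n => match n with
    | 0 => ∅
    | n + 1 => arcEdges (A n ∪ Q n)
  let C : ℕ → Finset (V × V) := fun n => (A (n + 1) \ A n) ∪ Q (n + 1) ∪ Q n
  -- The step from `A n ∪ Q n` to `A (n + 1) ∪ Q (n + 1)`: new arcs are reversed and `Q n` is
  -- restored, its arcs being present in opposite direction at that moment, whence the swap. As a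
  -- difference of two balanced sets `B n` is balanced. `C n` has the same pairs, oriented as in
  -- `D`.
  let B : ℕ → Finset (V × V) := fun n => (A (n + 1) \ A n) ∪ Q (n + 1) ∪ (Q n).image Prod.swap
  have hCarc : ∀ n, ∀ a ∈ C n, D.Adj a.1 a.2 := by
    intro n a ha
    simp only [C, Finset.mem_union, Finset.mem_sdiff] at ha
    rcases ha with (h | h) | h
    · exact hA _ a h.1
    · exact hQ _ a h
    · exact hQ _ a h
  have hBC : ∀ n, arcEdges (B n) = arcEdges (C n) := by
    intro n
    simp only [B, C, arcEdges_union, arcEdges_image_swap]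
  let T : ℕ → Set (Sym2 V) := fun n => match n with
    | 0 => arcEdges (A 0 ∪ Q 0)
    | n + 1 => arcEdges (C n)
  have hcase : ∀ p, (∃ x y, D.Adj x y ∧ p = s(x, y)) ∨
      ∀ X : Finset (V × V), (∀ a ∈ X, D.Adj a.1 a.2) → p ∉ arcEdges X := by
    intro p
    by_cases h : ∃ x y, D.Adj x y ∧ p = s(x, y)
    · exact Or.inl h
    · refine Or.inr fun X hX => ?_
      rintro ⟨a, ha, rfl⟩
      exact h ⟨_, _, hX a ha, rfl⟩
  have hsd : ∀ n, symmDiff (arcEdges (A n ∪ Q n)) (arcEdges (A (n + 1) ∪ Q (n + 1))) =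
      arcEdges (C n) := by
    intro n
    ext p
    rcases hcase p with ⟨x, y, hxy, rfl⟩ | hp
    · rw [Set.mem_symmDiff, mem_arcEdges_iff hD (hAQarc n) hxy,
        mem_arcEdges_iff hD (hAQarc (n + 1)) hxy, mem_arcEdges_iff hD (hCarc n) hxy]
      have h1 : (x, y) ∈ A n → (x, y) ∈ A (n + 1) := fun h => hmono (Nat.le_succ n) h
      have h2 := hAQ' (n + 1) n (x, y)
      have h3 := hAQ' (n + 1) (n + 1) (x, y)
      have h4 := hQQ' n (n + 1) (x, y)
      have h5 := hAQ' n (n + 1) (x, y)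
      simp only [C, Finset.mem_union, Finset.mem_sdiff]
      have h6 : n ≠ n + 1 := by omega
      tauto
    · simp [Set.mem_symmDiff, hp _ (hAQarc n), hp _ (hAQarc (n + 1)), hp _ (hCarc n)]
  have hsub : (⋃ n, T n) ⊆ ⋃ n, arcEdges (A n ∪ Q n) := by
    refine iUnion_subset fun n => ?_
    cases n with
    | zero => exact subset_iUnion (fun n => arcEdges (A n ∪ Q n)) 0
    | succ n =>
      simp only [T, C, arcEdges_union]
      refine union_subset (union_subset ?_ ?_) ?_
      · refine Subset.trans ?_ (subset_iUnion _ (n + 1))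
        refine Subset.trans ?_ subset_union_left
        rintro p ⟨a, ha, rfl⟩
        exact ⟨a, Finset.sdiff_subset ha, rfl⟩
      · exact Subset.trans subset_union_right (subset_iUnion (fun n => arcEdges (A n) ∪ arcEdges (Q n)) (n + 1))
      · exact Subset.trans subset_union_right (subset_iUnion (fun n => arcEdges (A n) ∪ arcEdges (Q n)) n)
  refine Reach.mono (Reach.seq (E := E) (T := T) rfl ?_ ?_ ?_) hsub
  · intro p
    rcases hcase p with ⟨x, y, hxy, rfl⟩ | hp
    -- An arc enters the increasing sets `A n` at most once and lies in at most one `Q n`, so few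
    -- steps touch it.
    · have f1 : {n | (x, y) ∈ A (n + 1) ∧ (x, y) ∉ A n}.Finite := by
        refine Set.Subsingleton.finite ?_
        rintro m ⟨h1, h2⟩ n ⟨h3, h4⟩
        by_contra hne
        rcases Nat.lt_or_gt_of_ne hne with h | h
        · exact h4 (hmono h h1)
        · exact h2 (hmono h h3)
      have f2 : {n | (x, y) ∈ Q n}.Finite := by
        refine Set.Subsingleton.finite ?_
        intro m hm n hn
        exact hQQ' m n _ hm hn
      have f3 : {n | (x, y) ∈ Q (n + 1)}.Finite :=
        f2.preimage (f := fun n => n + 1) (add_left_injective 1).injOn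
      refine Set.Finite.subset ((((f1.union f3).union f2).image (fun n => n + 1)).insert 0) ?_
      intro n hn
      cases n with
      | zero => exact mem_insert _ _
      | succ n =>
        refine mem_insert_of_mem _ ⟨n, ?_, rfl⟩
        have hn : s(x, y) ∈ arcEdges (C n) := hn
        rw [mem_arcEdges_iff hD (hCarc n) hxy] at hn
        simpa [C, or_assoc] using hn
    · convert Set.finite_empty
      ext n
      simp only [mem_ofPred_eq, mem_empty_iff_false, iff_false]
      cases n with
      | zero => exact hp _ (hAQarc 0)
      | succ n => exact hp _ (hCarc n)
  · intro n
    cases n with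
    | zero =>
      have : symmDiff (E 0) (E (0 + 1)) = arcEdges (A 0 ∪ Q 0) := by simp [E]
      rw [this]
      change Reach (toggle D ∅) _ _
      rw [toggle_empty]
      refine Reach.of_flow_eq_zero hD (hAQarc 0) ?_
      rw [flow_union (hAQ 0 0), hflow]
    | succ n =>
      have : symmDiff (E (n + 1)) (E (n + 1 + 1)) = arcEdges (B n) := by
        rw [hBC]; exact hsd n
      rw [this]
      change Reach (toggle D (arcEdges (A n ∪ Q n))) _ (arcEdges (C n))
      rw [← hBC]
      have hflowB : flow (B n) = 0 := by
        have d1 : Disjoint (A (n + 1) \ A n) (Q (n + 1)) :=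
          (hAQ (n + 1) (n + 1)).mono_left Finset.sdiff_subset
        have d2 : Disjoint ((A (n + 1) \ A n) ∪ Q (n + 1)) ((Q n).image Prod.swap) := by
          rw [Finset.disjoint_left]
          rintro ⟨x, y⟩ h h'
          obtain ⟨⟨a, b⟩, hab, e⟩ := Finset.mem_image.1 h'
          simp only [Prod.swap_prod_mk, Prod.mk.injEq] at e
          obtain ⟨rfl, rfl⟩ := e
          refine hD.asymm (hQ n _ hab) (hCarc n (b, a) ?_)
          exact Finset.mem_union_left _ h
        rw [flow_union d2, flow_union d1, flow_image_swap, flow_sdiff (hmono (Nat.le_succ n))]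
        have h1 := hflow n
        have h2 := hflow (n + 1)
        rw [Nat.succ_eq_add_one]
        rw [← eq_neg_iff_add_eq_zero] at h1 h2
        rw [h1, h2]
        abel
      refine Reach.of_flow_eq_zero (hD.toggle _) ?_ hflowB
      rintro ⟨x, y⟩ ha
      simp only [B, Finset.mem_union] at ha
      rcases ha with ha | ha
      · have hxy := hCarc n (x, y) (Finset.mem_union_left _ (Finset.mem_union.2 ha))
        rw [toggle_adj_of_notMem]
        · exact hxy
        · rw [mem_arcEdges_iff hD (hAQarc n) hxy]
          have h2 := hAQ' (n + 1) n (x, y)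
          have h4 := hQQ' n (n + 1) (x, y)
          have h5 := hAQ' n (n + 1) (x, y)
          have h6 : n ≠ n + 1 := by omega
          simp only [Finset.mem_union, Finset.mem_sdiff] at ha ⊢
          tauto
      · obtain ⟨⟨a, b⟩, hab, e⟩ := Finset.mem_image.1 ha
        simp only [Prod.swap_prod_mk, Prod.mk.injEq] at e
        obtain ⟨rfl, rfl⟩ := e
        rw [toggle_adj_of_mem]
        · exact hQ n _ hab
        · exact mem_arcEdges.2 (Or.inr (Finset.mem_union_right _ hab))
  · intro p
    rcases hcase p with ⟨x, y, hxy, rfl⟩ | hp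
    · by_cases h : ∃ N, (x, y) ∈ A N
      · obtain ⟨N, hN⟩ := h
        filter_upwards [Filter.eventually_ge_atTop (N + 1)] with n hn
        obtain ⟨n, rfl⟩ : ∃ k, n = k + 1 := ⟨n - 1, by omega⟩
        refine iff_of_true ?_ ?_
        · exact mem_arcEdges.2 (Or.inl (Finset.mem_union_left _ (hmono (by omega) hN)))
        · exact mem_iUnion.2 ⟨N, mem_arcEdges.2 (Or.inl hN)⟩
      · push Not at h
        have h' : s(x, y) ∉ ⋃ n, arcEdges (A n) := by
          simp only [mem_iUnion, not_exists]
          intro n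
          rw [mem_arcEdges_iff hD (hA n) hxy]
          exact h n
        have hN : ∃ N, ∀ n, N ≤ n → (x, y) ∉ Q n := by
          by_cases hq : ∃ m, (x, y) ∈ Q m
          · obtain ⟨m, hm⟩ := hq
            refine ⟨m + 1, fun n hn hn' => ?_⟩
            have := hQQ' _ _ _ hm hn'
            omega
          · push Not at hq
            exact ⟨0, fun n _ => hq n⟩
        obtain ⟨N, hN⟩ := hN
        filter_upwards [Filter.eventually_ge_atTop (N + 1)] with n hn
        obtain ⟨n, rfl⟩ : ∃ k, n = k + 1 := ⟨n - 1, by omega⟩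
        refine iff_of_false ?_ h'
        change s(x, y) ∉ arcEdges (A n ∪ Q n)
        rw [mem_arcEdges_iff hD (hAQarc n) hxy, Finset.mem_union, not_or]
        exact ⟨h n, hN n (by omega)⟩
    · refine Filter.Eventually.of_forall fun n => iff_of_false ?_ ?_
      · cases n with
        | zero => exact notMem_empty _
        | succ n => exact hp _ (hAQarc n)
      · simp only [mem_iUnion, not_exists]
        exact fun n => hp _ (hA n)

/-- If the new first vertex already occurs on the path, the path is cut back to that occurrence.
Absence of repetitions matters because `flow` counts each arc of a `Finset` once. -/
theorem exists_nodup_chain {r : V → V → Prop} {u v : V} (h : Relation.ReflTransGen r u v) :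
    ∃ l : List V, (u :: l).Nodup ∧ (u :: l).IsChain r ∧ (u :: l).getLast (by simp) = v := by
  induction h using Relation.ReflTransGen.head_induction_on with
  | refl => exact ⟨[], by simp⟩
  | @head a b hab _ ih =>
    obtain ⟨l, h1, h2, h3⟩ := ih
    by_cases ha : a ∈ b :: l
    · obtain ⟨s, t, hst⟩ := List.append_of_mem ha
      refine ⟨t, ?_, ?_, ?_⟩
      · rw [hst] at h1; exact h1.of_append_right
      · rw [hst] at h2; exact h2.right_of_append
      · rw [← h3]; simp [hst]
    · exact ⟨b :: l, List.nodup_cons.2 ⟨ha, h1⟩, List.isChain_cons_cons.2 ⟨hab, h2⟩, by simpa using h3⟩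

theorem exists_flow_of_chain {r : V → V → Prop} (l : List V) (u : V) (h1 : (u :: l).Nodup)
    (h2 : (u :: l).IsChain r) : ∃ A : Finset (V × V), (∀ a ∈ A, r a.1 a.2 ∧ a.1 ∈ u :: l) ∧
      flow A = Finsupp.single u 1 - Finsupp.single ((u :: l).getLast (by simp)) 1 := by
  induction l generalizing u with
  | nil => exact ⟨∅, by simp, by simp [flow]⟩
  | cons b l ih =>
    rw [List.isChain_cons_cons] at h2
    rw [List.nodup_cons] at h1
    obtain ⟨A, hA, hf⟩ := ih b h1.2 h2.2
    have hu : (u, b) ∉ A := fun h => h1.1 (hA _ h).2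
    refine ⟨insert (u, b) A, ?_, ?_⟩
    · intro a ha
      rcases Finset.mem_insert.1 ha with rfl | ha
      · exact ⟨h2.1, by simp⟩
      · exact ⟨(hA a ha).1, List.mem_cons_of_mem _ (hA a ha).2⟩
    · have : flow (insert (u, b) A) = (Finsupp.single u 1 - Finsupp.single b 1) + flow A :=
        Finset.sum_insert hu
      rw [this, hf]
      simp

/-- A directed walk contains a set of arcs carrying one unit of flow between its ends. -/
theorem exists_flow_of_reflTransGen {r : V → V → Prop} {u v : V}
    (h : Relation.ReflTransGen r u v) : ∃ A : Finset (V × V), (∀ a ∈ A, r a.1 a.2) ∧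
      flow A = Finsupp.single u 1 - Finsupp.single v 1 := by
  obtain ⟨l, h1, h2, h3⟩ := exists_nodup_chain h
  obtain ⟨A, hA, hf⟩ := exists_flow_of_chain l u h1 h2
  exact ⟨A, fun a ha => (hA a ha).1, by rw [hf, h3]⟩

end Flow

/-! ### A numerical inequality behind the finite case -/

section CutInequality

/-- The number of pairs `i < j < m` of different parity with `ε i = 1` and `ε j = 0`. -/
def mixedInversions (ε : ℕ → ℤ) (m : ℕ) : ℤ :=
  ∑ j ∈ Finset.range m, ∑ i ∈ Finset.range j, if i % 2 = j % 2 then 0 else ε i * (1 - ε j)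

/-- Pairs straddling the two blocks contribute non-negative terms, and a shift by `m` does not
change whether two indices have equal parity. -/
theorem mixedInversions_add {ε : ℕ → ℤ} (hε : ∀ i, ε i = 0 ∨ ε i = 1) (m n : ℕ) :
    mixedInversions ε m + mixedInversions (fun i => ε (m + i)) n ≤ mixedInversions ε (m + n) := by
  have hnn : ∀ i j : ℕ, 0 ≤ if i % 2 = j % 2 then (0 : ℤ) else ε i * (1 - ε j) := by
    intro i j
    rcases hε i with h | h <;> rcases hε j with h' | h' <;> split_ifs <;> simp [h, h']
  induction n with
  | zero => simp [mixedInversions]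
  | succ n ih =>
    have e1 : mixedInversions ε (m + (n + 1)) = mixedInversions ε (m + n) +
        ∑ i ∈ Finset.range (m + n), if i % 2 = (m + n) % 2 then 0 else ε i * (1 - ε (m + n)) := by
      rw [← add_assoc, mixedInversions, Finset.sum_range_succ]; rfl
    have e2 : mixedInversions (fun i => ε (m + i)) (n + 1) =
        mixedInversions (fun i => ε (m + i)) n + ∑ i ∈ Finset.range n,
          if i % 2 = n % 2 then 0 else ε (m + i) * (1 - ε (m + n)) := by
      rw [mixedInversions, Finset.sum_range_succ]; rfl
    have e3 : ∑ i ∈ Finset.range n, (if i % 2 = n % 2 then 0 else ε (m + i) * (1 - ε (m + n))) ≤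
        ∑ i ∈ Finset.range (m + n),
          if i % 2 = (m + n) % 2 then 0 else ε i * (1 - ε (m + n)) := by
      rw [Finset.sum_range_add]
      refine le_add_of_nonneg_of_le (Finset.sum_nonneg fun i _ => hnn i (m + n)) ?_
      refine le_of_eq (Finset.sum_congr rfl fun i _ => ?_)
      have : (m + i) % 2 = (m + n) % 2 ↔ i % 2 = n % 2 := by omega
      simp only [this]
    linarith

theorem sum_parity_ne (ε : ℕ → ℤ) (m : ℕ) (t : ℤ) :
    (∑ i ∈ Finset.range m, if i % 2 = m % 2 then 0 else ε i * t) =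
      (if m % 2 = 0 then ∑ i ∈ Finset.range m, (if i % 2 = 1 then ε i else 0)
        else ∑ i ∈ Finset.range m, (if i % 2 = 0 then ε i else 0)) * t := by
  split_ifs with h
  · rw [Finset.sum_mul]
    refine Finset.sum_congr rfl fun i _ => ?_
    rcases Nat.mod_two_eq_zero_or_one i with h' | h' <;> simp [h, h']
  · rw [Finset.sum_mul]
    refine Finset.sum_congr rfl fun i _ => ?_
    have h : m % 2 = 1 := by omega
    rcases Nat.mod_two_eq_zero_or_one i with h' | h' <;> simp [h, h']

/-- With `x` and `y` counting the chosen even and odd indices below `m` and `d = x - y`, induction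
on `m` shows that the right side exceeds the left by at least `d * (d - m % 2)`. This is a square or
a product of consecutive integers, hence non-negative. The bounds on `2 * x` and `2 * y` are what
the step `ε m = 1` needs. -/
theorem mixedInversions_lower_bound {ε : ℕ → ℤ} (hε : ∀ i, ε i = 0 ∨ ε i = 1) (m : ℕ) :
    (∑ i ∈ Finset.range m, ε i) * (m - 1) ≤
      2 * mixedInversions ε m + 2 * ∑ i ∈ Finset.range m, ε i * i := by
  set x : ℕ → ℤ := fun m => ∑ i ∈ Finset.range m, if i % 2 = 0 then ε i else 0 with hx
  set y : ℕ → ℤ := fun m => ∑ i ∈ Finset.range m, if i % 2 = 1 then ε i else 0 with hy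
  have hk : ∀ m, ∑ i ∈ Finset.range m, ε i = x m + y m := by
    intro m
    rw [hx, hy, ← Finset.sum_add_distrib]
    refine Finset.sum_congr rfl fun i _ => ?_
    rcases Nat.mod_two_eq_zero_or_one i with h' | h' <;> simp [h']
  have key : ∀ m : ℕ, (x m - y m) * (x m - y m - (m % 2 : ℕ)) ≤
      2 * mixedInversions ε m + 2 * ∑ i ∈ Finset.range m, ε i * i - (x m + y m) * (m - 1) ∧
      2 * x m ≤ m + (m % 2 : ℕ) ∧ 2 * y m ≤ m - (m % 2 : ℕ) := by
    intro m
    induction m with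
    | zero => simp [hx, hy, mixedInversions]
    | succ m ih =>
      obtain ⟨ih1, ih2, ih3⟩ := ih
      have e1 : mixedInversions ε (m + 1) = mixedInversions ε m +
          (if m % 2 = 0 then y m else x m) * (1 - ε m) := by
        rw [mixedInversions, Finset.sum_range_succ, sum_parity_ne]; rfl
      have e2 : x (m + 1) = x m + if m % 2 = 0 then ε m else 0 := by
        rw [hx]; exact Finset.sum_range_succ _ _
      have e3 : y (m + 1) = y m + if m % 2 = 1 then ε m else 0 := by
        rw [hy]; exact Finset.sum_range_succ _ _
      rw [e1, e2, e3, Finset.sum_range_succ]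
      rcases Nat.mod_two_eq_zero_or_one m with h | h
      · have h' : (m + 1) % 2 = 1 := by omega
        simp only [h, h', if_true, Nat.cast_zero, Nat.cast_one, Nat.cast_add] at *
        rcases hε m with h0 | h0
        · rw [h0]; norm_num
          exact ⟨by nlinarith, by linarith, by linarith⟩
        · rw [h0]; norm_num
          exact ⟨by nlinarith, by linarith, by linarith⟩
      · have h' : (m + 1) % 2 = 0 := by omega
        simp only [h, h', if_true, Nat.cast_zero, Nat.cast_one, Nat.cast_add] at *
        rcases hε m with h0 | h0
        · rw [h0]; norm_num
          exact ⟨by nlinarith, by linarith, by linarith⟩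
        · rw [h0]; norm_num
          exact ⟨by nlinarith, by linarith, by linarith⟩
  have h1 := (key m).1
  rw [hk]
  have h2 : 0 ≤ (x m - y m) * (x m - y m - (m % 2 : ℕ)) := by
    rcases Nat.mod_two_eq_zero_or_one m with h | h
    · rw [h]; simp only [Nat.cast_zero, sub_zero]; exact mul_self_nonneg _
    · rw [h]
      rcases le_or_gt (x m - y m) 0 with h3 | h3
      · exact mul_nonneg_of_nonpos_of_nonpos h3 (by push_cast; linarith)
      · exact mul_nonneg h3.le (by push_cast; linarith)
  linarith

/-- Abel summation: non-negative partial sums against a non-decreasing weight. -/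
theorem sum_mul_le_of_partial_sums_nonneg {a θ : ℕ → ℤ} (hθ : ∀ i, θ i ≤ θ (i + 1)) (m : ℕ)
    (ha : ∀ j ≤ m, 0 ≤ ∑ i ∈ Finset.range j, a i) :
    ∑ i ∈ Finset.range m, a i * θ i ≤ (∑ i ∈ Finset.range m, a i) * θ m := by
  induction m with
  | zero => simp
  | succ m ih =>
    have h1 := ih fun j hj => ha j (hj.trans (Nat.le_succ m))
    have h2 := ha m (Nat.le_succ m)
    have h3 := ha (m + 1) le_rfl
    rw [Finset.sum_range_succ] at h3 ⊢
    rw [Finset.sum_range_succ]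
    have h5 : (∑ i ∈ Finset.range m, a i + a m) * θ m ≤
        (∑ i ∈ Finset.range m, a i + a m) * θ (m + 1) := mul_le_mul_of_nonneg_left (hθ m) h3
    linarith

/-- By `hmin` no prefix of the block is sparser than the whole, so `r * ε i - k` has non-negative
partial sums and total zero, while `δ i + i` is non-decreasing. Abel summation bounds the
correlation of the two; the error from the added `i` is paid for by `mixedInversions_lower_bound`.
-/
theorem sum_mul_le_of_block {ε δ : ℕ → ℤ} (hε : ∀ i, ε i = 0 ∨ ε i = 1)
    (hδ : ∀ i, δ i - 1 ≤ δ (i + 1)) {r : ℕ}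
    (hmin : ∀ j ≤ r, (∑ i ∈ Finset.range r, ε i) * j ≤ r * ∑ i ∈ Finset.range j, ε i) :
    r * ∑ i ∈ Finset.range r, ε i * δ i ≤
      r * mixedInversions ε r + (∑ i ∈ Finset.range r, ε i) * ∑ i ∈ Finset.range r, δ i := by
  set k := ∑ i ∈ Finset.range r, ε i with hk
  have h1 := sum_mul_le_of_partial_sums_nonneg (a := fun i => r * ε i - k) (θ := fun i => δ i + i)
    (fun i => by have := hδ i; push_cast; linarith) r (by
      intro j hj
      rw [Finset.sum_sub_distrib, ← Finset.mul_sum, Finset.sum_const, Finset.card_range,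
        nsmul_eq_mul]
      have := hmin j hj
      linarith)
  have h2 : ∑ i ∈ Finset.range r, ((r : ℤ) * ε i - k) = 0 := by
    rw [Finset.sum_sub_distrib, ← Finset.mul_sum, Finset.sum_const, Finset.card_range,
      nsmul_eq_mul, ← hk]
    ring
  rw [h2, zero_mul] at h1
  have h3 : ∑ i ∈ Finset.range r, ((r : ℤ) * ε i - k) * (δ i + i) =
      r * ∑ i ∈ Finset.range r, ε i * δ i - k * ∑ i ∈ Finset.range r, δ i +
      (r * ∑ i ∈ Finset.range r, ε i * i - k * ∑ i ∈ Finset.range r, (i : ℤ)) := by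
    simp only [Finset.mul_sum]
    rw [← Finset.sum_sub_distrib, ← Finset.sum_sub_distrib, ← Finset.sum_add_distrib]
    exact Finset.sum_congr rfl fun i _ => by ring
  have h4 : 2 * ∑ i ∈ Finset.range r, (i : ℤ) = r * (r - 1) := by
    clear * -
    induction r with
    | zero => simp
    | succ r ih => rw [Finset.sum_range_succ]; push_cast; linarith
  have h5 := mixedInversions_lower_bound hε r
  rw [← hk] at h5
  have h6 := mul_le_mul_of_nonneg_left h5 (Int.natCast_nonneg r)
  have h7 : k * (2 * ∑ i ∈ Finset.range r, (i : ℤ)) = k * (r * (r - 1)) := by rw [h4]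
  rw [h3] at h1
  linarith

/-- The form needed for induction: `H` is the sum of `δ` over blocks already split off, and `p / q`
bounds the prefix densities from below. The prefix of least density `k / r` is split off. It
satisfies the block lemma, the remainder has prefix densities at least `k / r`, and the multiples of
`∑ δ` over the block cancel. Since `k / r ≥ p / q` and `H ≥ 0`, the leftover `-(k / r) * H` is good
enough. -/
theorem sum_mul_le_mixedInversions_aux (n : ℕ) : ∀ (ε δ : ℕ → ℤ) (H : ℤ) (p : ℤ) (q : ℕ),
    (∀ i, ε i = 0 ∨ ε i = 1) → (∀ i, δ i - 1 ≤ δ (i + 1)) →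
    (∀ j ≤ n, 0 ≤ H + ∑ i ∈ Finset.range j, δ i) → H + ∑ i ∈ Finset.range n, δ i = 0 → 0 < q →
    (∀ j ≤ n, p * j ≤ q * ∑ i ∈ Finset.range j, ε i) →
    q * ∑ i ∈ Finset.range n, ε i * δ i ≤ q * mixedInversions ε n - p * H := by
  induction n using Nat.strong_induction_on with | _ n ih =>
  intro ε δ H p q hε hδ hH hn hq hp
  rcases Nat.eq_zero_or_pos n with rfl | hn0
  · have : H = 0 := by simpa using hn
    simp [mixedInversions, this]
  obtain ⟨r, hr, hmin⟩ := Finset.exists_min_image (Finset.Icc 1 n)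
    (fun j => ((∑ i ∈ Finset.range j, ε i : ℤ) : ℚ) / j) ⟨1, by simp; omega⟩
  rw [Finset.mem_Icc] at hr
  set k := ∑ i ∈ Finset.range r, ε i with hk
  have hmin' : ∀ j ≤ n, k * j ≤ r * ∑ i ∈ Finset.range j, ε i := by
    intro j hj
    rcases Nat.eq_zero_or_pos j with rfl | hj0
    · simp
    · have := hmin j (Finset.mem_Icc.2 ⟨hj0, hj⟩)
      rw [div_le_div_iff₀ (by exact_mod_cast hr.1) (by exact_mod_cast hj0)] at this
      have : k * j ≤ (∑ i ∈ Finset.range j, ε i) * r := by exact_mod_cast this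
      linarith
  have hblock := sum_mul_le_of_block hε hδ (r := r) fun j hj => hmin' j (hj.trans hr.2)
  obtain ⟨m, rfl⟩ : ∃ m, n = r + m := ⟨n - r, by omega⟩
  have hrest := ih m (by omega) (fun i => ε (r + i)) (fun i => δ (r + i))
    (H + ∑ i ∈ Finset.range r, δ i) k r (fun i => hε _) (fun i => hδ (r + i)) (by
      intro j hj
      have := hH (r + j) (by omega)
      rw [Finset.sum_range_add] at this
      linarith) (by
      rw [Finset.sum_range_add] at hn
      linarith) hr.1 (by
      intro j hj
      have := hmin' (r + j) (by omega)
      rw [Finset.sum_range_add] at this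
      push_cast at this
      linarith)
  have hmix := mixedInversions_add hε r m
  rw [Finset.sum_range_add]
  rw [← hk] at hblock
  have hr0 : (0 : ℤ) < r := by exact_mod_cast hr.1
  have hq0 : (0 : ℤ) < q := by exact_mod_cast hq
  have hH0 : 0 ≤ H := by simpa using hH 0 (Nat.zero_le _)
  have h1 : (r : ℤ) * (∑ i ∈ Finset.range r, ε i * δ i +
      ∑ i ∈ Finset.range m, ε (r + i) * δ (r + i)) ≤ r * mixedInversions ε (r + m) - k * H := by
    have := mul_le_mul_of_nonneg_left hmix hr0.le
    linarith
  have h2 := mul_le_mul_of_nonneg_left h1 hq0.le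
  have h3 := mul_le_mul_of_nonneg_right (hp r (by omega)) hH0
  rw [← hk] at h3
  refine le_of_mul_le_mul_left ?_ hr0
  linarith

theorem sum_mul_le_mixedInversions {n : ℕ} {ε δ : ℕ → ℤ} (hε : ∀ i, ε i = 0 ∨ ε i = 1)
    (hδ : ∀ i, δ i - 1 ≤ δ (i + 1)) (hH : ∀ j ≤ n, 0 ≤ ∑ i ∈ Finset.range j, δ i)
    (hn : ∑ i ∈ Finset.range n, δ i = 0) :
    ∑ i ∈ Finset.range n, ε i * δ i ≤ mixedInversions ε n := by
  have := sum_mul_le_mixedInversions_aux n ε δ 0 0 1 hε hδ (by simpa using hH) (by simpa using hn)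
    one_pos (by
      intro j _
      simp only [zero_mul, Nat.cast_one, one_mul]
      refine Finset.sum_nonneg fun i _ => ?_
      rcases hε i with h | h <;> simp [h])
  simpa using this

end CutInequality

/-! ### Finite tournaments: sorting by score and splitting by parity -/

section Finite

open scoped Classical

variable {V : Type u}

theorem isAcyclicSet_of_adj_imp {D : Digraph V} {W : Set V} {r : V → V → Prop}
    (hirr : ∀ x, ¬ r x x) (htr : ∀ x y z, r x y → r y z → r x z)
    (h : ∀ x ∈ W, ∀ y ∈ W, D.Adj x y → r x y) : IsAcyclicSet D W := by
  intro c hc hW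
  obtain ⟨c', rfl⟩ := exists_map_val_eq hW
  have h1 : Cycle.Chain (fun a b : W => r a b) c' := by
    have := (Cycle.chain_map (r := D.Adj) (Subtype.val : W → V)).1 hc.2.2
    exact this.imp fun a b hab => h a a.2 b b.2 hab
  have : IsTrans W (fun a b : W => r a b) := ⟨fun a b c => htr a b c⟩
  have : Std.Irrefl (fun a b : W => r a b) := ⟨fun a => hirr a⟩
  have h2 := h1.eq_nil_of_irrefl
  have h3 := hc.2.1
  simp [h2] at h3

theorem isAcyclicSet_of_strictMono {D : Digraph V} {W : Set V} (pos : V → ℕ)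
    (h : ∀ x ∈ W, ∀ y ∈ W, D.Adj x y → pos x < pos y) : IsAcyclicSet D W :=
  isAcyclicSet_of_adj_imp (r := fun x y => pos x < pos y) (fun _ => lt_irrefl _)
    (fun _ _ _ => lt_trans) h

theorem two_mul_sum_inside {r : V → V → Prop} [∀ x y, Decidable (r x y)] (hirr : ∀ x, ¬ r x x)
    (hone : ∀ x y, x ≠ y → (r x y ↔ ¬ r y x)) (S : Finset V) :
    2 * ∑ v ∈ S, ∑ w ∈ S, (if r v w then (1 : ℤ) else 0) =
      ∑ v ∈ S, ∑ w ∈ S, if v = w then 0 else 1 := by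
  have h : ∑ v ∈ S, ∑ w ∈ S, (if r v w then (1 : ℤ) else 0) =
      ∑ v ∈ S, ∑ w ∈ S, (if r w v then (1 : ℤ) else 0) := Finset.sum_comm
  rw [two_mul]
  nth_rw 2 [h]
  simp only [← Finset.sum_add_distrib]
  refine Finset.sum_congr rfl fun v _ => Finset.sum_congr rfl fun w _ => ?_
  by_cases hvw : v = w
  · subst hvw; simp [hirr]
  · have := hone v w hvw
    by_cases h1 : r w v <;> simp [hvw, h1, this]

variable [Fintype V]

/-- The out-degree of a vertex. -/
noncomputable def score (D : Digraph V) (v : V) : ℤ :=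
  ∑ w, if D.Adj v w then 1 else 0

theorem flow_apply (A : Finset (V × V)) (v : V) :
    flow A v = ∑ w, ((if (v, w) ∈ A then (1 : ℤ) else 0) - if (w, v) ∈ A then 1 else 0) := by
  have h1 : flow A v = ∑ p : V × V, if p ∈ A then
      ((if p.1 = v then (1 : ℤ) else 0) - if p.2 = v then 1 else 0) else 0 := by
    rw [flow, Finsupp.finsetSum_apply, Finset.sum_ite_mem, Finset.univ_inter]
    refine Finset.sum_congr rfl fun p _ => ?_
    simp [Finsupp.single_apply]
  have h2 : ∀ p : V × V, (if p ∈ A then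
      ((if p.1 = v then (1 : ℤ) else 0) - if p.2 = v then 1 else 0) else 0) =
      (if p.1 = v then if p ∈ A then 1 else 0 else 0) -
        (if p.2 = v then if p ∈ A then 1 else 0 else 0) := by
    intro p; split_ifs <;> rfl
  rw [h1, Finset.sum_congr rfl fun p _ => h2 p, Finset.sum_sub_distrib, Finset.sum_sub_distrib,
    Fintype.sum_prod_type, Fintype.sum_prod_type_right]
  congr 1
  · rw [Finset.sum_eq_single v]
    · simp
    · intro b _ hb; simp [hb]
    · simp
  · rw [Finset.sum_eq_single v]
    · simp
    · intro b _ hb; simp [hb]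
    · simp

/-- At each vertex the out-degree changes by the net out-flow of `A`, which is zero. Thus the order
by scores survives all later reversals. -/
theorem score_toggle {D : Digraph V} (hD : IsTournament D) {A : Finset (V × V)}
    (hA : ∀ a ∈ A, D.Adj a.1 a.2) (h0 : flow A = 0) (v : V) :
    score (toggle D (arcEdges A)) v = score D v := by
  have h1 : flow A v = 0 := by rw [h0]; rfl
  rw [flow_apply] at h1
  suffices key : ∀ w, (if (toggle D (arcEdges A)).Adj v w then (1 : ℤ) else 0) =
      (if D.Adj v w then 1 else 0) -
        ((if (v, w) ∈ A then (1 : ℤ) else 0) - if (w, v) ∈ A then 1 else 0) by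
    rw [score, score, Finset.sum_congr rfl fun w _ => key w, Finset.sum_sub_distrib, h1, sub_zero]
  intro w
  by_cases ha : (v, w) ∈ A
  · have hvw := hA _ ha
    have hwv := hD.asymm hvw
    have hb : (w, v) ∉ A := fun h => hwv (hA _ h)
    rw [toggle_adj_of_mem (mem_arcEdges.2 (Or.inl ha))]
    simp [ha, hb, hwv, hvw]
  · by_cases hb : (w, v) ∈ A
    · have hwv := hA _ hb
      have hvw := hD.asymm hwv
      rw [toggle_adj_of_mem (mem_arcEdges.2 (Or.inr hb))]
      simp [ha, hb, hwv, hvw]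
    · rw [toggle_adj_of_notMem (by rw [mem_arcEdges]; tauto)]
      simp [ha, hb]

theorem sum_range_ite_lt (n i : ℕ) (hi : i < n) :
    ∑ j ∈ Finset.range n, (if i < j then (1 : ℤ) else 0) = n - 1 - i := by
  induction n with
  | zero => omega
  | succ n ih =>
    rw [Finset.sum_range_succ]
    rcases Nat.lt_or_ge i n with h | h
    · rw [ih h, if_pos h]; push_cast; ring
    · have : i = n := by omega
      subst this
      rw [Finset.sum_eq_zero]
      · simp
      · intro j hj
        have := Finset.mem_range.1 hj
        simp; omega

variable {n : ℕ} (e : V ≃ Fin n)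

theorem sum_range_eq_sum (F : ℕ → ℤ) :
    ∑ i ∈ Finset.range n, F i = ∑ v : V, F (e v) := by
  rw [Finset.sum_range, ← Equiv.sum_comp e]

/-- The cut form of the score deficiency of a vertex set. -/
theorem sum_deficiency {D : Digraph V} (hD : IsTournament D) (S : Finset V) :
    ∑ v ∈ S, ((n : ℤ) - 1 - (e v : ℕ) - score D v) =
      ∑ v ∈ S, ∑ w ∈ Sᶜ, ((if e v < e w then (1 : ℤ) else 0) - if D.Adj v w then 1 else 0) := by
  have h1 : ∀ v, (n : ℤ) - 1 - (e v : ℕ) = ∑ w, if e v < e w then (1 : ℤ) else 0 := by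
    intro v
    rw [← sum_range_ite_lt n (e v) (e v).2, sum_range_eq_sum e]
    rfl
  have h2 : 2 * ∑ v ∈ S, ∑ w ∈ S, (if e v < e w then (1 : ℤ) else 0) =
      2 * ∑ v ∈ S, ∑ w ∈ S, (if D.Adj v w then (1 : ℤ) else 0) := by
    rw [two_mul_sum_inside hD.loopless hD.exactly_one,
      two_mul_sum_inside (r := fun v w => e v < e w)]
    · simp
    · intro x y hxy
      have := e.injective.ne hxy
      rw [not_lt]
      exact ⟨fun h => h.le, fun h => lt_of_le_of_ne h this⟩
  have h3 : ∀ v ∈ S, (n : ℤ) - 1 - (e v : ℕ) - score D v =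
      (∑ w ∈ S, (if e v < e w then (1 : ℤ) else 0) - ∑ w ∈ S, if D.Adj v w then (1 : ℤ) else 0) +
      ∑ w ∈ Sᶜ, ((if e v < e w then (1 : ℤ) else 0) - if D.Adj v w then 1 else 0) := by
    intro v _
    rw [h1, score, ← Finset.sum_add_sum_compl S, ← Finset.sum_add_sum_compl S (fun w =>
      if D.Adj v w then (1 : ℤ) else 0), Finset.sum_sub_distrib]
    ring
  rw [Finset.sum_congr rfl h3, Finset.sum_add_distrib, Finset.sum_sub_distrib]
  linarith

/-- By `sum_deficiency` the arcs leaving `S` number the forward pairs leaving `S` minus the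
deficiency of `S`. The numerical inequality bounds the deficiency by the forward pairs of mixed
parity, so those of equal parity remain. Sorted scores give `δ i - 1 ≤ δ (i + 1)`. -/
theorem score_cut_inequality {D : Digraph V} (hD : IsTournament D)
    (hs : ∀ v w, e v ≤ e w → score D w ≤ score D v) (S : Finset V) :
    ∑ v ∈ S, ∑ w ∈ Sᶜ, (if e v < e w ∧ (e v : ℕ) % 2 = (e w : ℕ) % 2 then (1 : ℤ) else 0) ≤
      ∑ v ∈ S, ∑ w ∈ Sᶜ, if D.Adj v w then 1 else 0 := by
  have hs0 : ∀ v, 0 ≤ score D v := fun v => Finset.sum_nonneg fun w _ => by split_ifs <;> simp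
  -- Scores are non-negative, so the value `0` beyond `n` keeps `s` non-increasing on all of `ℕ`.
  let s : ℕ → ℤ := fun i => if h : i < n then score D (e.symm ⟨i, h⟩) else 0
  have hse : ∀ v, s (e v) = score D v := by
    intro v; simp [s]
  let δ : ℕ → ℤ := fun i => n - 1 - i - s i
  let ε : ℕ → ℤ := fun i => if ∃ v ∈ S, (e v : ℕ) = i then 1 else 0
  have hεe : ∀ v, ε (e v) = if v ∈ S then 1 else 0 := by
    intro v
    have : (∃ w ∈ S, (e w : ℕ) = e v) ↔ v ∈ S := by
      constructor
      · rintro ⟨w, hw, h⟩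
        rwa [← e.injective (Fin.ext h)]
      · intro h; exact ⟨v, h, rfl⟩
    simp only [ε, this]
  have hε : ∀ i, ε i = 0 ∨ ε i = 1 := by
    intro i
    simp only [ε]
    split_ifs <;> simp
  have hδ : ∀ i, δ i - 1 ≤ δ (i + 1) := by
    intro i
    have : s (i + 1) ≤ s i := by
      simp only [s]
      split_ifs with h1 h2 h2
      · exact hs _ _ (by simp)
      · omega
      · exact hs0 _
      · exact le_rfl
    simp only [δ]; push_cast; linarith
  have hδsum : ∀ j ≤ n, ∑ i ∈ Finset.range j, δ i =
      ∑ v ∈ Finset.univ.filter (fun v => (e v : ℕ) < j), ((n : ℤ) - 1 - (e v : ℕ) - score D v) := by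
    intro j hj
    have h1 : ∑ i ∈ Finset.range j, δ i = ∑ i ∈ Finset.range n, if i < j then δ i else 0 := by
      rw [← Finset.sum_filter]
      refine Finset.sum_congr ?_ fun _ _ => rfl
      ext i; simp; omega
    rw [h1, sum_range_eq_sum e, Finset.sum_filter]
    refine Finset.sum_congr rfl fun v _ => ?_
    simp only [δ, hse]
  have hineq := sum_mul_le_mixedInversions (n := n) hε hδ ?_ ?_
  · have h1 : ∑ i ∈ Finset.range n, ε i * δ i =
        ∑ v ∈ S, ((n : ℤ) - 1 - (e v : ℕ) - score D v) := by
      rw [sum_range_eq_sum e, ← Finset.sum_filter_add_sum_filter_not Finset.univ (· ∈ S)]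
      simp only [hεe, δ, hse]
      rw [Finset.sum_congr (s₁ := Finset.univ.filter (· ∉ S)) rfl (g := fun _ => 0)]
      · simp
      · intro v hv
        simp [(Finset.mem_filter.1 hv).2]
    have h2 : mixedInversions ε n = ∑ v ∈ S, ∑ w ∈ Sᶜ,
        if e v < e w ∧ (e v : ℕ) % 2 ≠ (e w : ℕ) % 2 then (1 : ℤ) else 0 := by
      have h3 : mixedInversions ε n = ∑ j ∈ Finset.range n, ∑ i ∈ Finset.range n,
          if i < j ∧ i % 2 ≠ j % 2 then ε i * (1 - ε j) else 0 := by
        rw [mixedInversions]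
        refine Finset.sum_congr rfl fun j hj => ?_
        have hj := Finset.mem_range.1 hj
        have : Finset.range j = (Finset.range n).filter (· < j) := by
          ext i; simp; omega
        rw [this, Finset.sum_filter]
        refine Finset.sum_congr rfl fun i _ => ?_
        by_cases h1 : i < j <;> by_cases h2 : i % 2 = j % 2 <;> simp [h1, h2]
      rw [h3, Finset.sum_comm, sum_range_eq_sum e]
      simp only [sum_range_eq_sum e, hεe]
      rw [← Finset.sum_add_sum_compl S]
      refine (congrArg₂ (· + ·) ?_ ?_).trans (add_zero _)
      · refine Finset.sum_congr rfl fun v hv => ?_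
        rw [← Finset.sum_add_sum_compl S]
        refine (congrArg₂ (· + ·) ?_ ?_).trans (zero_add _)
        · refine Finset.sum_eq_zero fun w hw => ?_
          simp [hw]
        · refine Finset.sum_congr rfl fun w hw => ?_
          simp [hv, Finset.mem_compl.1 hw]
      · refine Finset.sum_eq_zero fun v hv => Finset.sum_eq_zero fun w _ => ?_
        simp [Finset.mem_compl.1 hv]
    rw [h1, h2, sum_deficiency e hD] at hineq
    have h4 : ∑ v ∈ S, ∑ w ∈ Sᶜ, ((if e v < e w then (1 : ℤ) else 0) - if D.Adj v w then 1 else 0) =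
        ∑ v ∈ S, ∑ w ∈ Sᶜ, (if e v < e w ∧ (e v : ℕ) % 2 = (e w : ℕ) % 2 then (1 : ℤ) else 0) +
        ∑ v ∈ S, ∑ w ∈ Sᶜ, (if e v < e w ∧ (e v : ℕ) % 2 ≠ (e w : ℕ) % 2 then (1 : ℤ) else 0) -
        ∑ v ∈ S, ∑ w ∈ Sᶜ, if D.Adj v w then (1 : ℤ) else 0 := by
      simp only [← Finset.sum_add_distrib, ← Finset.sum_sub_distrib]
      refine Finset.sum_congr rfl fun v _ => Finset.sum_congr rfl fun w _ => ?_
      by_cases h1 : e v < e w <;> by_cases h2 : (e v : ℕ) % 2 = (e w : ℕ) % 2 <;> simp [h1, h2]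
    linarith
  -- For an initial segment every pair across the cut is forward, so its deficiency counts arcs
  -- entering it.
  · intro j hj
    rw [hδsum j hj, sum_deficiency e hD]
    refine Finset.sum_nonneg fun v hv => Finset.sum_nonneg fun w hw => ?_
    simp only [Finset.mem_compl, Finset.mem_filter, Finset.mem_univ, true_and] at hv hw
    have : e v < e w := Fin.lt_def.2 (by omega)
    simp only [this, if_true]
    split_ifs <;> simp
  · rw [hδsum n le_rfl]
    have : Finset.univ.filter (fun v => (e v : ℕ) < n) = Finset.univ := by
      ext v; simp
    rw [this, sum_deficiency e hD]
    simp

/-- The pairs of equal parity whose arc goes backwards. -/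
noncomputable def violations (D : Digraph V) : Finset (V × V) :=
  Finset.univ.filter fun p => e p.1 < e p.2 ∧ (e p.1 : ℕ) % 2 = (e p.2 : ℕ) % 2 ∧ D.Adj p.2 p.1

theorem exists_reach_of_violation {D : Digraph V} (hD : IsTournament D)
    (hs : ∀ v w, e v ≤ e w → score D w ≤ score D v) {i j : V} (hij : (i, j) ∈ violations e D) :
    ∃ A : Finset (V × V), (∀ a ∈ A, D.Adj a.1 a.2) ∧ flow A = 0 ∧
      violations e (toggle D (arcEdges A)) ⊂ violations e D := by
  simp only [violations, Finset.mem_filter, Finset.mem_univ, true_and] at hij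
  obtain ⟨hlt, hpar, hji⟩ := hij
  -- The arcs allowed on a return path from `i` to `j`: between vertices of equal parity only
  -- backward arcs may be used, so that reversing the path creates no violation.
  let step : V → V → Prop := fun x y => D.Adj x y ∧ (x, y) ≠ (j, i) ∧
    ((e x : ℕ) % 2 = (e y : ℕ) % 2 → e y < e x)
  have hpath : Relation.ReflTransGen step i j := by
    by_contra hcon
    -- The set reachable from `i`. All arcs leaving it are forward of equal parity, yet the forward
    -- equal-parity pair `(i, j)` crosses without being an arc; this contradicts the cut inequality.
    let S : Finset V := Finset.univ.filter fun v => Relation.ReflTransGen step i v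
    have hS : ∀ v, v ∈ S ↔ Relation.ReflTransGen step i v := by intro v; simp [S]
    have hiS : i ∈ S := (hS i).2 Relation.ReflTransGen.refl
    have hjS : j ∈ Sᶜ := by rw [Finset.mem_compl, hS]; exact hcon
    have hcut := score_cut_inequality e hD hs S
    have hout : ∀ v ∈ S, ∀ w ∈ Sᶜ, D.Adj v w →
        e v < e w ∧ (e v : ℕ) % 2 = (e w : ℕ) % 2 := by
      intro v hv w hw hvw
      rw [Finset.mem_compl] at hw
      have h1 : ¬ step v w := fun h => hw ((hS w).2 (((hS v).1 hv).tail h))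
      have h2 : (v, w) ≠ (j, i) := by
        intro h
        rw [Prod.mk.injEq] at h
        exact hw (h.2 ▸ hiS)
      simp only [step, not_and, not_forall] at h1
      obtain ⟨h3, h4⟩ := h1 hvw h2
      exact ⟨lt_of_le_of_ne (not_lt.1 h4) (e.injective.ne (hD.ne hvw)), h3⟩
    have hlt' : ∑ v ∈ S, ∑ w ∈ Sᶜ, (if D.Adj v w then (1 : ℤ) else 0) <
        ∑ v ∈ S, ∑ w ∈ Sᶜ,
          (if e v < e w ∧ (e v : ℕ) % 2 = (e w : ℕ) % 2 then (1 : ℤ) else 0) := by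
      have hle : ∀ v ∈ S, ∀ w ∈ Sᶜ, (if D.Adj v w then (1 : ℤ) else 0) ≤
          if e v < e w ∧ (e v : ℕ) % 2 = (e w : ℕ) % 2 then (1 : ℤ) else 0 := by
        intro v hv w hw
        by_cases h : D.Adj v w
        · simp only [h, if_true, hout v hv w hw h, and_self]
          exact le_rfl
        · simp only [h, if_false]
          split_ifs <;> simp
      refine Finset.sum_lt_sum (fun v hv => Finset.sum_le_sum (hle v hv)) ⟨i, hiS, ?_⟩
      refine Finset.sum_lt_sum (hle i hiS) ⟨j, hjS, ?_⟩
      simp [hD.asymm hji, hlt, hpar]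
    exact absurd hcut (not_le.2 hlt')
  obtain ⟨A₀, hA₀, hf₀⟩ := exists_flow_of_reflTransGen hpath
  have hnot : (j, i) ∉ A₀ := fun h => (hA₀ _ h).2.1 rfl
  have hA : ∀ a ∈ insert (j, i) A₀, D.Adj a.1 a.2 := by
    intro a ha
    rcases Finset.mem_insert.1 ha with rfl | ha
    · exact hji
    · exact (hA₀ a ha).1
  refine ⟨insert (j, i) A₀, hA, ?_, ?_⟩
  · have : flow (insert (j, i) A₀) = (Finsupp.single j 1 - Finsupp.single i 1) + flow A₀ :=
      Finset.sum_insert hnot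
    rw [this, hf₀]
    simp
  · rw [Finset.ssubset_iff_of_subset]
    · refine ⟨(i, j), ?_, ?_⟩
      · simp only [violations, Finset.mem_filter, Finset.mem_univ, true_and]
        exact ⟨hlt, hpar, hji⟩
      · simp only [violations, Finset.mem_filter, Finset.mem_univ, true_and, not_and]
        intro _ _
        rw [toggle_adj_of_mem (mem_arcEdges.2 (Or.inl (Finset.mem_insert_self _ _)))]
        exact hD.asymm hji
    · rintro ⟨v, w⟩ h
      simp only [violations, Finset.mem_filter, Finset.mem_univ, true_and] at h ⊢
      obtain ⟨h1, h2, h3⟩ := h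
      refine ⟨h1, h2, ?_⟩
      by_cases hm : s(w, v) ∈ arcEdges (insert (j, i) A₀)
      · rw [toggle_adj_of_mem hm] at h3
        rw [Sym2.eq_swap, mem_arcEdges_iff hD hA h3] at hm
        rcases Finset.mem_insert.1 hm with hm | hm
        · rw [Prod.mk.injEq] at hm
          obtain ⟨rfl, rfl⟩ := hm
          exact absurd h1 hlt.not_gt
        · exact absurd h1 ((hA₀ _ hm).2.2 h2).not_gt
      · rwa [toggle_adj_of_notMem hm] at h3

theorem Reducible.of_sorted {D : Digraph V} (hD : IsTournament D)
    (hs : ∀ v w, e v ≤ e w → score D w ≤ score D v) : Reducible D := by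
  induction hX : violations e D using Finset.strongInduction generalizing D with | H X ih =>
  subst hX
  rcases (violations e D).eq_empty_or_nonempty with h0 | ⟨⟨i, j⟩, hij⟩
  · have hmono : ∀ x y, (e x : ℕ) % 2 = (e y : ℕ) % 2 → D.Adj x y → (e x : ℕ) < e y := by
      intro x y hpar hxy
      by_contra hcon
      have hne : e x ≠ e y := e.injective.ne (hD.ne hxy)
      have : (y, x) ∈ violations e D := by
        simp only [violations, Finset.mem_filter, Finset.mem_univ, true_and]
        exact ⟨lt_of_le_of_ne (not_lt.1 hcon) hne.symm, hpar.symm, hxy⟩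
      rw [h0] at this
      simp at this
    refine ⟨∅, ∅, Reach.refl D _, {v | (e v : ℕ) % 2 = 0}, ?_, ?_⟩ <;> rw [toggle_empty] <;>
      refine isAcyclicSet_of_strictMono (fun v => (e v : ℕ)) fun x hx y hy h => hmono x y ?_ h
    · rw [mem_ofPred_eq] at hx hy
      rw [hx, hy]
    · rw [mem_compl_iff, mem_ofPred_eq] at hx hy
      omega
  · obtain ⟨A, hA, hf, hlt⟩ := exists_reach_of_violation e hD hs hij
    refine Reducible.of_reach (Reach.of_flow_eq_zero hD hA hf)
      (ih _ hlt (hD.toggle _) ?_ rfl)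
    simpa only [score_toggle hD hA hf] using hs

theorem Reducible.of_finite {V : Type u} [Finite V] {D : Digraph V} (hD : IsTournament D) :
    Reducible D := by
  obtain ⟨n, ⟨e₀⟩⟩ := Finite.exists_equiv_fin V
  have := Fintype.ofFinite V
  let f : Fin n → ℤ := fun i => - score D (e₀.symm i)
  refine Reducible.of_sorted (e₀.trans (Tuple.sort f).symm) hD fun v w h => ?_
  have := Tuple.monotone_sort f h
  simpa [f] using this

end Finite

/-! ### König's lemma and reversal of rays and double rays -/

section Rays

open scoped Classical

variable {V : Type u}

/-- König's lemma for a relation with finite out-neighbourhoods. -/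
theorem exists_ray {r : V → V → Prop} (hfin : ∀ x, {y | r x y}.Finite) {x : V}
    (hinf : {y | Relation.ReflTransGen r x y}.Infinite) :
    ∃ y : ℕ → V, y 0 = x ∧ Function.Injective y ∧ ∀ n, r (y n) (y (n + 1)) := by
  -- Vertices reachable from `x` by a walk not re-entering the set `P` of vertices already used. If
  -- `R P x` is infinite, some out-neighbour of `x` outside `insert x P` inherits an infinite set;
  -- recording `P` makes the ray injective.
  let R : Set V → V → Set V := fun P x => {y | Relation.ReflTransGen (fun a b => r a b ∧ b ∉ P) x y}
  have hsplit : ∀ P x y, y ∈ R P x → y = x ∨ ∃ z, r x z ∧ z ∉ insert x P ∧ y ∈ R (insert x P) z := by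
    intro P x y hy
    induction hy with
    | refl => exact Or.inl rfl
    | @tail a b _ hab ih =>
      by_cases hb : b = x
      · exact Or.inl hb
      right
      have hb' : b ∉ insert x P := by
        rintro (h | h)
        · exact hb h
        · exact hab.2 h
      rcases ih with rfl | ⟨z, h1, h2, h3⟩
      · exact ⟨b, hab.1, hb', Relation.ReflTransGen.refl⟩
      · exact ⟨z, h1, h2, h3.tail ⟨hab.1, hb'⟩⟩
  have hstep : ∀ s : {s : Set V × V // (R s.1 s.2).Infinite},
      ∃ t : {s : Set V × V // (R s.1 s.2).Infinite}, t.1.1 = insert s.1.2 s.1.1 ∧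
        r s.1.2 t.1.2 ∧ t.1.2 ∉ t.1.1 := by
    rintro ⟨⟨P, x⟩, hs⟩
    by_contra! hcon
    refine hs (Set.Finite.subset ((Set.Finite.biUnion (s := {z | r x z ∧ z ∉ insert x P})
      ((hfin x).subset fun z hz => hz.1) (t := fun z => R (insert x P) z) ?_).insert x) ?_)
    · rintro z ⟨h1, h2⟩
      by_contra h3
      exact h2 (hcon ⟨(insert x P, z), h3⟩ rfl h1)
    · intro y hy
      rcases hsplit P x y hy with rfl | ⟨z, h1, h2, h3⟩
      · exact mem_insert _ _
      · exact mem_insert_of_mem _ (mem_biUnion ⟨h1, h2⟩ h3)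
  choose nxt h1 h2 h3 using hstep
  have h0 : (R ∅ x).Infinite := by simpa [R] using hinf
  let s : ℕ → {s : Set V × V // (R s.1 s.2).Infinite} := fun n => nxt^[n] ⟨(∅, x), h0⟩
  have hs : ∀ n, s (n + 1) = nxt (s n) := fun n => Function.iterate_succ_apply' _ _ _
  have hmem : ∀ m n, m < n → (s m).1.2 ∈ (s n).1.1 := by
    intro m n hmn
    induction n with
    | zero => omega
    | succ n ih =>
      rw [hs, h1]
      rcases Nat.lt_succ_iff_lt_or_eq.1 hmn with h | rfl
      · exact mem_insert_of_mem _ (ih h)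
      · exact mem_insert _ _
  have hnot : ∀ n, (s n).1.2 ∉ (s n).1.1 := by
    intro n
    cases n with
    | zero => exact notMem_empty _
    | succ n => rw [hs]; exact h3 _
  refine ⟨fun n => (s n).1.2, rfl, ?_, fun n => ?_⟩
  · intro m n hmn
    by_contra hne
    rcases Nat.lt_or_gt_of_ne hne with h | h
    · have := hmem m n h
      rw [show (s m).1.2 = (s n).1.2 from hmn] at this
      exact hnot n this
    · have := hmem n m h
      rw [← show (s m).1.2 = (s n).1.2 from hmn] at this
      exact hnot m this
  · change r (s n).1.2 (s (n + 1)).1.2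
    rw [hs]; exact h2 _

theorem flow_singleton (a b : V) :
    flow {(a, b)} = Finsupp.single a 1 - Finsupp.single b 1 := by
  simp [flow]

theorem flow_ray {y : ℕ → V} (hy : Function.Injective y) (n : ℕ) :
    flow ((Finset.range n).image fun i => (y i, y (i + 1))) =
      Finsupp.single (y 0) 1 - Finsupp.single (y n) 1 := by
  rw [flow, Finset.sum_image fun a _ b _ h => hy (Prod.ext_iff.1 h).1]
  exact Finset.sum_range_sub' (fun i => Finsupp.single (y i) (1 : ℤ)) n

/-- A ray all but finitely many of whose vertices dominate its first vertex can be reversed. -/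
theorem Reach.of_ray {D : Digraph V} (hD : IsTournament D) {y : ℕ → V}
    (hy : Function.Injective y) (hray : ∀ n, D.Adj (y n) (y (n + 1))) {N : ℕ}
    (hN : ∀ n, N ≤ n → D.Adj (y n) (y 0)) :
    Reach D {p | ∃ n, p = s(y n, y (n + 1))} {p | ∃ m n, p = s(y m, y n)} := by
  let A : ℕ → Finset (V × V) := fun n => (Finset.range (n + N)).image fun i => (y i, y (i + 1))
  -- The initial segment ending at `y (n + N)` is closed by the single arc back to `y 0`; the shift
  -- by `N` ensures that this arc exists.
  let Q : ℕ → Finset (V × V) := fun n => {(y (n + N), y 0)}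
  have key := Reach.of_returns hD (A := A) (Q := Q) ?_ ?_ ?_ ?_ ?_ ?_
  · have e : (⋃ n, arcEdges (A n)) = {p | ∃ n, p = s(y n, y (n + 1))} := by
      ext p
      simp only [mem_iUnion]
      constructor
      · rintro ⟨n, a, ha, rfl⟩
        obtain ⟨i, -, rfl⟩ := Finset.mem_image.1 ha
        exact ⟨i, rfl⟩
      · rintro ⟨n, rfl⟩
        exact ⟨n + 1, (y n, y (n + 1)),
          Finset.mem_image_of_mem _ (Finset.mem_range.2 (by omega)), rfl⟩
    rw [e] at key
    refine key.mono (iUnion_subset fun n => ?_)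
    rintro p ⟨a, ha, rfl⟩
    rcases Finset.mem_union.1 ha with ha | ha
    · obtain ⟨i, -, rfl⟩ := Finset.mem_image.1 ha
      exact ⟨i, i + 1, rfl⟩
    · rw [Finset.mem_singleton.1 ha]
      exact ⟨n + N, 0, rfl⟩
  · intro m n hmn
    exact Finset.image_subset_image (Finset.range_mono (by omega))
  · intro n a ha
    obtain ⟨i, -, rfl⟩ := Finset.mem_image.1 ha
    exact hray i
  · intro n a ha
    rw [Finset.mem_singleton.1 ha]
    exact hN _ (by omega)
  · intro m n
    rw [Finset.disjoint_singleton_right]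
    intro h
    obtain ⟨i, -, h⟩ := Finset.mem_image.1 h
    have := hy (Prod.ext_iff.1 h).2
    omega
  · intro m n hmn
    rw [Finset.disjoint_singleton]
    intro h
    have := hy (Prod.ext_iff.1 h).1
    omega
  · intro n
    rw [flow_ray hy, flow_singleton]
    abel

/-- A double ray all but finitely many of whose late vertices dominate the corresponding early
vertices can be reversed. -/
theorem Reach.of_doubleRay {D : Digraph V} (hD : IsTournament D) {x y : ℕ → V}
    (hx : Function.Injective x) (hy : Function.Injective y) (hxy : ∀ m n, x m ≠ y n)
    (hxray : ∀ n, D.Adj (x (n + 1)) (x n)) (hyray : ∀ n, D.Adj (y n) (y (n + 1)))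
    (h0 : D.Adj (x 0) (y 0)) {N : ℕ} (hN : ∀ n, N ≤ n → D.Adj (y n) (x n)) :
    ∃ T, Reach D {p | p = s(x 0, y 0) ∨ (∃ n, p = s(x n, x (n + 1))) ∨
      ∃ n, p = s(y n, y (n + 1))} T := by
  let A₁ : ℕ → Finset (V × V) := fun n => (Finset.range (n + N)).image fun i => (y i, y (i + 1))
  let A₂ : ℕ → Finset (V × V) := fun n => (Finset.range (n + N)).image fun i => (x i, x (i + 1))
  let A : ℕ → Finset (V × V) := fun n => {(x 0, y 0)} ∪ (A₁ n ∪ (A₂ n).image Prod.swap)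
  let Q : ℕ → Finset (V × V) := fun n => {(y (n + N), x (n + N))}
  have hA₂ : ∀ n a, a ∈ (A₂ n).image Prod.swap ↔ ∃ i < n + N, a = (x (i + 1), x i) := by
    intro n a
    simp only [A₂, Finset.mem_image, Finset.mem_range]
    constructor
    · rintro ⟨_, ⟨i, hi, rfl⟩, rfl⟩; exact ⟨i, hi, rfl⟩
    · rintro ⟨i, hi, rfl⟩; exact ⟨_, ⟨i, hi, rfl⟩, rfl⟩
  have hA : ∀ n a, a ∈ A n ↔ a = (x 0, y 0) ∨ (∃ i < n + N, a = (y i, y (i + 1))) ∨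
      ∃ i < n + N, a = (x (i + 1), x i) := by
    intro n a
    simp only [A, Finset.mem_union, Finset.mem_singleton, hA₂]
    simp only [A₁, Finset.mem_image, Finset.mem_range, eq_comm (a := a)]
  have key := Reach.of_returns hD (A := A) (Q := Q) ?_ ?_ ?_ ?_ ?_ ?_
  · have e : (⋃ n, arcEdges (A n)) = {p | p = s(x 0, y 0) ∨ (∃ n, p = s(x n, x (n + 1))) ∨
        ∃ n, p = s(y n, y (n + 1))} := by
      ext p
      simp only [mem_iUnion]
      constructor
      · rintro ⟨n, a, ha, rfl⟩
        rcases (hA n a).1 ha with rfl | ⟨i, -, rfl⟩ | ⟨i, -, rfl⟩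
        · exact Or.inl rfl
        · exact Or.inr (Or.inr ⟨i, rfl⟩)
        · exact Or.inr (Or.inl ⟨i, Sym2.eq_swap⟩)
      · rintro (rfl | ⟨n, rfl⟩ | ⟨n, rfl⟩)
        · exact ⟨0, (x 0, y 0), (hA _ _).2 (Or.inl rfl), rfl⟩
        · exact ⟨n + 1, (x (n + 1), x n), (hA _ _).2 (Or.inr (Or.inr ⟨n, by omega, rfl⟩)),
            Sym2.eq_swap⟩
        · exact ⟨n + 1, (y n, y (n + 1)), (hA _ _).2 (Or.inr (Or.inl ⟨n, by omega, rfl⟩)), rfl⟩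
    rw [e] at key
    exact ⟨_, key⟩
  · intro m n hmn a ha
    rw [hA] at ha ⊢
    rcases ha with h | ⟨i, hi, h⟩ | ⟨i, hi, h⟩
    · exact Or.inl h
    · exact Or.inr (Or.inl ⟨i, by omega, h⟩)
    · exact Or.inr (Or.inr ⟨i, by omega, h⟩)
  · intro n a ha
    rcases (hA n a).1 ha with rfl | ⟨i, -, rfl⟩ | ⟨i, -, rfl⟩
    · exact h0
    · exact hyray i
    · exact hxray i
  · intro n a ha
    rw [Finset.mem_singleton.1 ha]
    exact hN _ (by omega)
  · intro m n
    rw [Finset.disjoint_singleton_right]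
    intro h
    rcases (hA m _).1 h with h | ⟨i, -, h⟩ | ⟨i, -, h⟩
    · exact hxy _ _ (Prod.ext_iff.1 h).1.symm
    · exact hxy _ _ (Prod.ext_iff.1 h).2
    · exact hxy _ _ (Prod.ext_iff.1 h).1.symm
  · intro m n hmn
    rw [Finset.disjoint_singleton]
    intro h
    have := hy (Prod.ext_iff.1 h).1
    omega
  · intro n
    have d2 : Disjoint (A₁ n) ((A₂ n).image Prod.swap) := by
      rw [Finset.disjoint_left]
      intro a ha ha'
      obtain ⟨i, -, rfl⟩ := Finset.mem_image.1 ha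
      obtain ⟨j, -, h⟩ := (hA₂ _ _).1 ha'
      exact hxy _ _ (Prod.ext_iff.1 h).1.symm
    have d1 : Disjoint {(x 0, y 0)} (A₁ n ∪ (A₂ n).image Prod.swap) := by
      rw [Finset.disjoint_singleton_left, Finset.mem_union, not_or]
      constructor
      · intro h
        obtain ⟨i, -, h⟩ := Finset.mem_image.1 h
        exact hxy _ _ (Prod.ext_iff.1 h).1.symm
      · intro h
        obtain ⟨j, -, h⟩ := (hA₂ _ _).1 h
        exact hxy _ _ (Prod.ext_iff.1 h).2.symm
    simp only [A, Q]
    rw [flow_union d1, flow_union d2, flow_image_swap, flow_ray hy, flow_ray hx, flow_singleton,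
      flow_singleton]
    abel

end Rays

/-! ### Countable tournaments with finite out-degrees -/

section FiniteOut

variable {V : Type u}

/-- If `v` reaches only finitely many vertices, they are added to `F`. Otherwise there is a ray from
`v`; it misses `F`, which is finite and closed, and almost all its vertices dominate `v` since `v`
has finite out-degree. Reversing it lowers the out-degree of `v`, so this happens finitely often.
The clause on `T` freezes all pairs meeting `F`. -/
theorem exists_reach_finite_closed {D : Digraph V} (hD : IsTournament D)
    (hout : ∀ v, {w | D.Adj v w}.Finite) {F : Set V} (hF : F.Finite)
    (hcl : ∀ x ∈ F, ∀ y, D.Adj x y → y ∈ F) (v : V) :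
    ∃ (S T : Set (Sym2 V)) (F' : Set V), Reach D S T ∧ (∀ x y, s(x, y) ∈ T → x ∉ F) ∧ F ⊆ F' ∧
      v ∈ F' ∧ F'.Finite ∧ (∀ x ∈ F', ∀ y, (toggle D S).Adj x y → y ∈ F') ∧
      ∀ v, {w | (toggle D S).Adj v w}.Finite := by
  induction hk : {w | D.Adj v w}.ncard using Nat.strong_induction_on generalizing D with | _ k ih =>
  by_cases hR : {y | Relation.ReflTransGen D.Adj v y}.Finite
  · refine ⟨∅, ∅, F ∪ {y | Relation.ReflTransGen D.Adj v y}, Reach.refl _ _, ?_,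
      subset_union_left, Or.inr Relation.ReflTransGen.refl, hF.union hR, ?_, ?_⟩
    · rintro x y ⟨⟩
    · rw [toggle_empty]
      rintro x (hx | hx) y hxy
      · exact Or.inl (hcl x hx y hxy)
      · exact Or.inr (Relation.ReflTransGen.tail hx hxy)
    · rwa [toggle_empty]
  obtain ⟨y, hy0, hy, hray⟩ := exists_ray hout hR
  have hyF : ∀ n, y n ∉ F := by
    intro n hn
    have h1 : ∀ k, y (n + k) ∈ F := by
      intro k
      induction k with
      | zero => exact hn
      | succ k ih => exact hcl _ ih _ (hray _)
    refine Set.infinite_range_of_injective (hy.comp (add_right_injective n)) (hF.subset ?_)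
    rintro _ ⟨k, rfl⟩
    exact h1 k
  obtain ⟨N, hN⟩ : ∃ N, ∀ n, N ≤ n → D.Adj (y n) (y 0) := by
    have hfin : {n | n = 0 ∨ D.Adj v (y n)}.Finite := by
      refine ((hout v).preimage (f := y) hy.injOn |>.insert 0).subset ?_
      rintro n (h | h)
      · exact Or.inl h
      · exact Or.inr h
    obtain ⟨M, hM⟩ := hfin.bddAbove
    refine ⟨M + 1, fun n hn => ?_⟩
    have h1 : ¬ (n = 0 ∨ D.Adj v (y n)) := fun h => by
      have := hM h
      omega
    push Not at h1
    rcases hD.adj_or (hy.ne h1.1) with h | h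
    · exact h
    · rw [hy0] at h; exact absurd h h1.2
  have hreach := Reach.of_ray hD hy hray hN
  set S₀ : Set (Sym2 V) := {p | ∃ n, p = s(y n, y (n + 1))} with hS₀
  set T₀ : Set (Sym2 V) := {p | ∃ m n, p = s(y m, y n)} with hT₀
  have hT₀y : ∀ a b, s(a, b) ∈ T₀ → ∃ n, a = y n := by
    rintro a b ⟨m, n, h⟩
    rcases Sym2.eq_iff.1 h with ⟨rfl, -⟩ | ⟨rfl, -⟩
    · exact ⟨m, rfl⟩
    · exact ⟨n, rfl⟩
  have hST := hreach.subset
  have hout' : ∀ w, {z | (toggle D S₀).Adj w z}.Finite := by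
    intro w
    have hfin : {z | ∃ n, w = y (n + 1) ∧ z = y n}.Finite := by
      refine Set.Subsingleton.finite ?_
      rintro a ⟨m, h1, rfl⟩ b ⟨n, h2, rfl⟩
      have := hy (h1.symm.trans h2)
      rw [Nat.succ_injective this]
    refine ((hout w).union hfin).subset ?_
    intro z hz
    by_cases hp : s(w, z) ∈ S₀
    · right
      obtain ⟨n, hn⟩ := hp
      have hz := (toggle_adj_of_mem (show s(w, z) ∈ S₀ from ⟨n, hn⟩)).1 hz
      rcases Sym2.eq_iff.1 hn with ⟨rfl, rfl⟩ | ⟨rfl, rfl⟩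
      · exact absurd hz (hD.asymm (hray n))
      · exact ⟨n, rfl, rfl⟩
    · left; exact (toggle_adj_of_notMem hp).1 hz
  -- The vertex `v = y 0` loses the out-neighbour `y 1` and gains none, as no arc of the ray enters
  -- it.
  have hlt : {w | (toggle D S₀).Adj v w}.ncard < k := by
    rw [← hk]
    refine Set.ncard_lt_ncard ?_ (hout v)
    rw [Set.ssubset_iff_of_subset]
    · refine ⟨y 1, ?_, ?_⟩
      · rw [mem_ofPred_eq, ← hy0]; exact hray 0
      · rw [mem_ofPred_eq, ← hy0, toggle_adj_of_mem (show s(y 0, y 1) ∈ S₀ from ⟨0, rfl⟩)]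
        exact hD.asymm (hray 0)
    · intro z hz
      by_cases hp : s(v, z) ∈ S₀
      · have hz := (toggle_adj_of_mem hp).1 hz
        obtain ⟨n, hn⟩ := hp
        rw [← hy0] at hn hz
        rcases Sym2.eq_iff.1 hn with ⟨h1, rfl⟩ | ⟨h1, rfl⟩
        · have := hy h1
          subst this
          exact absurd hz (hD.asymm (hray 0))
        · have := hy h1
          omega
      · exact (toggle_adj_of_notMem hp).1 hz
  obtain ⟨S, T, F', h1, h2, h3, h4, h5, h6, h7⟩ := ih _ hlt (hD.toggle S₀) hout' (by
    intro a ha b hab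
    have hp : s(a, b) ∉ S₀ := fun h => by
      obtain ⟨n, rfl⟩ := hT₀y _ _ (hST h)
      exact hyF n ha
    exact hcl a ha b ((toggle_adj_of_notMem hp).1 hab)) rfl
  refine ⟨symmDiff S₀ S, T₀ ∪ T, F', hreach.trans h1, ?_, h3, h4, h5, ?_, ?_⟩
  · rintro a b (h | h)
    · obtain ⟨n, rfl⟩ := hT₀y _ _ h
      exact hyF n
    · exact h2 a b h
  · rwa [← toggle_toggle]
  · rwa [← toggle_toggle]

theorem Reducible.of_finite_out [Countable V] {D : Digraph V} (hD : IsTournament D)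
    (hout : ∀ v, {w | D.Adj v w}.Finite) : Reducible D := by
  cases isEmpty_or_nonempty V
  · exact Reducible.of_finite hD
  obtain ⟨g, hg⟩ := exists_surjective_nat V
  let P : Set (Sym2 V) × Set V → Prop := fun s => s.2.Finite ∧
    (∀ x ∈ s.2, ∀ y, (toggle D s.1).Adj x y → y ∈ s.2) ∧ ∀ v, {w | (toggle D s.1).Adj v w}.Finite
  have hstep : ∀ (n : ℕ) (s : {s // P s}), ∃ (t : {s // P s}) (T : Set (Sym2 V)),
      Reach (toggle D s.1.1) (symmDiff s.1.1 t.1.1) T ∧ (∀ x y, s(x, y) ∈ T → x ∉ s.1.2) ∧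
      s.1.2 ⊆ t.1.2 ∧ g n ∈ t.1.2 := by
    rintro n ⟨⟨E, F⟩, hs⟩
    obtain ⟨S, T, F', h1, h2, h3, h4, h5, h6, h7⟩ :=
      exists_reach_finite_closed (hD.toggle E) hs.2.2 hs.1 hs.2.1 (g n)
    refine ⟨⟨(symmDiff E S, F'), h5, ?_, ?_⟩, T, ?_, h2, h3, h4⟩
    · simpa only [toggle_toggle] using h6
    · simpa only [toggle_toggle] using h7
    · simpa using h1
  choose nxt T h1 h2 h3 h4 using hstep
  have hP0 : P (∅, ∅) := ⟨finite_empty, by simp, by simpa [toggle_empty] using hout⟩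
  let s : ℕ → {s // P s} := fun n => Nat.rec ⟨(∅, ∅), hP0⟩ (fun n s => nxt n s) n
  have hs : ∀ n, s (n + 1) = nxt n (s n) := fun n => rfl
  have hFmono : Monotone fun n => (s n).1.2 := by
    refine monotone_nat_of_le_succ fun n => ?_
    rw [hs]; exact h3 _ _
  have hgF : ∀ k n, k + 1 ≤ n → g k ∈ (s n).1.2 := by
    intro k n hn
    refine hFmono hn ?_
    exact h4 k (s k)
  have hconst : ∀ k x y, x ∈ (s k).1.2 → ∀ n, k ≤ n →
      (s(x, y) ∈ (s n).1.1 ↔ s(x, y) ∈ (s k).1.1) := by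
    intro k x y hx n hn
    induction n, hn using Nat.le_induction with
    | base => rfl
    | succ n hn ih =>
      rw [← ih]
      have hnot : s(x, y) ∉ T n (s n) := fun h => h2 n (s n) x y h (hFmono hn hx)
      have := fun h => hnot ((h1 n (s n)).subset h)
      rw [← hs, Set.mem_symmDiff] at this
      tauto
  let E' : Set (Sym2 V) := {p | ∀ᶠ n in Filter.atTop, p ∈ (s n).1.1}
  have hE' : ∀ k x y, x ∈ (s k).1.2 → (s(x, y) ∈ E' ↔ s(x, y) ∈ (s k).1.1) := by
    intro k x y hx
    constructor
    · intro h
      obtain ⟨N, hN⟩ := Filter.eventually_atTop.1 h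
      exact (hconst k x y hx _ (le_max_right N k)).1 (hN _ (le_max_left _ _))
    · intro h
      exact Filter.eventually_atTop.2 ⟨k, fun n hn => (hconst k x y hx n hn).2 h⟩
  have hreach : Reach D E' (⋃ n, T n (s n)) := by
    refine Reach.seq (E := fun n => (s n).1.1) rfl ?_ ?_ ?_
    · intro p
      induction p with | h x y =>
      obtain ⟨k, rfl⟩ := hg x
      refine (Set.finite_le_nat k).subset ?_
      intro n hn
      by_contra hcon
      exact h2 n (s n) _ _ hn (hgF k n (by simp at hcon; omega))
    · intro n
      have := h1 n (s n)
      rwa [← hs] at this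
    · intro p
      induction p with | h x y =>
      obtain ⟨k, rfl⟩ := hg x
      have hk := hgF k (k + 1) le_rfl
      filter_upwards [Filter.eventually_ge_atTop (k + 1)] with n hn
      rw [hE' (k + 1) _ _ hk, hconst (k + 1) _ _ hk n hn]
  refine Reducible.of_reach hreach (Reducible.of_strongComponents fun v => ?_)
  obtain ⟨k, rfl⟩ := hg v
  -- The finite set obtained after treating `g k` is closed under out-arcs at that stage, and pairs
  -- meeting it never change again; so it is closed in the limit and contains the strong component.
  have hsub : strongComponent (toggle D E') (g k) ⊆ (s (k + 1)).1.2 := by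
    rintro w ⟨hw, -⟩
    induction hw with
    | refl => exact hgF k _ le_rfl
    | @tail a b _ hab ih =>
      refine (s (k + 1)).2.2.1 a ih b ?_
      have := hE' (k + 1) a b ih
      simp only [toggle] at hab ⊢
      rwa [this] at hab
  have : Finite (strongComponent (toggle D E') (g k)) :=
    ((s (k + 1)).2.1.subset hsub).to_subtype
  exact Reducible.of_finite ((hD.toggle _).restrict _)

end FiniteOut

/-! ### Thin countable tournaments: finite cuts -/

section Thin

variable {V : Type u}

/-- The arcs of `D` outside the set `E` of pairs. -/
def Avoid (D : Digraph V) (E : Set (Sym2 V)) (x y : V) : Prop :=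
  D.Adj x y ∧ s(x, y) ∉ E

/-- Any two vertices, equal or not, are separated by finitely many arcs. -/
def IsThin (D : Digraph V) : Prop :=
  ∀ a b, ∃ E : Set (Sym2 V), E.Finite ∧ ¬ Relation.TransGen (Avoid D E) a b

/-- A cut with finitely many leaving arcs, whose source side is locally in-finite and whose target
side is locally out-finite. -/
structure IsFiniteCut (D : Digraph V) (X : Set V) : Prop where
  finite_leaving : {p : V × V | p.1 ∈ X ∧ p.2 ∉ X ∧ D.Adj p.1 p.2}.Finite
  finite_out : ∀ y, {z | y ∉ X ∧ z ∉ X ∧ D.Adj y z}.Finite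
  finite_in : ∀ x, {z | x ∈ X ∧ z ∈ X ∧ D.Adj z x}.Finite

theorem finite_neighbors {E : Set (Sym2 V)} (hE : E.Finite) (v : V) : {z | s(v, z) ∈ E}.Finite := by
  refine hE.preimage (f := fun z => s(v, z)) ?_
  intro a _ b _ h
  exact Sym2.congr_right.1 h

theorem finite_ordered_pairs {E : Set (Sym2 V)} (hE : E.Finite) :
    {p : V × V | s(p.1, p.2) ∈ E}.Finite := by
  refine Set.Finite.preimage' hE fun p _ => ?_
  induction p with | h a b =>
  refine (Set.toFinite {(a, b), (b, a)}).subset ?_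
  rintro ⟨x, y⟩ h
  have h : s(x, y) = s(a, b) := h
  rcases Sym2.eq_iff.1 h with ⟨rfl, rfl⟩ | ⟨rfl, rfl⟩ <;> simp

/-- Two-arc paths from `u` to `w` through distinct `z` are arc-disjoint, so a finite separator meets
only finitely many of them. -/
theorem IsThin.finite_between {D : Digraph V} (h : IsThin D) (u w : V) :
    {z | D.Adj u z ∧ D.Adj z w}.Finite := by
  obtain ⟨E, hE, hn⟩ := h u w
  refine ((finite_neighbors hE u).union (finite_neighbors hE w)).subset ?_
  rintro z ⟨h1, h2⟩
  by_contra hcon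
  simp only [mem_union, mem_ofPred_eq, not_or] at hcon
  refine hn (Relation.TransGen.tail (Relation.TransGen.single ⟨h1, hcon.1⟩) ⟨h2, ?_⟩)
  rw [Sym2.eq_swap]; exact hcon.2

/-- `E` separates `v` from itself and `X` is what `v` reaches by nontrivial walks avoiding `E`; so
`v ∉ X`, and all arcs leaving `X` lie in `E`. An out-neighbour of `y` outside `X` is `v`, or lies
between `y` and `v`, or is reached from `v` by an arc of `E`. In-neighbours inside `X` are treated
symmetrically. -/
theorem IsThin.exists_isFiniteCut {D : Digraph V} (hD : IsTournament D) (h : IsThin D) :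
    ∃ X, IsFiniteCut D X := by
  rcases isEmpty_or_nonempty V with hV | ⟨⟨v⟩⟩
  · exact ⟨∅, Set.toFinite _, fun _ => Set.toFinite _, fun _ => Set.toFinite _⟩
  obtain ⟨E, hE, hn⟩ := h v v
  set X := {x | Relation.TransGen (Avoid D E) v x} with hX
  have hvX : v ∉ X := hn
  have hleave : ∀ x y, x ∈ X → y ∉ X → D.Adj x y → s(x, y) ∈ E := by
    intro x y hx hy hxy
    by_contra hE'
    exact hy (Relation.TransGen.tail hx ⟨hxy, hE'⟩)
  have h1 : {z | z ∉ X ∧ D.Adj v z}.Finite := by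
    refine (finite_neighbors hE v).subset ?_
    rintro z ⟨hz, hvz⟩
    by_contra hcon
    exact hz (Relation.TransGen.single ⟨hvz, hcon⟩)
  have h2 : {z | z ∈ X ∧ D.Adj z v}.Finite := by
    refine (finite_neighbors hE v).subset ?_
    rintro z ⟨hz, hzv⟩
    have := hleave z v hz hvX hzv
    rwa [Sym2.eq_swap] at this
  refine ⟨X, (finite_ordered_pairs hE).subset ?_, ?_, ?_⟩
  · rintro ⟨x, y⟩ ⟨hx, hy, hxy⟩
    exact hleave x y hx hy hxy
  · intro y
    refine ((h.finite_between y v).union (h1.insert v)).subset ?_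
    rintro z ⟨-, hz, hyz⟩
    by_cases hzv : z = v
    · exact Or.inr (Or.inl hzv)
    rcases hD.adj_or hzv with h' | h'
    · exact Or.inl ⟨hyz, h'⟩
    · exact Or.inr (Or.inr ⟨hz, h'⟩)
  · intro x
    refine ((h.finite_between v x).union (h2.insert v)).subset ?_
    rintro z ⟨-, hz, hzx⟩
    by_cases hzv : z = v
    · exact Or.inr (Or.inl hzv)
    rcases hD.adj_or hzv with h' | h'
    · exact Or.inr (Or.inr ⟨hz, h'⟩)
    · exact Or.inl ⟨h', hzx⟩

/-- All arcs across the cut enter `X`, so the two sides can be treated separately, the in-finite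
side via the opposite digraph. -/
theorem Reducible.of_cut_without_leaving [Countable V] {D : Digraph V} (hD : IsTournament D)
    {X : Set V} (h : IsFiniteCut D X) (h0 : ∀ x y, x ∈ X → y ∉ X → ¬ D.Adj x y) :
    Reducible D := by
  refine Reducible.of_fibers (ι := ULift.{u} Prop) (fun v => ⟨v ∈ X⟩)
    (fun a b => ¬ a.down ∧ b.down) (fun i hi => hi.1 hi.2) (fun i j k h1 h2 => ⟨h1.1, h2.2⟩) ?_ ?_
  · intro x y hxy
    by_cases hx : x ∈ X <;> by_cases hy : y ∈ X
    · left; simp [hx, hy]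
    · exact absurd hxy (h0 x y hx hy)
    · right; exact ⟨hx, hy⟩
    · left; simp [hx, hy]
  · rintro ⟨i⟩
    have hmem : ∀ v : {v | (⟨v ∈ X⟩ : ULift.{u} Prop) = ⟨i⟩}, (v : V) ∈ X ↔ i := fun v =>
      iff_of_eq (ULift.up_injective v.2)
    by_cases hi : i
    · have := Reducible.of_finite_out (D := CycleReversion.opposite (restrict D {v | (⟨v ∈ X⟩ : ULift.{u} Prop) = ⟨i⟩}))
        (hD.restrict _).opposite ?_
      · exact this.opposite
      · intro v
        refine ((h.finite_in v).preimage (f := Subtype.val) Subtype.val_injective.injOn).subset ?_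
        intro w hw
        exact ⟨(hmem v).2 hi, (hmem w).2 hi, hw⟩
    · refine Reducible.of_finite_out (hD.restrict _) ?_
      intro v
      refine ((h.finite_out v).preimage (f := Subtype.val) Subtype.val_injective.injOn).subset ?_
      intro w hw
      exact ⟨mt (hmem v).1 hi, mt (hmem w).1 hi, hw⟩

/-- `R` is what `y` reaches outside `X`, and `A` is what reaches `x` inside `X`. If `R` is finite it
is moved into `X`, if `A` is finite it is moved out; either way `xy` stops leaving and no new arc
leaves. If both are infinite, König's lemma yields a double ray through `xy`. As few arcs leave `X`,
almost all `ys n` dominate `xs n`, and the double ray can be reversed. -/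
theorem IsFiniteCut.exists_smaller {D : Digraph V} (hD : IsTournament D) {X : Set V}
    (h : IsFiniteCut D X) {x y : V} (hx : x ∈ X) (hy : y ∉ X) (hxy : D.Adj x y) :
    ∃ S T X', Reach D S T ∧ IsFiniteCut (toggle D S) X' ∧
      {p : V × V | p.1 ∈ X' ∧ p.2 ∉ X' ∧ (toggle D S).Adj p.1 p.2} ⊂
        {p : V × V | p.1 ∈ X ∧ p.2 ∉ X ∧ D.Adj p.1 p.2} := by
  set R := {z | Relation.ReflTransGen (fun a b => a ∉ X ∧ b ∉ X ∧ D.Adj a b) y z} with hR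
  set A := {z | Relation.ReflTransGen (fun a b => a ∈ X ∧ b ∈ X ∧ D.Adj b a) x z} with hA
  by_cases hRfin : R.Finite
  · have hRX : ∀ z ∈ R, z ∉ X := by
      intro z hz
      rcases Relation.ReflTransGen.cases_tail hz with h' | ⟨w, -, hw⟩
      · rwa [h']
      · exact hw.2.1
    have hleave : ∀ a b, a ∈ R → b ∉ X ∪ R → ¬ D.Adj a b := by
      intro a b ha hb hab
      rw [mem_union, not_or] at hb
      exact hb.2 (Relation.ReflTransGen.tail ha ⟨hRX a ha, hb.1, hab⟩)
    have hsub : {p : V × V | p.1 ∈ X ∪ R ∧ p.2 ∉ X ∪ R ∧ D.Adj p.1 p.2} ⊆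
        {p : V × V | p.1 ∈ X ∧ p.2 ∉ X ∧ D.Adj p.1 p.2} := by
      rintro ⟨a, b⟩ ⟨ha | ha, hb, hab⟩
      · exact ⟨ha, fun h => hb (Or.inl h), hab⟩
      · exact absurd hab (hleave a b ha hb)
    refine ⟨∅, ∅, X ∪ R, Reach.refl _ _, ?_, ?_⟩
    · rw [toggle_empty]
      refine ⟨h.finite_leaving.subset hsub, ?_, ?_⟩
      · intro z
        refine (h.finite_out z).subset ?_
        rintro w ⟨h1, h2, h3⟩
        exact ⟨fun h => h1 (Or.inl h), fun h => h2 (Or.inl h), h3⟩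
      · intro z
        have h1 : {w | w ∈ X ∧ z ∉ X ∧ D.Adj w z}.Finite :=
          h.finite_leaving.preimage (f := fun w => (w, z))
            (fun a _ b _ e => (Prod.ext_iff.1 e).1) |>.subset fun w hw => hw
        refine ((hRfin.union h1).union (h.finite_in z)).subset ?_
        rintro w ⟨hz, hw | hw, hwz⟩
        · by_cases hzX : z ∈ X
          · exact Or.inr ⟨hzX, hw, hwz⟩
          · exact Or.inl (Or.inr ⟨hw, hzX, hwz⟩)
        · exact Or.inl (Or.inl hw)
    · rw [toggle_empty, Set.ssubset_iff_of_subset hsub]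
      exact ⟨(x, y), ⟨hx, hy, hxy⟩, fun h => h.2.1 (Or.inr Relation.ReflTransGen.refl)⟩
  by_cases hAfin : A.Finite
  · have hAX : ∀ z ∈ A, z ∈ X := by
      intro z hz
      rcases Relation.ReflTransGen.cases_tail hz with h' | ⟨w, -, hw⟩
      · rwa [h']
      · exact hw.2.1
    have hleave : ∀ a b, a ∈ X \ A → b ∈ A → ¬ D.Adj a b := by
      intro a b ha hb hab
      exact ha.2 (Relation.ReflTransGen.tail hb ⟨hAX b hb, ha.1, hab⟩)
    have hsub : {p : V × V | p.1 ∈ X \ A ∧ p.2 ∉ X \ A ∧ D.Adj p.1 p.2} ⊆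
        {p : V × V | p.1 ∈ X ∧ p.2 ∉ X ∧ D.Adj p.1 p.2} := by
      rintro ⟨a, b⟩ ⟨ha, hb, hab⟩
      refine ⟨ha.1, fun hbX => hb ⟨hbX, fun hbA => hleave a b ha hbA hab⟩, hab⟩
    refine ⟨∅, ∅, X \ A, Reach.refl _ _, ?_, ?_⟩
    · rw [toggle_empty]
      refine ⟨h.finite_leaving.subset hsub, ?_, ?_⟩
      · intro z
        have h1 : {w | z ∈ X ∧ w ∉ X ∧ D.Adj z w}.Finite :=
          h.finite_leaving.preimage (f := fun w => (z, w))
            (fun a _ b _ e => (Prod.ext_iff.1 e).2) |>.subset fun w hw => hw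
        refine ((hAfin.union h1).union (h.finite_out z)).subset ?_
        rintro w ⟨hz, hw, hzw⟩
        by_cases hwA : w ∈ A
        · exact Or.inl (Or.inl hwA)
        have hwX : w ∉ X := fun h => hw ⟨h, hwA⟩
        by_cases hzX : z ∈ X
        · exact Or.inl (Or.inr ⟨hzX, hwX, hzw⟩)
        · exact Or.inr ⟨hzX, hwX, hzw⟩
      · intro z
        refine (h.finite_in z).subset ?_
        rintro w ⟨h1, h2, h3⟩
        exact ⟨h1.1, h2.1, h3⟩
    · rw [toggle_empty, Set.ssubset_iff_of_subset hsub]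
      exact ⟨(x, y), ⟨hx, hy, hxy⟩, fun h => h.1.2 Relation.ReflTransGen.refl⟩
  obtain ⟨ys, hy0, hys, hyray⟩ := exists_ray h.finite_out hRfin
  obtain ⟨xs, hx0, hxs, hxray⟩ := exists_ray h.finite_in hAfin
  have hxX : ∀ n, xs n ∈ X := fun n => (hxray n).1
  have hyX : ∀ n, ys n ∉ X := fun n => (hyray n).1
  have hne : ∀ m n, xs m ≠ ys n := fun m n e => hyX n (e ▸ hxX m)
  obtain ⟨N, hN⟩ : ∃ N, ∀ n, N ≤ n → D.Adj (ys n) (xs n) := by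
    have hfin : {n | D.Adj (xs n) (ys n)}.Finite := by
      refine (h.finite_leaving.preimage (f := fun n => (xs n, ys n))
        (fun a _ b _ e => hxs (Prod.ext_iff.1 e).1)).subset ?_
      intro n hn
      exact ⟨hxX n, hyX n, hn⟩
    obtain ⟨M, hM⟩ := hfin.bddAbove
    refine ⟨M + 1, fun n hn => ?_⟩
    rcases hD.adj_or (hne n n) with h' | h'
    · have := hM h'
      omega
    · exact h'
  obtain ⟨T, hT⟩ := Reach.of_doubleRay hD hxs hys hne (fun n => (hxray n).2.2)
    (fun n => (hyray n).2.2) (by rw [hx0, hy0]; exact hxy) hN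
  set S : Set (Sym2 V) := {p | p = s(xs 0, ys 0) ∨ (∃ n, p = s(xs n, xs (n + 1))) ∨
      ∃ n, p = s(ys n, ys (n + 1))} with hS
  -- One half of the double ray lies in `X` and the other outside, so `xy` is its only crossing arc.
  have hcross : ∀ a b, a ∈ X → b ∉ X → s(a, b) ∈ S → a = x ∧ b = y := by
    rintro a b ha hb (h' | ⟨n, h'⟩ | ⟨n, h'⟩)
    · rcases Sym2.eq_iff.1 h' with ⟨rfl, rfl⟩ | ⟨rfl, rfl⟩
      · exact ⟨hx0, hy0⟩
      · exact absurd ha (hyX 0)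
    · rcases Sym2.eq_iff.1 h' with ⟨rfl, rfl⟩ | ⟨rfl, rfl⟩ <;> exact absurd (hxX _) hb
    · rcases Sym2.eq_iff.1 h' with ⟨rfl, rfl⟩ | ⟨rfl, rfl⟩ <;> exact absurd ha (hyX _)
  have hfinS : ∀ a, {b | s(a, b) ∈ S}.Finite := by
    intro a
    have h1 : ∀ ys : ℕ → V, Function.Injective ys → {b | ∃ n, s(a, b) = s(ys n, ys (n + 1))}.Finite := by
      intro ys hys
      have h2 : {b | ∃ n, a = ys n ∧ b = ys (n + 1)}.Finite := by
        refine Set.Subsingleton.finite ?_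
        rintro b ⟨m, h1, rfl⟩ b' ⟨n, h2, rfl⟩
        rw [hys (h1.symm.trans h2)]
      have h3 : {b | ∃ n, a = ys (n + 1) ∧ b = ys n}.Finite := by
        refine Set.Subsingleton.finite ?_
        rintro b ⟨m, h1, rfl⟩ b' ⟨n, h2, rfl⟩
        rw [Nat.succ_injective (hys (h1.symm.trans h2))]
      refine (h2.union h3).subset ?_
      rintro b ⟨n, hn⟩
      rcases Sym2.eq_iff.1 hn with ⟨rfl, rfl⟩ | ⟨rfl, rfl⟩
      · exact Or.inl ⟨n, rfl, rfl⟩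
      · exact Or.inr ⟨n, rfl, rfl⟩
    refine (((finite_neighbors (Set.finite_singleton s(xs 0, ys 0)) a).union (h1 xs hxs)).union
      (h1 ys hys)).subset ?_
    rintro b (h' | h' | h')
    · exact Or.inl (Or.inl h')
    · exact Or.inl (Or.inr h')
    · exact Or.inr h'
  have hsub : {p : V × V | p.1 ∈ X ∧ p.2 ∉ X ∧ (toggle D S).Adj p.1 p.2} ⊂
        {p : V × V | p.1 ∈ X ∧ p.2 ∉ X ∧ D.Adj p.1 p.2} := by
    have hxyS : s(x, y) ∈ S := Or.inl (by rw [hx0, hy0])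
    rw [Set.ssubset_iff_of_subset]
    · refine ⟨(x, y), ⟨hx, hy, hxy⟩, fun h' => ?_⟩
      exact hD.asymm hxy ((toggle_adj_of_mem hxyS).1 h'.2.2)
    · rintro ⟨a, b⟩ ⟨ha, hb, hab⟩
      by_cases hp : s(a, b) ∈ S
      · obtain ⟨rfl, rfl⟩ := hcross a b ha hb hp
        exact ⟨hx, hy, hxy⟩
      · exact ⟨ha, hb, (toggle_adj_of_notMem hp).1 hab⟩
  refine ⟨S, T, X, hT, ⟨h.finite_leaving.subset hsub.subset, ?_, ?_⟩, hsub⟩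
  · intro z
    refine ((h.finite_out z).union (hfinS z)).subset ?_
    rintro w ⟨h1, h2, h3⟩
    by_cases hp : s(z, w) ∈ S
    · exact Or.inr hp
    · exact Or.inl ⟨h1, h2, (toggle_adj_of_notMem hp).1 h3⟩
  · intro z
    refine ((h.finite_in z).union (hfinS z)).subset ?_
    rintro w ⟨h1, h2, h3⟩
    by_cases hp : s(w, z) ∈ S
    · right; rw [Sym2.eq_swap] at hp; exact hp
    · exact Or.inl ⟨h1, h2, (toggle_adj_of_notMem hp).1 h3⟩

theorem Reducible.of_isFiniteCut [Countable V] {D : Digraph V} (hD : IsTournament D) {X : Set V}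
    (h : IsFiniteCut D X) : Reducible D := by
  induction hk : {p : V × V | p.1 ∈ X ∧ p.2 ∉ X ∧ D.Adj p.1 p.2}.ncard
    using Nat.strong_induction_on generalizing D X with | _ k ih =>
  by_cases h0 : ∀ x y, x ∈ X → y ∉ X → ¬ D.Adj x y
  · exact Reducible.of_cut_without_leaving hD h h0
  · push Not at h0
    obtain ⟨x, y, hx, hy, hxy⟩ := h0
    obtain ⟨S, T, X', h1, h2, h3⟩ := h.exists_smaller hD hx hy hxy
    refine Reducible.of_reach h1 (ih _ ?_ (hD.toggle S) h2 rfl)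
    rw [← hk]
    exact Set.ncard_lt_ncard h3 h.finite_leaving

theorem Reducible.of_isThin [Countable V] {D : Digraph V} (hD : IsTournament D) (h : IsThin D) :
    Reducible D := by
  obtain ⟨X, hX⟩ := h.exists_isFiniteCut hD
  exact Reducible.of_isFiniteCut hD hX

end Thin

/-! ### Reversing well-ordered families of single arcs -/

section Families

variable {V : Type u}

/-- Pairwise arc-disjoint paths, chosen by recursion along a well-founded relation. -/
theorem exists_disjoint_flows {D : Digraph V} {J : Type*} {r : J → J → Prop}
    (hwf : WellFounded r) (htri : ∀ j k, r j k ∨ j = k ∨ r k j) (u v : J → V)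
    (B : J → Set (Sym2 V))
    (h : ∀ j, ∀ G : J → Finset (V × V),
      Relation.TransGen (Avoid D (B j ∪ ⋃ k, ⋃ (_ : r k j), arcEdges (G k))) (u j) (v j)) :
    ∃ Q : J → Finset (V × V), (∀ j, ∀ a ∈ Q j, D.Adj a.1 a.2 ∧ s(a.1, a.2) ∉ B j) ∧
      (∀ j, flow (Q j) = Finsupp.single (u j) 1 - Finsupp.single (v j) 1) ∧
      ∀ p j k, p ∈ arcEdges (Q j) → p ∈ arcEdges (Q k) → j = k := by
  classical
  have h' := fun j G => exists_flow_of_reflTransGen (h j G).to_reflTransGen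
  choose P hP hPf using h'
  -- The path for `j` is chosen to avoid those of all predecessors; the value `∅` at other indices
  -- plays no role.
  let step : ∀ j, (∀ k, r k j → Finset (V × V)) → Finset (V × V) := fun j G =>
    P j fun k => if hk : r k j then G k hk else ∅
  let Q := hwf.fix step
  have hQ : ∀ j, Q j = P j fun k => if r k j then Q k else ∅ := fun j => hwf.fix_eq step j
  have hav : ∀ j, ∀ a ∈ Q j,
      Avoid D (B j ∪ ⋃ k, ⋃ (_ : r k j), arcEdges (if r k j then Q k else ∅)) a.1 a.2 := by
    intro j a ha
    rw [hQ] at ha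
    exact hP j _ a ha
  have hlt : ∀ p j k, r k j → p ∈ arcEdges (Q j) → p ∉ arcEdges (Q k) := by
    rintro p j k hkj ⟨a, ha, rfl⟩ hk
    refine (hav j a ha).2 (Or.inr ?_)
    simp only [mem_iUnion]
    exact ⟨k, hkj, by rwa [if_pos hkj]⟩
  refine ⟨Q, fun j a ha => ⟨(hav j a ha).1, fun hB => (hav j a ha).2 (Or.inl hB)⟩,
    fun j => ?_, fun p j k hj hk => ?_⟩
  · rw [hQ]
    exact hPf j _
  · rcases htri j k with hjk | hjk | hjk
    · exact absurd hj (hlt p k j hjk hk)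
    · exact hjk
    · exact absurd hk (hlt p j k hjk hj)

/-- A well-ordered family of arcs can be reversed if each of them closes a cycle with infinitely
many paths, all of these paths being arc-disjoint and avoiding the arcs reversed earlier. -/
theorem Reach.of_family {D : Digraph V} (hD : IsTournament D) {F : Type u} [LinearOrder F]
    [WellFoundedLT F] {u v : F → V} (hadj : ∀ f, D.Adj (v f) (u f))
    (hinj : ∀ f g, u f = u g → v f = v g → f = g)
    {r : F × ℕ → F × ℕ → Prop} (hwf : WellFounded r) (htri : ∀ j k, r j k ∨ j = k ∨ r k j)
    (h : ∀ j, ∀ G : F × ℕ → Finset (V × V),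
      Relation.TransGen (Avoid D ({p | ∃ g ≤ j.1, p = s(u g, v g)} ∪
        ⋃ k, ⋃ (_ : r k j), arcEdges (G k))) (u j.1) (v j.1)) :
    ∃ T, Reach D {p | ∃ f, p = s(u f, v f)} T := by
  classical
  obtain ⟨Q, hQ, hflow, hdisj⟩ := exists_disjoint_flows hwf htri (fun j => u j.1) (fun j => v j.1)
    (fun j => {p | ∃ g ≤ j.1, p = s(u g, v g)}) h
  have hinj' : ∀ f g, s(u f, v f) = s(u g, v g) → f = g := by
    intro f g e
    rcases Sym2.eq_iff.1 e with ⟨h1, h2⟩ | ⟨h1, h2⟩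
    · exact hinj f g h1 h2
    · exact absurd (hadj g) (by rw [← h1, ← h2]; exact hD.asymm (hadj f))
  let S : F → Set (Sym2 V) := fun f => {s(u f, v f)}
  -- The return paths of `f` are touched but finally restored. All chosen paths being disjoint, a
  -- pair lies on the path of at most one index, whence local finiteness even if it is also reversed
  -- as a member of the family.
  let T : F → Set (Sym2 V) := fun f => ⋃ n, arcEdges ({(v f, u f)} ∪ Q (f, n))
  have hS : ∀ A : Set F, oddSet S A = ⋃ f ∈ A, S f := fun A =>
    oddSet_of_subsingleton fun p w w' _ _ h1 h2 => hinj' w w' (h1.symm.trans h2)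
  have hmem1 : ∀ f p, p ∈ arcEdges ({(v f, u f)} : Finset (V × V)) ↔ p = s(u f, v f) := by
    intro f p
    simp [arcEdges, Sym2.eq_swap]
  have hfin : ∀ p, {f | p ∈ T f}.Finite := by
    intro p
    have h1 : {f | p = s(u f, v f)}.Subsingleton := fun f hf g hg =>
      hinj' f g (Eq.trans (Eq.symm hf) hg)
    have h2 : {f | ∃ n, p ∈ arcEdges (Q (f, n))}.Subsingleton := by
      rintro f ⟨n, hf⟩ g ⟨m, hg⟩
      exact (Prod.ext_iff.1 (hdisj p _ _ hf hg)).1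
    refine (h1.finite.union h2.finite).subset ?_
    intro f hf
    obtain ⟨n, hn⟩ := mem_iUnion.1 hf
    rw [arcEdges_union] at hn
    rcases hn with hn | hn
    · exact Or.inl ((hmem1 f p).1 hn)
    · exact Or.inr ⟨n, hn⟩
  refine ⟨⋃ f, T f, ?_⟩
  have key := Reach.comp (D := D) (S := S) (T := T) hfin ?_
  · rw [hS] at key
    convert key using 1
    ext p
    simp [S, eq_comm]
  intro f
  have hE : ∀ p, p ∈ oddSet S (Iio f) ↔ ∃ g < f, p = s(u g, v g) := by
    intro p
    simp [hS, S]
  have hself : (toggle D (oddSet S (Iio f))).Adj (v f) (u f) := by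
    rw [toggle_adj_of_notMem]
    · exact hadj f
    · rw [hE]
      rintro ⟨g, hg, e⟩
      rw [Sym2.eq_swap] at e
      exact hg.ne' (hinj' f g e)
  have hQ' : ∀ n, ∀ a ∈ Q (f, n), (toggle D (oddSet S (Iio f))).Adj a.1 a.2 := by
    intro n a ha
    rw [toggle_adj_of_notMem]
    · exact (hQ _ a ha).1
    · rw [hE]
      rintro ⟨g, hg, e⟩
      exact (hQ _ a ha).2 ⟨g, hg.le, e⟩
  -- Here `A` is constant: the single arc stays reversed while its return path is exchanged
  -- infinitely often.
  have := Reach.of_returns (hD.toggle (oddSet S (Iio f))) (A := fun _ => {(v f, u f)})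
    (Q := fun n => Q (f, n)) (fun _ _ _ => le_rfl) ?_ hQ' ?_ ?_ ?_
  · convert this using 1
    ext p
    simp [S, hmem1]
  · intro n a ha
    rw [Finset.mem_singleton.1 ha]
    exact hself
  · intro m n
    rw [Finset.disjoint_singleton_left]
    intro hm
    exact (hQ _ _ hm).2 ⟨f, le_rfl, Sym2.eq_swap⟩
  · intro m n hmn
    refine Finset.disjoint_left.2 fun a ha hb => hmn ?_
    exact (Prod.ext_iff.1 (hdisj s(a.1, a.2) _ _ ⟨a, ha, rfl⟩ ⟨a, hb, rfl⟩)).2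
  · intro n
    rw [hflow, flow_singleton]
    abel

end Families

/-! ### Arc-connectivity of pairs at a given cardinal -/

section Connected

variable {V : Type u} {D : Digraph V} {c : Cardinal.{u}} {a b d : V}

/-- Fewer than `c` arcs do not separate `a` from `b`. -/
def Connected (D : Digraph V) (c : Cardinal.{u}) (a b : V) : Prop :=
  ∀ E : Set (Sym2 V), Cardinal.mk E < c → Relation.TransGen (Avoid D E) a b

theorem Connected.mono {c' : Cardinal.{u}} (h : Connected D c a b) (hc : c' ≤ c) :
    Connected D c' a b :=
  fun E hE => h E (hE.trans_le hc)

theorem Connected.trans (h : Connected D c a b) (h' : Connected D c b d) : Connected D c a d :=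
  fun E hE => (h E hE).trans (h' E hE)

/-- Suppose `E₁` separates `a` from `d` and `E₂` separates `d` from `b`. If `x` is reachable from
`a` off `E₁` and reaches `b` off `E₂`, the pair `x, d` must lie in `E₁ ∪ E₂`, so there are fewer
than `c` such `x`. Also deleting the pairs joining `a` to them, and the pair `a, b`, leaves no first
step for a walk from `a` to `b`. -/
theorem Connected.adj_or (hD : IsTournament D) (hc : Cardinal.aleph0 ≤ c)
    (h : Connected D c a b) (d : V) : Connected D c a d ∨ Connected D c d b := by
  by_contra! hcon
  simp only [Connected, not_forall] at hcon
  obtain ⟨⟨E₁, h1, h1'⟩, E₂, h2, h2'⟩ := hcon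
  set Z := {x | Relation.TransGen (Avoid D E₁) a x ∧ Relation.TransGen (Avoid D E₂) x b} with hZ
  have hsub : (fun x => s(x, d)) '' Z ⊆ E₁ ∪ E₂ := by
    rintro _ ⟨x, ⟨hx1, hx2⟩, rfl⟩
    by_contra hx
    simp only [mem_union, not_or] at hx
    have hne : x ≠ d := fun e => h1' (e ▸ hx1)
    rcases hD.adj_or hne with hxd | hxd
    · exact h1' (hx1.tail ⟨hxd, hx.1⟩)
    · exact h2' (hx2.head ⟨hxd, by rw [Sym2.eq_swap]; exact hx.2⟩)
  have h12 : Cardinal.mk ↥(E₁ ∪ E₂) < c :=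
    (Cardinal.mk_union_le _ _).trans_lt (Cardinal.add_lt_of_lt hc h1 h2)
  have hZc : Cardinal.mk Z < c := by
    have hinj : Function.Injective fun x => s(x, d) := fun x y h => Sym2.congr_left.1 h
    rw [← Cardinal.mk_image_eq (s := Z) hinj]
    exact (Cardinal.mk_le_mk_of_subset hsub).trans_lt h12
  have hE : Cardinal.mk ↥((E₁ ∪ E₂) ∪ (((fun x => s(a, x)) '' Z) ∪ {s(a, b)})) < c := by
    refine (Cardinal.mk_union_le _ _).trans_lt (Cardinal.add_lt_of_lt hc h12 ?_)
    refine (Cardinal.mk_union_le _ _).trans_lt (Cardinal.add_lt_of_lt hc ?_ ?_)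
    · exact Cardinal.mk_image_le.trans_lt hZc
    · rw [Cardinal.mk_singleton]
      exact Cardinal.one_lt_aleph0.trans_le hc
  obtain ⟨x, hax, hxb⟩ := Relation.TransGen.head'_iff.1 (h _ hE)
  simp only [Avoid, mem_union, not_or] at hax
  rcases Relation.reflTransGen_iff_eq_or_transGen.1 hxb with rfl | hxb
  · exact hax.2.2.2 rfl
  · refine hax.2.2.1 ⟨x, ⟨Relation.TransGen.single ⟨hax.1, hax.2.1.1⟩, ?_⟩, rfl⟩
    refine hxb.lift id fun y z hyz => ⟨hyz.1, fun hyz' => hyz.2 (Or.inl (Or.inr hyz'))⟩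

end Connected

/-! ### Propagating connectivity along walks with detours -/

section Walks

variable {V : Type u} {A C : V → V → Prop} {M : Set V}

/-- A relation `C` that is interval-like, compatible with the arcs of `A` inside `M`, and holds
along the detours of `A` outside `M` is preserved by moving its target along `A`. -/
theorem rel_of_reflTransGen_right (htr : ∀ a b d, C a b → C b d → C a d)
    (hint : ∀ a b d, C a b → C a d ∨ C d b)
    (hadj : ∀ a b, a ∈ M → b ∈ M → A a b → C b a → C a b)
    (hexc : ∀ a b, a ∈ M → b ∈ M →
      Relation.TransGen (fun x y => A x y ∧ ¬ (x ∈ M ∧ y ∈ M)) a b → C a b)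
    {a b d : V} (hb : b ∈ M) (hd : d ∈ M) (h : C a b)
    (hbd : Relation.ReflTransGen A b d) : C a d := by
  have hlast : ∀ x z, z ∈ M → x ∈ M → C a z →
      Relation.ReflTransGen (fun x y => A x y ∧ ¬ (x ∈ M ∧ y ∈ M)) z x → C a x := by
    intro x z hz hx haz hzx
    rcases Relation.reflTransGen_iff_eq_or_transGen.1 hzx with rfl | hzx
    · exact haz
    · exact htr _ _ _ haz (hexc z x hz hx hzx)
  have hinv : ∀ x, Relation.ReflTransGen A b x → ∃ z ∈ M, C a z ∧
      Relation.ReflTransGen (fun x y => A x y ∧ ¬ (x ∈ M ∧ y ∈ M)) z x := by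
    intro x hx
    induction hx with
    | refl => exact ⟨b, hb, h, Relation.ReflTransGen.refl⟩
    | @tail x y _ hxy ih =>
      obtain ⟨z, hz, haz, hzx⟩ := ih
      by_cases hM : x ∈ M ∧ y ∈ M
      · have hax := hlast x z hz hM.1 haz hzx
        refine ⟨y, hM.2, ?_, Relation.ReflTransGen.refl⟩
        rcases hint a x y hax with h1 | h1
        · exact h1
        · exact htr _ _ _ hax (hadj x y hM.1 hM.2 hxy h1)
      · exact ⟨z, hz, haz, hzx.tail ⟨hxy, hM⟩⟩
  obtain ⟨z, hz, haz, hzd⟩ := hinv d hbd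
  exact hlast d z hz hd haz hzd

theorem rel_of_reflTransGen_left (htr : ∀ a b d, C a b → C b d → C a d)
    (hint : ∀ a b d, C a b → C a d ∨ C d b)
    (hadj : ∀ a b, a ∈ M → b ∈ M → A a b → C b a → C a b)
    (hexc : ∀ a b, a ∈ M → b ∈ M →
      Relation.TransGen (fun x y => A x y ∧ ¬ (x ∈ M ∧ y ∈ M)) a b → C a b)
    {a b d : V} (ha : a ∈ M) (hd : d ∈ M) (h : C a b)
    (hda : Relation.ReflTransGen A d a) : C d b := by
  refine rel_of_reflTransGen_right (A := fun x y => A y x) (C := fun x y => C y x) (M := M)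
    (fun a b d h1 h2 => htr _ _ _ h2 h1) (fun a b d h => (hint _ _ d h).symm)
    (fun a b ha hb h1 h2 => hadj b a hb ha h1 h2) ?_ ha hd h hda.swap
  intro a b ha hb hab
  exact hexc b a hb ha (hab.swap.lift id fun x y h => ⟨h.1, fun h' => h.2 h'.symm⟩)

theorem exists_last_mem {a w : V} (ha : a ∈ M) (h : Relation.ReflTransGen A a w) :
    ∃ b ∈ M, Relation.ReflTransGen A a b ∧
      Relation.ReflTransGen (fun x y => A x y ∧ ¬ (x ∈ M ∧ y ∈ M)) b w := by
  induction h with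
  | refl => exact ⟨a, ha, .refl, .refl⟩
  | @tail x y hax hxy ih =>
    obtain ⟨b, hb, hab, hbx⟩ := ih
    by_cases hM : x ∈ M ∧ y ∈ M
    · exact ⟨y, hM.2, hax.tail hxy, .refl⟩
    · exact ⟨b, hb, hab, hbx.tail ⟨hxy, hM⟩⟩

theorem exists_first_mem {a w : V} (ha : a ∈ M) (h : Relation.ReflTransGen A w a) :
    ∃ b ∈ M, Relation.ReflTransGen A b a ∧
      Relation.ReflTransGen (fun x y => A x y ∧ ¬ (x ∈ M ∧ y ∈ M)) w b := by
  obtain ⟨b, hb, hab, hbw⟩ := exists_last_mem (A := fun x y => A y x) ha h.swap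
  exact ⟨b, hb, hab.swap, hbw.swap.lift id fun x y h => ⟨h.1, fun h' => h.2 h'.symm⟩⟩

end Walks

/-! ### A linear order from connectivity, and the arcs against it -/

section BackArcs

variable {V : Type u}

/-- The strict parts of the nested transitive relations `C i` have a transitive union: two strict
relations can be composed at the smaller of their indices, where both relations hold. The resulting
partial order is extended to a linear one. -/
theorem exists_strictOrder {I : Type*} [LinearOrder I] {C : I → V → V → Prop}
    (hanti : ∀ i j a b, i ≤ j → C j a b → C i a b)
    (htr : ∀ i a b d, C i a b → C i b d → C i a d) :
    ∃ p : V → V → Prop, (∀ a, ¬ p a a) ∧ (∀ a b d, p a b → p b d → p a d) ∧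
      (∀ a b, a ≠ b → p a b ∨ p b a) ∧ ∀ i a b, C i a b → ¬ C i b a → p a b := by
  let r : V → V → Prop := fun a b => ∃ i, C i a b ∧ ¬ C i b a
  have hr : ∀ a b d, r a b → r b d → r a d := by
    rintro a b d ⟨i, h1, h2⟩ ⟨j, h3, h4⟩
    rcases le_total i j with hij | hij
    · have h3' := hanti i j _ _ hij h3
      exact ⟨i, htr _ _ _ _ h1 h3', fun h => h2 (htr _ _ _ _ h3' h)⟩
    · have h1' := hanti j i _ _ hij h1
      exact ⟨j, htr _ _ _ _ h1' h3, fun h => h4 (htr _ _ _ _ h h1')⟩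
  have hirr : ∀ a, ¬ r a a := fun a ⟨i, h1, h2⟩ => h2 h1
  have hpo : IsPartialOrder V fun a b => a = b ∨ r a b :=
    { refl := fun a => Or.inl rfl
      trans := by
        rintro a b d (rfl | h1) (rfl | h2)
        · exact Or.inl rfl
        · exact Or.inr h2
        · exact Or.inr h1
        · exact Or.inr (hr _ _ _ h1 h2)
      antisymm := by
        rintro a b (rfl | h1) (h | h2)
        · rfl
        · rfl
        · exact h.symm
        · exact absurd (hr _ _ _ h1 h2) (hirr a) }
  obtain ⟨s, hs, hrs⟩ := extend_partialOrder fun a b => a = b ∨ r a b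
  refine ⟨fun a b => s a b ∧ a ≠ b, fun a h => h.2 rfl, ?_, ?_, ?_⟩
  · rintro a b d ⟨h1, h1'⟩ ⟨h2, h2'⟩
    refine ⟨_root_.trans h1 h2, ?_⟩
    rintro rfl
    exact h1' (antisymm h1 h2)
  · intro a b hab
    rcases total_of s a b with h | h
    · exact Or.inl ⟨h, hab⟩
    · exact Or.inr ⟨h, hab.symm⟩
  · intro i a b h1 h2
    refine ⟨hrs _ _ (Or.inr ⟨i, h1, h2⟩), ?_⟩
    rintro rfl
    exact h2 h1

/-- The pairs `(a, b)` related by `p` and `L` whose arc runs against `p`. -/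
def backArcs (D : Digraph V) (p L : V → V → Prop) : Set (V × V) :=
  {q | D.Adj q.2 q.1 ∧ p q.1 q.2 ∧ L q.1 q.2}

/-- The edges underlying `backArcs`. -/
def backEdges (D : Digraph V) (p L : V → V → Prop) : Set (Sym2 V) :=
  {e | ∃ f : backArcs D p L, e = s(f.1.1, f.1.2)}

theorem toggle_backEdges_adj {D : Digraph V} {p L : V → V → Prop} {a b : V}
    (hD : IsTournament D) (h : (toggle D (backEdges D p L)).Adj a b) :
    (p a b ∧ L a b) ∨ (D.Adj a b ∧ (p b a → ¬ L b a)) := by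
  by_cases hm : s(a, b) ∈ backEdges D p L
  · rw [toggle_adj_of_mem hm] at h
    obtain ⟨⟨⟨x, y⟩, h1, h2⟩, e⟩ := hm
    rcases Sym2.eq_iff.1 e with ⟨rfl, rfl⟩ | ⟨rfl, rfl⟩
    · exact Or.inl h2
    · exact absurd h (hD.asymm h1)
  · rw [toggle_adj_of_notMem hm] at h
    exact Or.inr ⟨h, fun h1 h2 => hm ⟨⟨(b, a), h, h1, h2⟩, Sym2.eq_swap⟩⟩

theorem Reach.backEdges {D : Digraph V} (hD : IsTournament D) {p L : V → V → Prop}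
    [LinearOrder (backArcs D p L)] [WellFoundedLT (backArcs D p L)]
    {r : backArcs D p L × ℕ → backArcs D p L × ℕ → Prop}
    (hwf : WellFounded r) (htri : ∀ j k, r j k ∨ j = k ∨ r k j)
    (h : ∀ j, ∀ G : backArcs D p L × ℕ → Finset (V × V),
      Relation.TransGen (Avoid D ({e | ∃ g ≤ j.1, e = s(g.1.1, g.1.2)} ∪
        ⋃ k, ⋃ (_ : r k j), arcEdges (G k))) j.1.1.1 j.1.1.2) :
    ∃ T, Reach D (CycleReversion.backEdges D p L) T :=
  Reach.of_family (F := backArcs D p L) (u := fun f => f.1.1) (v := fun f => f.1.2) hD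
    (fun f => f.2.1) (fun _ _ h1 h2 => Subtype.ext (Prod.ext h1 h2)) hwf htri h

theorem Reducible.of_adj_imp {D : Digraph V} {r : V → V → Prop} (hirr : ∀ x, ¬ r x x)
    (htr : ∀ x y z, r x y → r y z → r x z) (h : ∀ x y, D.Adj x y → r x y) : Reducible D := by
  refine ⟨∅, ∅, Reach.refl _ _, univ, ?_⟩
  rw [toggle_empty]
  exact ⟨isAcyclicSet_of_adj_imp hirr htr fun x _ y _ hxy => h x y hxy,
    isAcyclicSet_of_adj_imp hirr htr fun x _ y _ hxy => h x y hxy⟩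

end BackArcs

/-! ### Countable tournaments -/

section Countable

variable {V : Type u}

theorem Connected.of_finite {D : Digraph V} {c : Cardinal.{u}} {a b : V} (h : Connected D c a b)
    (hc : Cardinal.aleph0 ≤ c) {E : Set (Sym2 V)} (hE : E.Finite) :
    Relation.TransGen (Avoid D E) a b :=
  h E ((Cardinal.lt_aleph0_iff_set_finite.2 hE).trans_le hc)

/-- Back arcs and return paths are enumerated separately in type `ω`, so each path has only finitely
many pairs to avoid; the lexicographic order on paths would leave infinitely many. -/
theorem exists_reach_backEdges_of_countable [Countable V] {D : Digraph V} (hD : IsTournament D)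
    (p : V → V → Prop) :
    ∃ T, Reach D (backEdges D p (Connected D Cardinal.aleph0)) T := by
  obtain ⟨e, he⟩ := exists_injective_nat (backArcs D p (Connected D Cardinal.aleph0))
  obtain ⟨e', he'⟩ := exists_injective_nat (backArcs D p (Connected D Cardinal.aleph0) × ℕ)
  let i1 : LinearOrder (backArcs D p (Connected D Cardinal.aleph0)) := LinearOrder.lift' e he
  have i2 : WellFoundedLT (backArcs D p (Connected D Cardinal.aleph0)) :=
    ⟨InvImage.wf e (wellFounded_lt (α := ℕ))⟩
  refine Reach.backEdges hD (r := InvImage (· < ·) e') (InvImage.wf e' wellFounded_lt) ?_ ?_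
  · intro j k
    rcases lt_trichotomy (e' j) (e' k) with h | h | h
    · exact Or.inl h
    · exact Or.inr (Or.inl (he' h))
    · exact Or.inr (Or.inr h)
  · intro j G
    refine Connected.of_finite j.1.2.2.2 le_rfl (Set.Finite.union ?_ ?_)
    · have h1 : {g | e g ≤ e j.1}.Finite := (Set.finite_Iic (e j.1)).preimage he.injOn
      refine (h1.image fun g => s(g.1.1, g.1.2)).subset ?_
      rintro _ ⟨g, hg, rfl⟩
      exact ⟨g, hg, rfl⟩
    · have h1 : {k | e' k < e' j}.Finite := (Set.finite_Iio (e' j)).preimage he'.injOn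
      exact h1.biUnion fun k _ => finite_arcEdges _

/-- After the reversal a strong component containing one infinitely connected pair consists of such
pairs only and follows `p`. Otherwise all its arcs are arcs of `D` and finite separators in `D` show
that it is thin. -/
theorem Reducible.of_countable [Countable V] {D : Digraph V} (hD : IsTournament D) :
    Reducible D := by
  obtain ⟨p, hirr, htr, htot, hp⟩ := exists_strictOrder (I := Unit)
    (C := fun _ => Connected D Cardinal.aleph0) (fun _ _ _ _ _ h => h)
    (fun _ _ _ _ h h' => h.trans h')
  obtain ⟨T, hT⟩ := exists_reach_backEdges_of_countable hD p
  set D' := toggle D (backEdges D p (Connected D Cardinal.aleph0)) with hD'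
  have hD'T : IsTournament D' := hD.toggle _
  refine Reducible.of_reach hT (Reducible.of_strongComponents fun v => ?_)
  have hadj : ∀ a b, D'.Adj a b → Connected D Cardinal.aleph0 b a →
      Connected D Cardinal.aleph0 a b := by
    intro a b hab hba
    rcases toggle_backEdges_adj hD hab with h | h
    · exact h.2
    · by_contra hcon
      exact h.2 (hp () _ _ hba hcon) hba
  set K := strongComponent D' v with hK
  have hreach : ∀ a ∈ K, ∀ b ∈ K, Relation.ReflTransGen D'.Adj a b :=
    fun a ha b hb => ha.2.trans hb.1
  by_cases hcase : ∃ a ∈ K, ∃ b ∈ K, Connected D Cardinal.aleph0 a b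
  · obtain ⟨a, ha, b, hb, hab⟩ := hcase
    -- With `M` the whole vertex set there are no detours.
    have hexc : ∀ x y, x ∈ (univ : Set V) → y ∈ (univ : Set V) → Relation.TransGen
        (fun x y => D'.Adj x y ∧ ¬ (x ∈ (univ : Set V) ∧ y ∈ (univ : Set V))) x y →
        Connected D Cardinal.aleph0 x y := by
      intro x y _ _ hxy
      obtain ⟨z, hz, -⟩ := Relation.TransGen.head'_iff.1 hxy
      exact absurd ⟨mem_univ _, mem_univ _⟩ hz.2
    have hint := fun (x y z : V) (h : Connected D Cardinal.aleph0 x y) => h.adj_or hD le_rfl z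
    have hall : ∀ x ∈ K, ∀ y ∈ K, Connected D Cardinal.aleph0 x y := by
      intro x hx y hy
      have h1 := rel_of_reflTransGen_right (fun _ _ _ => Connected.trans) hint
        (fun a b _ _ => hadj a b) hexc (mem_univ b) (mem_univ y) hab (hreach b hb y hy)
      exact rel_of_reflTransGen_left (fun _ _ _ => Connected.trans) hint
        (fun a b _ _ => hadj a b) hexc (mem_univ a) (mem_univ x) h1 (hreach x hx a ha)
    refine Reducible.of_adj_imp (r := fun x y : K => p x y) (fun x => hirr x)
      (fun x y z => htr x y z) ?_
    rintro ⟨x, hx⟩ ⟨y, hy⟩ hxy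
    rcases toggle_backEdges_adj hD hxy with h | h
    · exact h.1
    · refine (htot x y (hD.ne h.1)).resolve_right fun h' => h.2 h' (hall y hy x hx)
  · refine Reducible.of_isThin (hD'T.restrict K) fun a b => ?_
    have hab : ¬ Connected D Cardinal.aleph0 (a : V) b :=
      fun h => hcase ⟨a, a.2, b, b.2, h⟩
    simp only [Connected, not_forall] at hab
    obtain ⟨E, hE, hn⟩ := hab
    refine ⟨Sym2.map Subtype.val ⁻¹' E, (Cardinal.lt_aleph0_iff_set_finite.1 hE).preimage
      (Sym2.map.injective Subtype.val_injective).injOn, fun h => hn ?_⟩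
    refine h.lift Subtype.val ?_
    rintro ⟨x, hx⟩ ⟨y, hy⟩ ⟨hxy, hxyE⟩
    rcases toggle_backEdges_adj hD hxy with h | h
    · exact absurd ⟨x, hx, y, hy, h.2⟩ hcase
    · exact ⟨h.1, hxyE⟩

end Countable

/-! ### Filtration of an uncountable vertex set -/

section Hierarchy

variable {V : Type u}

theorem mk_iUnion_le_of_forall_le {ι : Type u} {μ : Cardinal.{u}} (hμ : Cardinal.aleph0 ≤ μ)
    (hι : Cardinal.mk ι ≤ μ) {f : ι → Set V} (hf : ∀ i, Cardinal.mk (f i) ≤ μ) :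
    Cardinal.mk ↥(⋃ i, f i) ≤ μ := by
  refine (Cardinal.mk_iUnion_le_sum_mk).trans ((Cardinal.sum_le_sum _ _ hf).trans ?_)
  rw [Cardinal.sum_const']
  exact (mul_le_mul_left hι μ).trans (Cardinal.mul_eq_self hμ).le

/-- The closure of `B` under the set-valued binary operation `f`. -/
inductive Hull (B : Set V) (f : V → V → Set V) : V → Prop
  | base {x : V} (h : x ∈ B) : Hull B f x
  | step {a b x : V} (ha : Hull B f a) (hb : Hull B f b) (h : x ∈ f a b) : Hull B f x

theorem Hull.mono {B B' : Set V} {f f' : V → V → Set V} (hB : B ⊆ B')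
    (hf : ∀ a b, f a b ⊆ f' a b) {x : V} (h : Hull B f x) : Hull B' f' x := by
  induction h with
  | base h => exact .base (hB h)
  | step _ _ h iha ihb => exact .step iha ihb (hf _ _ h)

theorem mk_hull_le {μ : Cardinal.{u}} (hμ : Cardinal.aleph0 ≤ μ) {B : Set V}
    {f : V → V → Set V} (hB : Cardinal.mk B ≤ μ) (hf : ∀ a b, Cardinal.mk (f a b) ≤ μ) :
    Cardinal.mk {x | Hull B f x} ≤ μ := by
  let N : ℕ → Set V := fun n =>
    n.rec B fun _ S => S ∪ ⋃ q : S × S, f q.1 q.2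
  have hN : ∀ n, Cardinal.mk ↥(N n) ≤ μ := by
    intro n
    induction n with
    | zero => exact hB
    | succ n ih =>
      refine (Cardinal.mk_union_le _ _).trans (Cardinal.add_le_of_le hμ ih ?_)
      refine mk_iUnion_le_of_forall_le hμ ?_ fun q => hf _ _
      rw [Cardinal.mk_prod, Cardinal.lift_id]
      exact (mul_le_mul' ih ih).trans (Cardinal.mul_eq_self hμ).le
  have hmono : Monotone N := monotone_nat_of_le_succ fun n => subset_union_left
  have hsub : {x | Hull B f x} ⊆ ⋃ n : ULift.{u} ℕ, N n.down := by
    intro x hx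
    simp only [mem_iUnion, ULift.exists]
    induction hx with
    | base h => exact ⟨0, h⟩
    | @step a b x _ _ h iha ihb =>
      obtain ⟨m, hm⟩ := iha
      obtain ⟨n, hn⟩ := ihb
      refine ⟨max m n + 1, Or.inr (mem_iUnion.2 ⟨⟨⟨a, ?_⟩, ⟨b, ?_⟩⟩, h⟩)⟩
      · exact hmono (le_max_left m n) hm
      · exact hmono (le_max_right m n) hn
  refine (Cardinal.mk_le_mk_of_subset hsub).trans (mk_iUnion_le_of_forall_le hμ ?_ fun n => hN _)
  rw [Cardinal.mk_uLift, Cardinal.mk_nat, Cardinal.lift_aleph0]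
  exact hμ

theorem mk_vertices_le {μ : Cardinal.{u}} (hμ : Cardinal.aleph0 ≤ μ) {E : Set (Sym2 V)}
    (hE : Cardinal.mk E ≤ μ) : Cardinal.mk {x | ∃ e ∈ E, x ∈ e} ≤ μ := by
  have : {x | ∃ e ∈ E, x ∈ e} = ⋃ e : E, {x | x ∈ e.1} := by
    ext x
    simp
  rw [this]
  refine mk_iUnion_le_of_forall_le hμ hE fun e => ?_
  have hfin : {x | x ∈ e.1}.Finite := by
    obtain ⟨e, -⟩ := e
    induction e with | h a b =>
    refine (Set.toFinite {a, b}).subset fun x hx => ?_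
    simpa using hx
  exact (Cardinal.lt_aleph0_iff_set_finite.2 hfin).le.trans hμ

/-- An uncountable vertex set is filtered by sets of smaller cardinality that contain small
separators for those pairs of their vertices that have one. -/
theorem exists_rank (D : Digraph V) (hV : Cardinal.aleph0 < Cardinal.mk V) :
    ∃ (I : Type u) (_ : LinearOrder I) (_ : WellFoundedLT I) (μ : I → Cardinal.{u})
      (rank : V → I), Monotone μ ∧ (∀ i, Cardinal.aleph0 ≤ μ i) ∧ (∀ i, μ i < Cardinal.mk V) ∧
      (∀ i, Cardinal.mk {x | rank x ≤ i} ≤ μ i) ∧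
      ∀ i a b, rank a ≤ i → rank b ≤ i → ¬ Connected D (Order.succ (μ i)) a b →
        ∃ E : Set (Sym2 V), Cardinal.mk E ≤ μ i ∧
          (∀ x y, s(x, y) ∈ E → rank x ≤ i ∧ rank y ≤ i) ∧
          ¬ Relation.TransGen (Avoid D E) a b := by
  classical
  -- In the initial well-order of type `|V|` every proper initial segment has smaller cardinality,
  -- which gives `μ i < |V|`.
  let I := (Cardinal.mk V).ord.ToType
  obtain ⟨e⟩ : Nonempty (V ≃ I) := Cardinal.eq.1 (Cardinal.mk_ord_toType _).symm
  let μ : I → Cardinal.{u} := fun i => max Cardinal.aleph0 (Cardinal.mk (Iic i))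
  have hμ0 : ∀ i, Cardinal.aleph0 ≤ μ i := fun i => le_max_left _ _
  have hμV : ∀ i, μ i < Cardinal.mk V := by
    intro i
    refine max_lt hV ?_
    rw [← Iio_insert]
    refine Cardinal.mk_insert_le.trans_lt (Cardinal.add_lt_of_lt hV.le ?_ ?_)
    · exact (Cardinal.mk_Iio_lt i (by simp [I])).trans_eq (Cardinal.mk_ord_toType _)
    · exact Cardinal.one_lt_aleph0.trans hV
  have hμm : Monotone μ := fun i j hij =>
    max_le_max le_rfl (Cardinal.mk_le_mk_of_subset (Iic_subset_Iic.2 hij))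
  have hsep : ∀ (i : I) (a b : V), ∃ E : Set (Sym2 V), Cardinal.mk E ≤ μ i ∧
      (¬ Connected D (Order.succ (μ i)) a b → ¬ Relation.TransGen (Avoid D E) a b) := by
    intro i a b
    by_cases h : Connected D (Order.succ (μ i)) a b
    · exact ⟨∅, by simp, fun h' => absurd h h'⟩
    · have h' := h
      simp only [Connected, not_forall] at h'
      obtain ⟨E, hE, hn⟩ := h'
      exact ⟨E, Order.lt_succ_iff.1 hE, fun _ => hn⟩
  choose E hEc hEs using hsep
  -- Endpoints of the separators for all levels `k ≤ i`, not just `i`, are adjoined; this makes the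
  -- hulls `M i` increasing.
  let f : I → V → V → Set V := fun i a b => ⋃ k : Iic i, {x | ∃ e ∈ E k a b, x ∈ e}
  let M : I → Set V := fun i => {x | Hull {y | e y ≤ i} (f i) x}
  have hMm : Monotone M := by
    intro i j hij x hx
    refine Hull.mono (fun y hy => le_trans hy hij) (fun a b y hy => ?_) hx
    obtain ⟨k, hk⟩ := mem_iUnion.1 hy
    exact mem_iUnion.2 ⟨⟨k.1, k.2.trans hij⟩, hk⟩
  have hMc : ∀ i, Cardinal.mk (M i) ≤ μ i := by
    intro i
    refine mk_hull_le (hμ0 i) ?_ fun a b => ?_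
    · have : {y | e y ≤ i} = e ⁻¹' (Iic i) := rfl
      rw [this, Cardinal.mk_preimage_equiv]
      exact le_max_right _ _
    · refine mk_iUnion_le_of_forall_le (hμ0 i) (le_max_right _ _) fun k => ?_
      exact mk_vertices_le (hμ0 i) ((hEc k a b).trans (hμm k.2))
  have hne : ∀ x, {i | x ∈ M i}.Nonempty := fun x => ⟨e x, .base (le_refl (e x))⟩
  let rank : V → I := fun x => wellFounded_lt.min {i | x ∈ M i} (hne x)
  have hrank : ∀ x i, rank x ≤ i ↔ x ∈ M i := by
    intro x i
    refine ⟨fun h => hMm h (wellFounded_lt.min_mem {i | x ∈ M i} (hne x)), fun h => ?_⟩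
    exact not_lt.1 (wellFounded_lt.not_lt_min {i | x ∈ M i} h)
  refine ⟨I, inferInstance, inferInstance, μ, rank, hμm, hμ0, hμV, ?_, ?_⟩
  · intro i
    simp only [hrank]
    exact hMc i
  · intro i a b ha hb hab
    rw [hrank] at ha hb
    refine ⟨E i a b, hEc i a b, fun x y hxy => ?_, hEs i a b hab⟩
    simp only [hrank]
    have hmem : ∀ z, z ∈ s(x, y) → z ∈ M i := fun z hz =>
      Hull.step ha hb (mem_iUnion.2 ⟨⟨i, le_refl i⟩, ⟨_, hxy, hz⟩⟩)
    exact ⟨hmem x (Sym2.mem_mk_left _ _), hmem y (Sym2.mem_mk_right _ _)⟩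

end Hierarchy

/-! ### Uncountable tournaments and the general theorem -/

section Uncountable

variable {V : Type u}

/-- The connectivity demanded of a pair of vertices grows with their ranks. -/
def LevelConnected {I : Type u} [LinearOrder I] (D : Digraph V) (μ : I → Cardinal.{u})
    (rank : V → I) (a b : V) : Prop :=
  Connected D (Order.succ (μ (max (rank a) (rank b)))) a b

theorem exists_reach_backEdges_of_rank {D : Digraph V} (hD : IsTournament D) (p : V → V → Prop)
    {I : Type u} [LinearOrder I] [WellFoundedLT I] {μ : I → Cardinal.{u}} {rank : V → I}
    (hμ : ∀ i, Cardinal.aleph0 ≤ μ i) (hrank : ∀ i, Cardinal.mk {x | rank x ≤ i} ≤ μ i) :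
    ∃ T, Reach D (backEdges D p (LevelConnected D μ rank)) T := by
  obtain ⟨W, _, _, ⟨e⟩⟩ : ∃ (W : Type u) (_ : LinearOrder W) (_ : WellFoundedLT W),
      Nonempty (V ≃ W) := by
    obtain ⟨i1, i2⟩ := exists_wellFoundedLT V
    exact ⟨V, i1, i2, ⟨Equiv.refl V⟩⟩
  set F := backArcs D p (LevelConnected D μ rank) with hF
  -- Back arcs are ordered by level first, ties being broken arbitrarily. Hence at most `μ i` of
  -- them precede or equal one of level `i`, and together with their countably many finite paths
  -- they occupy at most `μ i` pairs, too few to separate its ends.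
  let key : F → I ×ₗ (W ×ₗ W) := fun f =>
    toLex (max (rank f.1.1) (rank f.1.2), toLex (e f.1.1, e f.1.2))
  have hkey : Function.Injective key := by
    intro f g h
    have h2 := toLex.injective (Prod.ext_iff.1 (toLex.injective h)).2
    exact Subtype.ext (Prod.ext
      (e.injective (Prod.ext_iff.1 h2).1) (e.injective (Prod.ext_iff.1 h2).2))
  let i1 : LinearOrder F := LinearOrder.lift' key hkey
  have i2 : WellFoundedLT F :=
    ⟨InvImage.wf key (wellFounded_lt (α := I ×ₗ (W ×ₗ W)))⟩
  have hlevel : ∀ f g : F, f ≤ g →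
      max (rank f.1.1) (rank f.1.2) ≤ max (rank g.1.1) (rank g.1.2) := fun f g h =>
    Prod.Lex.monotone_fst (key f) (key g) h
  have hcard : ∀ f : F, Cardinal.mk {g : F | g ≤ f} ≤ μ (max (rank f.1.1) (rank f.1.2)) := by
    intro f
    set i := max (rank f.1.1) (rank f.1.2) with hi
    let φ : {g : F | g ≤ f} → {x | rank x ≤ i} × {x | rank x ≤ i} := fun g =>
      (⟨g.1.1.1, (le_max_left _ _).trans (hlevel _ _ g.2)⟩,
        ⟨g.1.1.2, (le_max_right _ _).trans (hlevel _ _ g.2)⟩)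
    have hφ : Function.Injective φ := by
      intro g g' h
      have h1 := congrArg Subtype.val (Prod.ext_iff.1 h).1
      have h2 := congrArg Subtype.val (Prod.ext_iff.1 h).2
      exact Subtype.ext (Subtype.ext (Prod.ext h1 h2))
    refine (Cardinal.mk_le_of_injective hφ).trans ?_
    rw [Cardinal.mk_prod, Cardinal.lift_id]
    exact (mul_le_mul' (hrank i) (hrank i)).trans (Cardinal.mul_eq_self (hμ i)).le
  refine Reach.backEdges hD (r := Prod.Lex (· < ·) (· < ·))
    (WellFounded.prod_lex wellFounded_lt wellFounded_lt) ?_ ?_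
  · rintro ⟨f, m⟩ ⟨g, n⟩
    rcases lt_trichotomy f g with h | rfl | h
    · exact Or.inl (.left _ _ h)
    · rcases lt_trichotomy m n with h | rfl | h
      · exact Or.inl (.right _ h)
      · exact Or.inr (Or.inl rfl)
      · exact Or.inr (Or.inr (.right _ h))
    · exact Or.inr (Or.inr (.left _ _ h))
  · rintro ⟨f, n⟩ G
    have hμf := hμ (max (rank f.1.1) (rank f.1.2))
    refine f.2.2.2 _ (Order.lt_succ_iff.2 ?_)
    refine (Cardinal.mk_union_le _ _).trans (Cardinal.add_le_of_le hμf ?_ ?_)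
    · have : {e | ∃ g ≤ f, e = s(g.1.1, g.1.2)} ⊆
          (fun g : F => s(g.1.1, g.1.2)) '' {g | g ≤ f} := by
        rintro _ ⟨g, hg, rfl⟩
        exact ⟨g, hg, rfl⟩
      exact (Cardinal.mk_le_mk_of_subset this).trans (Cardinal.mk_image_le.trans (hcard f))
    · have : (⋃ k, ⋃ (_ : Prod.Lex (· < ·) (· < ·) k (f, n)), arcEdges (G k)) ⊆
          ⋃ k : {g : F | g ≤ f} × ULift.{u} ℕ, arcEdges (G (k.1, k.2.down)) := by
        refine iUnion₂_subset fun k hk => ?_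
        have hk' : k.1 ≤ f := by
          rcases Prod.lex_def.1 hk with h | h
          · exact h.le
          · exact h.1.le
        exact subset_iUnion (fun k : {g : F | g ≤ f} × ULift.{u} ℕ => arcEdges (G (k.1, k.2.down)))
          (⟨k.1, hk'⟩, ⟨k.2⟩)
      refine (Cardinal.mk_le_mk_of_subset this).trans (mk_iUnion_le_of_forall_le hμf ?_ fun k => ?_)
      · rw [Cardinal.mk_prod, Cardinal.lift_id, Cardinal.lift_id, Cardinal.mk_uLift,
          Cardinal.mk_nat, Cardinal.lift_aleph0]
        exact (mul_le_mul' (hcard f) hμf).trans (Cardinal.mul_eq_self hμf).le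
      · exact (Cardinal.lt_aleph0_iff_set_finite.2 (finite_arcEdges _)).le.trans hμf

theorem Reducible.of_aleph0_lt (hV : Cardinal.aleph0 < Cardinal.mk V) {D : Digraph V}
    (hD : IsTournament D)
    (ih : ∀ K : Set V, Cardinal.mk K < Cardinal.mk V → ∀ D' : Digraph K, IsTournament D' →
      Reducible D') : Reducible D := by
  obtain ⟨I, _, _, μ, rank, hμm, hμ0, hμV, hrank, hsep⟩ := exists_rank D hV
  have hanti : ∀ i j a b, i ≤ j → Connected D (Order.succ (μ j)) a b →
      Connected D (Order.succ (μ i)) a b := fun i j a b hij h =>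
    h.mono (Order.succ_le_succ (hμm hij))
  obtain ⟨p, hirr, htr, htot, hp⟩ := exists_strictOrder
    (C := fun i => Connected D (Order.succ (μ i))) hanti (fun _ _ _ _ h h' => h.trans h')
  obtain ⟨T, hT⟩ := exists_reach_backEdges_of_rank hD p hμ0 hrank
  set D' := toggle D (backEdges D p (LevelConnected D μ rank)) with hD'
  have hD'T : IsTournament D' := hD.toggle _
  refine Reducible.of_reach hT (Reducible.of_strongComponents fun v => ?_)
  set K := strongComponent D' v with hK
  -- A component of bounded rank has fewer than `|V|` vertices.
  by_cases hbd : ∃ i, ∀ x ∈ K, rank x ≤ i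
  · obtain ⟨i, hi⟩ := hbd
    exact ih K (((Cardinal.mk_le_mk_of_subset hi).trans (hrank i)).trans_lt (hμV i)) _
      (hD'T.restrict K)
  push Not at hbd
  have hreach : ∀ a ∈ K, ∀ b ∈ K, Relation.ReflTransGen D'.Adj a b :=
    fun a ha b hb => ha.2.trans hb.1
  have hint := fun (i : I) (x y z : V) (h : Connected D (Order.succ (μ i)) x y) =>
    h.adj_or hD ((hμ0 i).trans (Order.le_succ _)) z
  have hadj : ∀ i a b, a ∈ {x | rank x ≤ i} → b ∈ {x | rank x ≤ i} → D'.Adj a b →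
      Connected D (Order.succ (μ i)) b a → Connected D (Order.succ (μ i)) a b := by
    intro i a b ha hb hab hba
    by_contra hcon
    have hpba : p b a := hp i _ _ hba hcon
    rcases toggle_backEdges_adj hD hab with h | h
    · exact hirr _ (htr _ _ _ h.1 hpba)
    · exact h.2 hpba (hanti _ i _ _ (max_le hb ha) hba)
  have hexc : ∀ i a b, a ∈ {x | rank x ≤ i} → b ∈ {x | rank x ≤ i} → Relation.TransGen
      (fun x y => D'.Adj x y ∧ ¬ (x ∈ {x | rank x ≤ i} ∧ y ∈ {x | rank x ≤ i})) a b →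
      Connected D (Order.succ (μ i)) a b := by
    intro i a b ha hb hab
    by_contra hcon
    obtain ⟨E, hEc, hE, hn⟩ := hsep i a b ha hb hcon
    -- An arc of the detour either joins a pair connected at its own level, which is at least `i`,
    -- and is replaced by a walk of `D` avoiding `E`; or it is an arc of `D` with an end of rank
    -- above `i`, hence not in `E`.
    refine hn (hab.lift' id ?_)
    rintro x y ⟨hxy, hM⟩
    rcases toggle_backEdges_adj hD hxy with h | h
    · have hi : i ≤ max (rank x) (rank y) := by
        by_contra! hlt
        exact hM ⟨(le_max_left _ _).trans hlt.le, (le_max_right _ _).trans hlt.le⟩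
      exact hanti _ _ _ _ hi h.2 E (Order.lt_succ_iff.2 hEc)
    · exact .single ⟨h.1, fun h' => hM (hE x y h')⟩
  have hall : ∀ i a b, a ∈ K → b ∈ K → rank a ≤ i → rank b ≤ i →
      Connected D (Order.succ (μ i)) a b := by
    intro i a b ha hb hai hbi
    -- A walk from `a` to `b` through a vertex of rank above `i` contains a detour, whose ends are
    -- therefore connected at level `i`; connectivity is then carried along the rest of the walk to
    -- `a` and `b`.
    obtain ⟨w, hw, hwi⟩ := hbd i
    obtain ⟨x, hx, hax, hxw⟩ := exists_last_mem (M := {x | rank x ≤ i}) hai (hreach a ha w hw)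
    obtain ⟨y, hy, hyb, hwy⟩ := exists_first_mem (M := {x | rank x ≤ i}) hbi (hreach w hw b hb)
    have hxw' := (Relation.reflTransGen_iff_eq_or_transGen.1 hxw).resolve_left
      fun h => hwi.not_ge (h ▸ hx)
    have hxy := hexc i x y hx hy (hxw'.trans_left hwy)
    have hxb := rel_of_reflTransGen_right (fun _ _ _ => Connected.trans) (hint i) (hadj i)
      (hexc i) hy hbi hxy hyb
    exact rel_of_reflTransGen_left (fun _ _ _ => Connected.trans) (hint i) (hadj i)
      (hexc i) hx hai hxb hax
  refine Reducible.of_adj_imp (r := fun x y : K => p x y) (fun x => hirr x)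
    (fun x y z => htr x y z) ?_
  rintro ⟨x, hx⟩ ⟨y, hy⟩ hxy
  rcases toggle_backEdges_adj hD hxy with h | h
  · exact h.1
  · refine (htot x y (hD.ne h.1)).resolve_right fun h' => h.2 h' ?_
    exact hall _ y x hy hx (le_max_left _ _) (le_max_right _ _)

theorem Reducible.of_isTournament {D : Digraph V} (hD : IsTournament D) : Reducible D := by
  induction hκ : Cardinal.mk V using WellFoundedLT.induction generalizing V with | ind κ ih =>
  subst hκ
  rcases le_or_gt (Cardinal.mk V) Cardinal.aleph0 with h | h
  · have := Cardinal.mk_le_aleph0_iff.1 h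
    exact Reducible.of_countable hD
  · exact Reducible.of_aleph0_lt h hD fun K hK D' hD' => ih _ hK hD' rfl

end Uncountable

end CycleReversion

theorem mainTheorem2 {V : Type u} (D : Digraph V) (hD : CycleReversion.IsTournament D) :
    ∃ C ∈ CycleReversion.reversalSequences D,
      CycleReversion.dichromaticNumber (CycleReversion.reversed D C) ≤ 2 := by
  obtain ⟨S, T, hR, h2⟩ := CycleReversion.Reducible.of_isTournament hD
  obtain ⟨C, hC, e⟩ := hR.exists_reversalSequence hD
  exact ⟨C, hC, e ▸ h2.dichromaticNumber_le⟩
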